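/- **Model.** Let $G=(V,E)$ be a graph with $|V|=n\ge 2$ and let $Y\in\{\pm1\}^V$ be an unknown ground truth. One observes $X\in\{\pm1\}^E$ with $X_{uv}=Y_uY_v$ with probability $1-p$ and $X_{uv}=-Y_uY_v$ otherwise, and $Z\in\{\pm1\}^V$ with $Z_v=Y_v$ with probability $1-q$ and $Z_v=-Y_v$ otherwise; all measurements are independent, $0<p<q<1/2$, and $\varepsilon=1/2-q$. **Decomposition.** Let $E'\subseteq E$ (the probed edges) be such that $G'=(V,E')$ is connected, and let $T=(\mathcal W,F)$ be a tree decomposition of $G'$ (every vertex lies in some component, both ends of every edge of $G'$ lie in a common component, and $T$ is coherent: if $W_2$ is on the path of $T$ from $W_1$ to $W_3$, then $W_1\cap W_3\subseteq W_2$), non-redundant in the sense that no $W$ is contained in a neighbour of $W$ in $T$. Every $W\in\mathcal W$ has an extended component $W^\star\supseteq W$ such that the induced graph $G'(W^\star)$ is connected; $E'(W^\star)$ is its edge set. Write $\deg(T)$, $\deg(G')$ for maximum degrees, $\mathrm{wid}(T)=\max_W|W|-1$, $\mathrm{wid}^\star(T)=\max_W|W^\star|-1$, $\deg_E^\star(T)=\max_{e\in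 E'}|\{W: e\in E'(W^\star)\}|$, $M=\max_W|E'(W^\star)|$, and $$\mathrm{mincut}^\star(W)=\min\{|\delta_{G'(W^\star)}(S)|: S\subseteq W^\star,\ S\cap W\ne\emptyset,\ W\setminus S\neq\emptyset\},\qquad \Sigma=\sum_{W\in\mathcal W}p^{\lceil \mathrm{mincut}^\star(W)/2\rceil}.$$ **Algorithm** (TreeDecompositionDecoder with failure probability $\delta$). Put $K_n=4^{\mathrm{wid}^\star(T)+2}\,\Sigma+6\deg_E^\star(T)\,M\log(2/\delta)$ and $L_n=\deg(T)K_n$. (1) For each $W$ let $\widetilde Y^{W^\star}\in\{\pm1\}^{W^\star}$ minimize $\sum_{uv\in E'(W^\star)}\mathbf 1\{\widetilde Y_u\widetilde Y_v\ne X_{uv}\}$, and let $\widehat Y^{W^\star}$ be its restriction to $W$. (2) For each $W$ and $s\in\{\pm1\}$ put $\mathrm{Cost}_W[s]=\sum_{v\in W}\mathbf 1\{s\widehat Y^{W^\star}_v\neq Z_v\}$; for each $(W_1,W_2)\in F$ choose $v\in W_1\cap W_2$ and put $S(W_1,W_2)=\widehat Y^{W_1^\star}_v\widehat Y^{W_2^\star}_v$.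 Let $\hat s\in\{\pm1\}^{\mathcal W}$ minimize $\sum_W\mathrm{Cost}_W[s_W]$ subject to $\sum_{(W_1,W_2)\in F}\mathbf 1\{s_{W_1}\ne s_{W_2}S(W_1,W_2)\}\le L_n$. For each $v$ choose $W\ni v$ and output $\widehat Y_v=\hat s_W\widehat Y^{W^\star}_v$. All minimizers and choices are arbitrary, and the error bounds below hold simultaneously for all outputs $\widehat Y$ that can arise from the same $(X,Z)$. **Theorem.** (a) There is a universal constant $C>0$ such that for every $\delta\in(0,1/2]$, with probability at least $1-\delta$ over $X$ and $Z$, $$\sum_{v\in V}\mathbf 1\{\widehat Y_v\ne Y_v\}\le \frac{C}{\varepsilon^2}\,\deg(G')\deg_E^\star(T)\Big(4^{\mathrm{wid}^\star(T)}\,\Sigma+\deg_E^\star(T)\,M\log(1/\delta)\Big)\big(\mathrm{wid}(T)+\deg(T)\log n\big).$$ (b) For every $D$ there is a constant $C_D>0$ such that, if $\deg(T)$, $\deg^\star_E(T)$, $M$, $\mathrm{wid}^\star(T)$ and $\deg(G')$ are at most $D$ and $\delta=1/n$, then with probability at least $1-1/n$ $$\sum_{v\in V}\mathbf 1\{\widehat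 Y_v\ne Y_v\}\le \frac{C_D}{\varepsilon^2}\log n\,\big(\Sigma+\log n\big),$$ and, for every integer $\Delta\ge0$ with $\Delta\le\mathrm{mincut}^\star(W)$ for all $W\in\mathcal W$, with probability at least $1-1/n$ $$\sum_{v\in V}\mathbf 1\{\widehat Y_v\ne Y_v\}\le \frac{C_D}{\varepsilon^2}\log n\,\big(p^{\lceil\Delta/2\rceil}n+\log n\big).$$ (c) The implementation of the algorithm by brute-force enumeration in step (1) and dynamic programming over $T$ (with tables indexed by component, sign and number of violated edges, from an arbitrary root) in step (2), given $L_n$, always returns a possible output of the algorithm. Under the assumptions of (b), for every such $\Delta$, the number of elementary steps it takes is at most $C_D\,(\log n)^2\,\lceil p^{\Delta/2}n\rceil^2\,n$, and at most $C_D\,(\log n)^2\,\lceil p^{\Delta/2}n\rceil\,n$ when $T$ is a path. (One step is an operation on a bounded number of machine words: an arithmetic operation or comparison on signs, indices or natural numbers, an adjacency query, an array access, or the allocation of a cell.) -/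

import Mathlib

open MeasureTheory

namespace TreeDecoding

/-! ## Tree decompositions and their parameters -/

/-- `T` (given by `tree` on the index set `ι`, with component `bag i` at the node `i`) is a
non-redundant tree decomposition of the graph `H`. -/
structure IsTreeDecomposition {V ι : Type*} (H : SimpleGraph V) (tree : SimpleGraph ι)
    (bag : ι → Finset V) : Prop where
  isTree : tree.IsTree
  vertex_inclusion : ∀ v, ∃ i, v ∈ bag i
  edge_inclusion : ∀ u v, H.Adj u v → ∃ i, u ∈ bag i ∧ v ∈ bag i
  coherence : ∀ (i k : ι) (w : tree.Walk i k), w.IsPath → ∀ j ∈ w.support,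
    ∀ v, v ∈ bag i → v ∈ bag k → v ∈ bag j
  nonredundant : ∀ i j, tree.Adj i j → ¬ bag j ⊆ bag i

/-- The parameters of the decoder: the graph `G` (`graph`) on `n` vertices, the graph `G'`
(`probed`) of probed edges, the tree with its `N` components `W` (`bag i`), and the extended
components `W*` (`ext i`). -/
structure Setup (n N : ℕ) where
  graph : SimpleGraph (Fin n)
  probed : SimpleGraph (Fin n)
  tree : SimpleGraph (Fin N)
  bag : Fin N → Finset (Fin n)
  ext : Fin N → Finset (Fin n)
  decGraph : DecidableRel graph.Adj
  decProbed : DecidableRel probed.Adj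
  decTree : DecidableRel tree.Adj

attribute [instance] Setup.decGraph Setup.decProbed Setup.decTree

namespace Setup

variable {n N : ℕ} (P : Setup n N)

/-- `E'(W*)`: the probed edges with both endpoints in the extended component. -/
def extEdges (i : Fin N) : Finset (Sym2 (Fin n)) :=
  P.probed.edgeFinset.filter fun e => ∀ v ∈ e, v ∈ P.ext i

/-- `wid(T)`. -/
def wid : ℕ := (Finset.univ.sup fun i => (P.bag i).card) - 1

/-- `wid*(T)`. -/
def widStar : ℕ := (Finset.univ.sup fun i => (P.ext i).card) - 1

/-- `deg(T)`. -/
def treeDeg : ℕ := P.tree.maxDegree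

/-- `deg*_E(T)`: the largest number of extended components that contain a given probed edge. -/
def edgeDegStar : ℕ :=
  P.probed.edgeFinset.sup fun e => (Finset.univ.filter fun i => e ∈ P.extEdges i).card

/-- `max_W |E'(W*)|`. -/
def maxExtEdges : ℕ := Finset.univ.sup fun i => (P.extEdges i).card

/-- `mincut*(W)`: the least number of edges of `G'(W*)` between `S` and `W* \ S`, over the sets
`S ⊆ W*` that separate two vertices of `W`.  (There is such an `S` as soon as `W` has two
vertices.) -/
noncomputable def mincutStar (i : Fin N) : ℕ :=
  sInf {k | ∃ S ⊆ P.ext i, (S ∩ P.bag i).Nonempty ∧ (P.bag i \ S).Nonempty ∧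
    k = (P.probed.interedges S (P.ext i \ S)).card}

/-- `∑_W p ^ ⌈mincut*(W) / 2⌉`. -/
noncomputable def cutSum (p : ℝ) : ℝ := ∑ i, p ^ ((P.mincutStar i + 1) / 2)

/-- The qualitative part of admissibility. -/
structure IsAdmissible : Prop where
  probed_le : P.probed ≤ P.graph
  isTreeDecomposition : IsTreeDecomposition P.probed P.tree P.bag
  bag_subset_ext : ∀ i, P.bag i ⊆ P.ext i
  ext_connected : ∀ i, (P.probed.induce {v | v ∈ P.ext i}).Connected

/-- The quantitative part of admissibility, together with bounded degree of the probed graph: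
all the quantities that have to be constant are at most `D`. -/
structure BoundedBy (D : ℕ) : Prop where
  treeDeg_le : P.treeDeg ≤ D
  edgeDegStar_le : P.edgeDegStar ≤ D
  maxExtEdges_le : P.maxExtEdges ≤ D
  widStar_le : P.widStar ≤ D
  maxDegree_le : P.probed.maxDegree ≤ D

end Setup

/-! ## The observation model -/

instance : DiscreteMeasurableSpace ℤˣ where
  forall_measurableSet s := by
    refine ⟨Units.val '' s, trivial, ?_⟩
    exact Set.preimage_image_eq s Units.val_injective

/-- The product `y u * y v` of the labels at the two ends of `e = uv`. -/
def edgeProd {V : Type*} (y : V → ℤˣ) (e : Sym2 V) : ℤˣ := (e.map y).mul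

/-- The sign `y`, flipped with probability `p`. -/
noncomputable def noisySign (p : ℝ) (y : ℤˣ) : Measure ℤˣ :=
  ENNReal.ofReal (1 - p) • Measure.dirac y + ENNReal.ofReal p • Measure.dirac (-y)

variable {n N : ℕ}

/-- Edge measurements `X`. -/
abbrev EdgeObs (P : Setup n N) : Type := P.graph.edgeSet → ℤˣ

/-- Vertex measurements `Z`. -/
abbrev VertexObs (n : ℕ) : Type := Fin n → ℤˣ

/-- The law of `(X, Z)` for the ground truth `Y`: all measurements are independent, edge
measurements are flipped with probability `p`, vertex measurements with probability `q`. -/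
noncomputable def obsLaw (P : Setup n N) (Y : Fin n → ℤˣ) (p q : ℝ) :
    Measure (EdgeObs P × VertexObs n) :=
  (Measure.pi fun e : P.graph.edgeSet => noisySign p (edgeProd Y e)).prod
    (Measure.pi fun v => noisySign q (Y v))

/-! ## What the decoder computes -/

namespace Setup

variable (P : Setup n N)

/-- `K_n`, the bound for the number of components on which the first stage fails. -/
noncomputable def errBudget (p δ : ℝ) : ℝ :=
  4 ^ (P.widStar + 2) * P.cutSum p
    + 6 * P.edgeDegStar * P.maxExtEdges * Real.log (2 / δ)

/-- `L_n = deg(T) * K_n`, the number of violated edges that is allowed in the second stage. -/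
noncomputable def treeBudget (p δ : ℝ) : ℝ := P.treeDeg * P.errBudget p δ

/-- The number of edges of `E'(W*)` whose measurement disagrees with the labeling `y`. -/
def disagreements (X : EdgeObs P) (i : Fin N) (y : Fin n → ℤˣ) : ℕ :=
  (Finset.univ.filter fun e : P.graph.edgeSet =>
    (e : Sym2 (Fin n)) ∈ P.extEdges i ∧ edgeProd y e ≠ X e).card

/-- `Cost_W[s]`. -/
def bagCost (Z : VertexObs n) (est : Fin N → Fin n → ℤˣ) (i : Fin N) (s : ℤˣ) : ℕ :=
  ((P.bag i).filter fun v => s * est i v ≠ Z v).card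

/-- The number of edges `(W₁, W₂)` of the tree with `s W₁ ≠ s W₂ * S(W₁, W₂)`, where
`S(W₁, W₂)` is read off at the common vertex `link (W₁, W₂)`. -/
def violations (est : Fin N → Fin n → ℤˣ) (link : Sym2 (Fin N) → Fin n) (s : Fin N → ℤˣ) : ℕ :=
  (P.tree.edgeFinset.filter fun e => edgeProd s e ≠ edgeProd (fun i => est i (link e)) e).card

/-- `Yhat` is a possible output of the decoder, for the failure probability `δ` and the input
`X`, `Z`, with some resolution of the arbitrary choices: of the minimizers `est i` (only the
values of `est i` on `W*` matter, and only those on `W` are used), of the common vertices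
`link e` of adjacent components, of the minimizer `s`, and of the component `home v` of each
vertex. -/
def IsOutput (p δ : ℝ) (X : EdgeObs P) (Z : VertexObs n) (Yhat : Fin n → ℤˣ) : Prop :=
  ∃ (est : Fin N → Fin n → ℤˣ) (link : Sym2 (Fin N) → Fin n) (s : Fin N → ℤˣ)
    (home : Fin n → Fin N),
    (∀ i y, P.disagreements X i (est i) ≤ P.disagreements X i y) ∧
    (∀ i j, P.tree.Adj i j → link s(i, j) ∈ P.bag i ∩ P.bag j) ∧
    (P.violations est link s : ℝ) ≤ P.treeBudget p δ ∧
    (∀ s' : Fin N → ℤˣ, (P.violations est link s' : ℝ) ≤ P.treeBudget p δ →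
      ∑ i, P.bagCost Z est i (s i) ≤ ∑ i, P.bagCost Z est i (s' i)) ∧
    (∀ v, v ∈ P.bag (home v)) ∧
    (∀ v, Yhat v = s (home v) * est (home v) v)

end Setup

/-! ## Programs with a step count

A program is a value together with the number of elementary steps spent on it.  Steps add up
under sequencing.  One step pays for an operation on a bounded number of machine words (signs,
vertices, components, natural numbers, pointers): an arithmetic operation, a comparison, an
adjacency query, the allocation of a cell, an access to an array. -/

structure Timed (α : Type) where
  val : α
  time : ℕ

namespace Timed

instance : Monad Timed where
  pure a := ⟨a, 0⟩
  bind x f := ⟨(f x.val).val, x.time + (f x.val).time⟩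

/-- Spend `k` steps. -/
def tick (k : ℕ) : Timed Unit := ⟨(), k⟩

/-- Read an array. -/
def fetch {ι α : Type} (a : ι → α) (i : ι) : Timed α := ⟨a i, 1⟩

/-- Loop over a list; each iteration costs one step more than its body. -/
def forEach {α β : Type} : List α → β → (β → α → Timed β) → Timed β
  | [], b, _ => pure b
  | a :: l, b, f => do
    tick 1
    let b' ← f b a
    forEach l b' f

/-- Fill an array with the index set `Fin m`. -/
def fillFin {α : Type} {m : ℕ} (f : Fin m → Timed α) : Timed (Fin m → α) :=
  ⟨fun i => (f i).val, ∑ i, ((f i).time + 1)⟩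

/-- Fill an array with the indices `0, …, L`. -/
def fillUpTo {α : Type} (L : ℕ) (f : ℕ → Timed α) : Timed (ℕ → α) :=
  ⟨fun k => (f (min k L)).val, ∑ k ∈ Finset.range (L + 1), ((f k).time + 1)⟩

/-- Fill an array with the indices `1, -1`. -/
def fillSign {α : Type} (f : ℤˣ → Timed α) : Timed (ℤˣ → α) := do
  tick 2
  let a ← f 1
  let b ← f (-1)
  pure fun s => if s = 1 then a else b

end Timed

open Timed

namespace Setup

variable (P : Setup n N)

/-! ### First stage -/

/-- All labelings of the vertices in a list (with the value `1` at all other vertices). -/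
def labelings : List (Fin n) → List (Fin n → ℤˣ)
  | [] => [fun _ => 1]
  | v :: l => (labelings l).flatMap fun y => [y, Function.update y v (-1)]

/-- Read one label of a labeling that is stored as a list of `m` pairs (vertex, label). -/
def readLabel (m : ℕ) (y : Fin n → ℤˣ) (v : Fin n) : Timed ℤˣ := do
  tick (m + 1)
  pure (y v)

/-- Read the measurement of the edge `uv`. -/
def readEdge (X : EdgeObs P) (u v : Fin n) : Timed ℤˣ := do
  tick 1
  pure (if h : P.graph.Adj u v then X ⟨s(u, v), h⟩ else 1)

/-- The number of probed edges with ends in the list whose measurement disagrees with `y`. -/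
def energyProg (X : EdgeObs P) (l : List (Fin n)) (y : Fin n → ℤˣ) : Timed ℕ :=
  forEach l 0 fun acc u => forEach l acc fun acc v => do
    tick 2
    if u < v ∧ P.probed.Adj u v then
      let x ← P.readEdge X u v
      let a ← readLabel l.length y u
      let b ← readLabel l.length y v
      tick 3
      pure (if a * b ≠ x then acc + 1 else acc)
    else pure acc

/-- Brute-force search for a labeling with the least number of disagreements. -/
def estimatorProg (X : EdgeObs P) (l : List (Fin n)) : Timed (Fin n → ℤˣ) := do
  -- list all labelings, each of them of length at most `l.length`
  tick (2 ^ (l.length + 1) * (l.length + 1))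
  let e₀ ← P.energyProg X l fun _ => 1
  let best ← forEach (labelings l) (e₀, fun _ => 1) fun (best : ℕ × (Fin n → ℤˣ)) y => do
    let e ← P.energyProg X l y
    tick 1
    pure (if e < best.1 then (e, y) else best)
  pure best.2

/-! ### Costs and signs for the second stage -/

def costProg (Z : VertexObs n) (est : Fin N → Fin n → ℤˣ) (i : Fin N) (s : ℤˣ) : Timed ℕ :=
  forEach ((P.bag i).sort (· ≤ ·)) 0 fun acc v => do
    let y ← readLabel (P.ext i).card (est i) v
    let z ← fetch Z v
    tick 3
    pure (if s * y ≠ z then acc + 1 else acc)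

/-- The first common vertex of two components, found by comparing their vertex lists. -/
def linkProg (i j : Fin N) : Timed (Option (Fin n)) :=
  forEach ((P.bag i).sort (· ≤ ·)) none fun acc v => do
    tick ((P.bag j).card + 2)
    pure (if acc.isNone ∧ v ∈ P.bag j then some v else acc)

/-- `S(W₁, W₂)`. -/
def signProg (est : Fin N → Fin n → ℤˣ) (i j : Fin N) : Timed ℤˣ := do
  let o ← P.linkProg i j
  match o with
  | none => pure 1
  | some v => do
    let a ← readLabel (P.ext i).card (est i) v
    let b ← readLabel (P.ext j).card (est j) v
    tick 1
    pure (a * b)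

/-! ### Dynamic programming over the tree -/

/-- A labeling of some components, stored as a binary tree of pointers. -/
inductive Labels (N : ℕ) : Type
  | single (i : Fin N) (s : ℤˣ) : Labels N
  | join (a b : Labels N) : Labels N

/-- For a sign `s` and a budget `k`: the least cost of a labeling of a subtree whose root has
the label `s`, with at most `k` violated edges, and a labeling with that cost. -/
abbrev Table (N : ℕ) : Type := ℤˣ → ℕ → ℕ × Labels N

def better (a b : ℕ × Labels N) : Timed (ℕ × Labels N) := do
  tick 1
  pure (if b.1 < a.1 then b else a)

/-- Add the costs and join the labelings. -/
def addCells (a b : ℕ × Labels N) : Timed (ℕ × Labels N) := do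
  tick 2
  pure (a.1 + b.1, Labels.join a.2 b.2)

/-- The table of a component without the subtrees below it. -/
def baseTable (L : ℕ) (cost : Fin N → ℤˣ → ℕ) (u : Fin N) : Timed (Table N) :=
  fillSign fun s => fillUpTo L fun _ => do
    tick 2
    pure (cost u s, Labels.single u s)

/-- From the table `g` of a child, the table in terms of the label `t` and the budget `k` of the
parent, with the edge to the parent taken into account; `sg` is the sign of that edge. -/
def messageTable (L : ℕ) (sg : ℤˣ) (g : Table N) : Timed (Table N) :=
  fillSign fun t => fillUpTo L fun k => do
    tick 2
    let a ← fetch (g (t * sg)) k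
    if k = 0 then pure a
    else
      let b ← fetch (g (-(t * sg))) (k - 1)
      better a b

/-- Combine the base table of a component with the message of its first child (one cell of the
base table is enough, because its entries do not depend on the budget). -/
def attachFirst (L : ℕ) (base h : Table N) : Timed (Table N) :=
  fillSign fun s => fillUpTo L fun k => do
    let a ← fetch (base s) 0
    let b ← fetch (h s) k
    addCells a b

/-- Combine the table of a component, with some subtrees attached, with the message of one more
child, over all ways to split the budget. -/
def attachNext (L : ℕ) (g h : Table N) : Timed (Table N) :=
  fillSign fun s => fillUpTo L fun k => do
    let a ← fetch (g s) k
    let b ← fetch (h s) 0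
    let c ← addCells a b
    forEach (List.range k) c fun c j => do
      tick 2
      let a ← fetch (g s) (k - (j + 1))
      let b ← fetch (h s) (j + 1)
      let c' ← addCells a b
      better c c'

/-- The table of the subtree below `u`, where `parent` is the component above `u`, if there is
one.  The recursion depth is at most `fuel`. -/
def solveProg (L : ℕ) (est : Fin N → Fin n → ℤˣ) (cost : Fin N → ℤˣ → ℕ) :
    ℕ → Option (Fin N) → Fin N → Timed (Table N)
  | 0, _, u => baseTable L cost u
  | fuel + 1, parent, u => do
    let base ← baseTable L cost u
    let nbrs := (P.tree.neighborFinset u).sort (· ≤ ·)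
    tick nbrs.length
    match nbrs.filter fun c => parent ≠ some c with
    | [] => pure base
    | c :: cs => do
      let g ← solveProg L est cost fuel (some u) c
      let sg ← P.signProg est u c
      let h ← messageTable L sg g
      let t ← attachFirst L base h
      forEach cs t fun t c => do
        let g ← solveProg L est cost fuel (some u) c
        let sg ← P.signProg est u c
        let h ← messageTable L sg g
        attachNext L t h

/-- Write a labeling into an array. -/
def writeLabels : Labels N → (Fin N → ℤˣ) → Timed (Fin N → ℤˣ)
  | Labels.single i s, a => do
    tick 1
    pure (Function.update a i s)
  | Labels.join l r, a => do
    tick 1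
    let a' ← writeLabels l a
    writeLabels r a'

/-- Minimize the total cost over the labelings of the tree with at most `L` violated edges. -/
def treeDecoder (L : ℕ) (root : Fin N) (est : Fin N → Fin n → ℤˣ) (cost : Fin N → ℤˣ → ℕ) :
    Timed (Fin N → ℤˣ) := do
  let t ← P.solveProg L est cost N none root
  let a ← fetch (t 1) L
  let b ← fetch (t (-1)) L
  let c ← better a b
  let init ← fillFin fun _ => pure 1
  writeLabels c.2 init

/-! ### The decoder -/

/-- For each vertex, a component that contains it. -/
def homeProg (root : Fin N) : Timed (Fin n → Fin N) := do
  let init ← fillFin fun _ => pure root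
  forEach (List.finRange N) init fun h i =>
    forEach ((P.bag i).sort (· ≤ ·)) h fun h v => do
      tick 1
      pure (Function.update h v i)

/-- The decoder with the budget `L` for violated edges.  The tree is given by adjacency lists,
components and extended components by vertex lists, the graphs by adjacency matrices; the tree
is traversed from the component `root`. -/
def decoder (L : ℕ) (root : Fin N) (X : EdgeObs P) (Z : VertexObs n) :
    Timed (Fin n → ℤˣ) := do
  let est ← fillFin fun i => P.estimatorProg X ((P.ext i).sort (· ≤ ·))
  let cost ← fillFin fun i => fillSign fun s => P.costProg Z est i s
  let s ← P.treeDecoder L root est cost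
  let home ← P.homeProg root
  fillFin fun v => do
    let i ← fetch home v
    let a ← fetch s i
    let y ← readLabel (P.ext i).card (est i) v
    tick 1
    pure (a * y)

/-- The decoder with failure probability `δ`, whose budget is the constant `L_n`. -/
noncomputable def treeDecompositionDecoder (p δ : ℝ) (root : Fin N) (X : EdgeObs P)
    (Z : VertexObs n) : Timed (Fin n → ℤˣ) :=
  P.decoder ⌊P.treeBudget p δ⌋₊ root X Z

end Setup

end TreeDecoding

/-! First stage. Suppose the estimate on `W*` is neither `Y` nor `-Y` on `W`. The set `S` of
vertices of `W*` where it differs from `Y` then separates two vertices of `W`. On edges that do not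
cross `S` the two labelings predict the same measurement, and on crossing edges they predict
opposite ones. By minimality, at least half of the crossing edges are flipped
(`eq_or_eq_neg_of_not_corrupted`). For one cut this has probability at most `(4p) ^ ⌈mincut*(W)/2⌉`
(`measure_half_flipped_le`), and a union bound over `S` costs a factor `2 ^ (wid* + 1)`. The event
for `W` depends only on the edges in `E'(W*)`, so it shares measurements with at most `d = deg*_E ·
M` others. Colour the events with `d + 1` colours so that each class is independent. Averaging
exponential moments over the classes gives a Chernoff bound for the number of failures
(`measure_card_ge_le`), so at most `K_n` components are bad with probability at least `1 - δ/2`.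

Second stage. On a good component the estimate is `σ_W Y`. The signs `σ` violate only tree edges at
bad components, hence at most `deg(T) K_n = L_n` of them, so `σ` competes with the chosen `s`. Let
`D` be the set of good components with `s ≠ σ`. A tree edge on the boundary of `D` is violated by
`s` or touches a bad component, so there are at most `2 L_n` of them. Optimality of `s` bounds the
sum of `Y_v Z_v` over the bags in `D` by `K_n (wid + 1)` (`IsOutput.exists_flipped`). On the other
hand, each `Y_v Z_v` has mean `2ε`, and a set of components is determined by its boundary and its
membership at the root, so only about `N ^ (2 L_n)` sets can occur as `D`. A Chernoff bound, uniform
over them, gives a lower bound `ε ∑ |W| - O(log) / ε` for the same sum (`measure_uninformative_le`).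
Comparing the two bounds `∑_{W ∈ D} |W|`. Every error lies in a bad bag or in a bag of `D`. Both
exceptional events concern only `X` and `Z`, so the bound holds for all outputs at once.

Program. Each table entry is an optimal labeling of a subtree under a budget of violated edges
(`IsTable`). Violations add up over the subtrees below a component and the edges to them, so tables
combine by splitting the budget (`isTable_solveProg`). The first child needs no split and costs
`O(L)`; every further child costs `O(L ^ 2)`. The quadratic cost is therefore multiplied by the
number of extra children, which is at most one in a path, and this separates the two running times.
-/

namespace TreeDecoding

open Timed

/-! ## Rooted trees -/

section Rooted

variable {ι : Type*} {T : SimpleGraph ι}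

open Classical in
/-- The neighbour of `x` that is closer to the root `r`. -/
noncomputable def parent (T : SimpleGraph ι) (r x : ι) : ι :=
  if h : ∃ y, T.Adj x y ∧ T.dist r y + 1 = T.dist r x then h.choose else x

theorem parent_spec (hT : T.IsTree) {r x : ι} (hx : x ≠ r) :
    T.Adj x (parent T r x) ∧ T.dist r (parent T r x) + 1 = T.dist r x := by
  have h : ∃ y, T.Adj x y ∧ T.dist r y + 1 = T.dist r x := by
    obtain ⟨w, hw⟩ := hT.connected.exists_walk_length_eq_dist x r
    cases w with
    | nil => exact absurd rfl hx
    | @cons _ y _ hadj w =>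
      refine ⟨y, hadj, ?_⟩
      have h1 := SimpleGraph.dist_le w
      simp only [SimpleGraph.Walk.length_cons] at hw
      rw [SimpleGraph.dist_comm (u := r), SimpleGraph.dist_comm (u := r)]
      rcases hT.dist_eq_dist_add_one_of_adj r hadj with h2 | h2 <;>
      rw [SimpleGraph.dist_comm (u := r), SimpleGraph.dist_comm (u := r)] at h2 <;> omega
  rw [parent, dif_pos h]
  exact h.choose_spec

theorem parent_adj (hT : T.IsTree) {r x : ι} (hx : x ≠ r) : T.Adj x (parent T r x) :=
  (parent_spec hT hx).1

theorem parent_root (r : ι) : parent T r r = r := by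
  rw [parent, dif_neg]
  simp

theorem dist_parent (hT : T.IsTree) (r x : ι) :
    T.dist r (parent T r x) = T.dist r x - 1 := by
  by_cases hx : x = r
  · subst hx; simp [parent_root]
  · have := (parent_spec hT hx).2; omega

/-- The neighbour that is closer to the root is unique. -/
theorem eq_parent_of_dist (hT : T.IsTree) {r x y : ι} (hxy : T.Adj x y)
    (h : T.dist r y ≤ T.dist r x) : x ≠ r ∧ y = parent T r x := by
  have hx : x ≠ r := by
    rintro rfl
    have h1 := SimpleGraph.dist_eq_one_iff_adj.2 hxy
    rw [SimpleGraph.dist_self] at h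
    omega
  refine ⟨hx, ?_⟩
  -- By uniqueness of paths in a tree, a neighbour `z` that is not farther from `r` must be the
  -- second vertex of the path from `x` to `r`: the edge `xz` followed by a shortest path from `z`
  -- avoids `x`, so it is that path.
  have key : ∀ z, T.Adj x z → T.dist r z ≤ T.dist r x → ∀ p : T.Walk x r, p.IsPath →
      z = p.snd := by
    intro z hz hd p hp
    obtain ⟨q, hq, hql⟩ := (hT.connected z r).exists_path_of_dist
    have hxq : x ∉ q.support := by
      intro hxq
      have h2 := hT.isAcyclic.eq_snd_of_adj_start hq hz.symm hxq
      have hne : z ≠ r := by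
        rintro rfl
        cases q with
        | nil => simp at hxq; exact hz.ne hxq
        | cons => simp at hql
      have h3 : T.dist r x < T.dist r z := by
        rw [SimpleGraph.dist_comm, SimpleGraph.dist_comm (u := r), ← hql]
        cases q with
        | nil => exact absurd rfl hne
        | cons hadj w =>
          simp at h2
          subst h2
          have := SimpleGraph.dist_le w
          simp
          omega
      omega
    have := Subtype.mk.inj <| (hT.isAcyclic.subsingleton_path x r).elim ⟨p, hp⟩
      ⟨_, hq.cons (h := hz) hxq⟩
    rw [this]; simp
  obtain ⟨p, hp, -⟩ := (hT.connected x r).exists_path_of_dist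
  rw [key y hxy h p hp, key (parent T r x) (parent_adj hT hx) _ p hp]
  rw [dist_parent hT]; omega

theorem adj_iff_parent (hT : T.IsTree) (r : ι) {x y : ι} :
    T.Adj x y ↔ (x ≠ r ∧ y = parent T r x) ∨ (y ≠ r ∧ x = parent T r y) := by
  constructor
  · intro h
    rcases le_total (T.dist r y) (T.dist r x) with h1 | h1
    · exact Or.inl (eq_parent_of_dist hT h h1)
    · exact Or.inr (eq_parent_of_dist hT h.symm h1)
  · rintro (⟨h, rfl⟩ | ⟨h, rfl⟩)
    · exact parent_adj hT h
    · exact (parent_adj hT h).symm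

theorem dist_parent_iterate (hT : T.IsTree) (r x : ι) (k : ℕ) :
    T.dist r ((parent T r)^[k] x) = T.dist r x - k := by
  induction k generalizing x with
  | zero => simp
  | succ k ih => rw [Function.iterate_succ_apply, ih, dist_parent hT]; omega

theorem parent_iterate_dist (hT : T.IsTree) (r x : ι) :
    (parent T r)^[T.dist r x] x = r := by
  have h := dist_parent_iterate hT r x (T.dist r x)
  rw [Nat.sub_self, (hT.connected r _).dist_eq_zero_iff] at h
  exact h.symm

/-- `x` lies in the subtree below `u`. -/
def Below (T : SimpleGraph ι) (r u x : ι) : Prop := ∃ k, (parent T r)^[k] x = u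

theorem below_self (r u : ι) : Below T r u u := ⟨0, rfl⟩

theorem below_root (hT : T.IsTree) (r x : ι) : Below T r r x := ⟨_, parent_iterate_dist hT r x⟩

theorem Below.of_parent {r u x : ι} (h : Below T r u (parent T r x)) : Below T r u x := by
  obtain ⟨k, hk⟩ := h
  exact ⟨k + 1, hk⟩

theorem Below.parent {r u x : ι} (h : Below T r u x) (hne : x ≠ u) :
    Below T r u (parent T r x) := by
  obtain ⟨k, hk⟩ := h
  cases k with
  | zero => exact absurd hk hne
  | succ k => exact ⟨k, hk⟩

theorem Below.dist_le (hT : T.IsTree) {r u x : ι} (h : Below T r u x) :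
    T.dist r u ≤ T.dist r x := by
  obtain ⟨k, rfl⟩ := h
  rw [dist_parent_iterate hT]; omega

theorem Below.eq_of_dist_eq (hT : T.IsTree) {r u v x : ι} (hu : Below T r u x)
    (hv : Below T r v x) (h : T.dist r u = T.dist r v) : u = v := by
  obtain ⟨k, rfl⟩ := hu
  obtain ⟨l, rfl⟩ := hv
  rw [dist_parent_iterate hT, dist_parent_iterate hT] at h
  have hr : ∀ m, (_root_.TreeDecoding.parent T r)^[m] r = r := fun m =>
    Function.iterate_fixed (parent_root r) m
  -- Iterates beyond the depth of `x` stay at the root; this covers the case where `k` and `l`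
  -- differ although the distances agree.
  have main : ∀ m, T.dist r x ≤ m → (_root_.TreeDecoding.parent T r)^[m] x = r := by
    intro m hm
    obtain ⟨j, rfl⟩ := Nat.exists_eq_add_of_le hm
    rw [add_comm, Function.iterate_add_apply, parent_iterate_dist hT, hr]
  by_cases hk : T.dist r x ≤ k
  · rw [main k hk, main l (by omega)]
  · rw [show k = l by omega]

theorem below_iff {r u x : ι} :
    Below T r u x ↔ x = u ∨ ∃ c, c ≠ r ∧ parent T r c = u ∧ Below T r c x := by
  constructor
  · rintro ⟨k, hk⟩
    induction k generalizing u with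
    | zero => exact Or.inl hk
    | succ k ih =>
      rw [Function.iterate_succ_apply'] at hk
      -- `parent` fixes the root, so the last iteration may be idle; it is dropped in that case, so
      -- that the child `c` is never the root.
      by_cases hr : (parent T r)^[k] x = r
      · have : u = (parent T r)^[k] x := by rw [hr, ← hk, hr, parent_root]
        exact ih this.symm
      · exact Or.inr ⟨_, hr, hk, k, rfl⟩
  · rintro (rfl | ⟨c, -, hc, k, hk⟩)
    · exact below_self _ _
    · exact ⟨k + 1, by rw [Function.iterate_succ_apply', hk, hc]⟩

theorem not_below_child (hT : T.IsTree) {r c : ι} (hc : c ≠ r) :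
    ¬ Below T r c (parent T r c) := by
  intro h
  have := h.dist_le hT
  have := (parent_spec hT hc).2
  omega

/-- Siblings have the same depth, and `x` has only one ancestor at each depth. -/
theorem below_child_unique (hT : T.IsTree) {r c d x : ι} (hc : c ≠ r) (hd : d ≠ r)
    (h : parent T r c = parent T r d) (hcx : Below T r c x) (hdx : Below T r d x) : c = d := by
  refine hcx.eq_of_dist_eq hT hdx ?_
  have h1 := (parent_spec hT hc).2
  have h2 := (parent_spec hT hd).2
  rw [h] at h1
  omega

/-- A path that starts downwards goes downwards. -/
theorem below_of_path (hT : T.IsTree) {r x y z : ι} (h : T.Adj x y) (p : T.Walk y z)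
    (hp : (SimpleGraph.Walk.cons h p).IsPath) (hxy : y ≠ r ∧ x = parent T r y) :
    T.dist r x < T.dist r z := by
  induction p generalizing x with
  | nil => have := (parent_spec hT hxy.1).2; rw [← hxy.2] at this; omega
  | @cons y w z hyw p ih =>
    have h1 := (parent_spec hT hxy.1).2
    rw [← hxy.2] at h1
    have hp' := hp.of_cons
    rcases (adj_iff_parent hT r).1 hyw with ⟨-, h2⟩ | h2
    · exfalso
      rw [← hxy.2] at h2
      subst h2
      rw [SimpleGraph.Walk.isPath_def] at hp
      simp at hp
    · have := ih hyw hp' h2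
      omega

/-- The path from `x` to a vertex that is not farther from the root goes through the parent. -/
theorem parent_mem_path (hT : T.IsTree) {r x z : ι} (p : T.Walk x z) (hp : p.IsPath) (hxz : x ≠ z)
    (h : T.dist r z ≤ T.dist r x) : x ≠ r ∧ parent T r x ∈ p.support := by
  cases p with
  | nil => exact absurd rfl hxz
  | @cons _ y _ hadj p =>
    rcases (adj_iff_parent hT r).1 hadj with ⟨h1, h2⟩ | h1
    · exact ⟨h1, by rw [← h2]; simp⟩
    · have := below_of_path hT hadj p hp h1
      omega

theorem edgeFinset_eq_image_parent [Fintype ι] [DecidableEq ι] [DecidableRel T.Adj]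
    (hT : T.IsTree) (r : ι) :
    T.edgeFinset = (Finset.univ.erase r).image fun x => s(x, parent T r x) := by
  ext e
  induction e with | _ x y => ?_
  simp only [SimpleGraph.mem_edgeFinset, SimpleGraph.mem_edgeSet, Finset.mem_image,
    Finset.mem_erase, Finset.mem_univ, and_true, adj_iff_parent hT r, Sym2.eq_iff]
  constructor
  · rintro (⟨h, rfl⟩ | ⟨h, rfl⟩)
    · exact ⟨x, h, Or.inl ⟨rfl, rfl⟩⟩
    · exact ⟨y, h, Or.inr ⟨rfl, rfl⟩⟩
  · rintro ⟨z, hz, ⟨rfl, rfl⟩ | ⟨rfl, rfl⟩⟩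
    · exact Or.inl ⟨hz, rfl⟩
    · exact Or.inr ⟨hz, rfl⟩

/-- The vertex `x` is recovered from the edge to its parent as the end farther from the root. -/
theorem edge_parent_injOn (hT : T.IsTree) (r : ι) :
    Set.InjOn (fun x => s(x, parent T r x)) {x | x ≠ r} := by
  intro x hx y hy h
  simp only [Sym2.eq_iff] at h
  rcases h with ⟨h, -⟩ | ⟨h1, h2⟩
  · exact h
  · have h3 := (parent_spec hT hx).2
    have h4 := (parent_spec hT hy).2
    rw [h2] at h3; rw [← h1] at h4; omega

/-- Counting edges of a tree by their lower ends. -/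
theorem card_filter_edgeFinset [Fintype ι] [DecidableEq ι] [DecidableRel T.Adj]
    (hT : T.IsTree) (r : ι) (p : Sym2 ι → Prop) [DecidablePred p] :
    (T.edgeFinset.filter p).card =
      (Finset.univ.filter fun x => x ≠ r ∧ p s(x, parent T r x)).card := by
  rw [edgeFinset_eq_image_parent hT r, Finset.filter_image, Finset.card_image_of_injOn]
  · congr 1; ext x; simp
  · intro x hx y hy h
    refine edge_parent_injOn hT r ?_ ?_ h
    · simp at hx; exact hx.1
    · simp at hy; exact hy.1

end Rooted

/-! ## Tree decompositions -/

theorem exists_adj_of_preconnected {V : Type*} {G : SimpleGraph V} (h : G.Preconnected) {x y : V}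
    (hxy : x ≠ y) : ∃ z, G.Adj x z := by
  obtain ⟨w⟩ := h x y
  cases w with
  | nil => exact absurd rfl hxy
  | cons hadj _ => exact ⟨_, hadj⟩

section Decomposition

variable {V ι : Type*} {H : SimpleGraph V} {T : SimpleGraph ι} {bag : ι → Finset V}

/-- The components that contain `v` form a subtree; this is the one closest to the root. -/
theorem IsTreeDecomposition.exists_top (h : IsTreeDecomposition H T bag) (r : ι) (v : V) :
    ∃ t, v ∈ bag t ∧ (∀ j, v ∈ bag j → T.dist r t ≤ T.dist r j) ∧
      (∀ j, v ∈ bag j → j ≠ t → j ≠ r ∧ v ∈ bag (parent T r j)) ∧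
      ∀ j, v ∈ bag j → Below T r t j := by
  obtain ⟨t, ht, hmin⟩ : ∃ t, v ∈ bag t ∧ ∀ j, v ∈ bag j → T.dist r t ≤ T.dist r j := by
    have hne : {i | v ∈ bag i}.Nonempty := h.vertex_inclusion v
    exact ⟨Function.argminOn (T.dist r) {i | v ∈ bag i} hne, Function.argminOn_mem _ _ hne,
      fun j hj => Function.argminOn_le (T.dist r) {i | v ∈ bag i} hj⟩
  have hpar : ∀ j, v ∈ bag j → j ≠ t → j ≠ r ∧ v ∈ bag (parent T r j) := by
    intro j hj hjt
    obtain ⟨p, hp, -⟩ := (h.isTree.connected j t).exists_path_of_dist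
    obtain ⟨h1, h2⟩ := parent_mem_path h.isTree p hp hjt (hmin j hj)
    exact ⟨h1, h.coherence j t p hp _ h2 v hj ht⟩
  refine ⟨t, ht, hmin, hpar, ?_⟩
  have : ∀ d j, T.dist r j = d → v ∈ bag j → Below T r t j := by
    intro d
    induction d using Nat.strong_induction_on with
    | _ d ih =>
      intro j hd hj
      by_cases hjt : j = t
      · subst hjt; exact below_self _ _
      · obtain ⟨h1, h2⟩ := hpar j hj hjt
        have h3 := (parent_spec h.isTree h1).2
        exact (ih _ (by omega) _ rfl h2).of_parent
  exact fun j => this _ j rfl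

/-- An empty bag would be contained in the bag of any neighbour. A component without a neighbour is
the only one and contains every vertex. -/
theorem IsTreeDecomposition.bag_nonempty [Nonempty V] (h : IsTreeDecomposition H T bag) (i : ι) :
    (bag i).Nonempty := by
  obtain ⟨k, hk⟩ := h.vertex_inclusion (Classical.arbitrary V)
  by_cases hik : i = k
  · exact ⟨_, hik ▸ hk⟩
  · obtain ⟨j, hj⟩ := exists_adj_of_preconnected h.isTree.connected.preconnected hik
    rw [Finset.nonempty_iff_ne_empty]
    intro h0
    exact h.nonredundant j i hj.symm (by simp [h0])

/-- By non-redundancy, each component other than the root has a vertex that is missing from its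
parent. That vertex has the component as its top, so the choice of such vertices is injective. -/
theorem IsTreeDecomposition.card_le [Fintype V] [Fintype ι] [Nonempty V]
    (h : IsTreeDecomposition H T bag) : Fintype.card ι ≤ Fintype.card V := by
  obtain ⟨r⟩ := h.isTree.connected.nonempty
  have hex : ∀ x, ∃ v, v ∈ bag x ∧ (x ≠ r → v ∉ bag (parent T r x)) := by
    intro x
    by_cases hx : x = r
    · obtain ⟨v, hv⟩ := h.bag_nonempty x
      exact ⟨v, hv, fun h => absurd hx h⟩
    · have := h.nonredundant _ _ (parent_adj h.isTree hx).symm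
      rw [Finset.not_subset] at this
      obtain ⟨v, hv, hv'⟩ := this
      exact ⟨v, hv, fun _ => hv'⟩
  choose f hf hf' using hex
  refine Fintype.card_le_of_injective f ?_
  choose t _ _ hpar _ using h.exists_top r
  have key : ∀ x, x = t (f x) := by
    intro x
    by_contra hne
    obtain ⟨h1, h2⟩ := hpar (f x) x (hf x) hne
    exact hf' x h1 h2
  intro x y hxy
  rw [key x, key y, hxy]

theorem Below.trans {r a b c : ι} (h1 : Below T r a b) (h2 : Below T r b c) : Below T r a c := by
  obtain ⟨k, rfl⟩ := h1
  obtain ⟨l, rfl⟩ := h2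
  exact ⟨k + l, by rw [Function.iterate_add_apply]⟩

/-- On the way up from `y` to `j` every component lies below `j`, so it is not `t` and passes `v` on
to its parent. The same applies to `j` itself. -/
theorem mem_of_crossing {r j t : ι} {v : V}
    (hpar : ∀ j, v ∈ bag j → j ≠ t → j ≠ r ∧ v ∈ bag (_root_.TreeDecoding.parent T r j))
    (ht : ¬ Below T r j t) {y : ι} (hy : v ∈ bag y) (hyj : Below T r j y) :
    v ∈ bag j ∧ v ∈ bag (_root_.TreeDecoding.parent T r j) := by
  obtain ⟨k, hk⟩ := hyj
  induction k generalizing y with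
  | zero =>
    simp only [Function.iterate_zero, id_eq] at hk
    subst hk
    exact ⟨hy, (hpar y hy (by rintro rfl; exact ht (below_self _ _))).2⟩
  | succ k ih =>
    have hyt : y ≠ t := by
      rintro rfl
      exact ht ⟨_, hk⟩
    exact ih (hpar y hy hyt).2 hk

/-- Adjacent components of a tree decomposition of a connected graph meet. -/
theorem IsTreeDecomposition.bag_inter_nonempty [DecidableEq V] [Nonempty V] (hH : H.Connected)
    (h : IsTreeDecomposition H T bag) {i j : ι} (hij : T.Adj i j) :
    (bag i ∩ bag j).Nonempty := by
  have hT := h.isTree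
  obtain ⟨hji, hpj⟩ : j ≠ i ∧ i = parent T i j := by
    rcases (adj_iff_parent hT i).1 hij with h1 | h1
    · exact absurd rfl h1.1
    · exact h1
  by_contra hempty
  have hemp : ∀ v, v ∈ bag j → v ∉ bag i := by
    intro v hv hv'
    exact hempty ⟨v, Finset.mem_inter.2 ⟨hv', hv⟩⟩
  -- If the two bags were disjoint, no vertex could occur on both sides of the tree edge. Occurring
  -- below `j` would then spread along the edges of the connected graph `H` to all vertices,
  -- including those of `bag i`.
  have step : ∀ u v, H.Adj u v → (∃ y, Below T i j y ∧ u ∈ bag y) →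
      ∃ y, Below T i j y ∧ v ∈ bag y := by
    rintro u v huv ⟨y, hy, hu⟩
    obtain ⟨k, hku, hkv⟩ := h.edge_inclusion u v huv
    obtain ⟨t, -, -, hpar, hbel⟩ := h.exists_top i u
    by_cases ht : Below T i j t
    · exact ⟨k, ht.trans (hbel k hku), hkv⟩
    · have := mem_of_crossing hpar ht hu hy
      rw [← hpj] at this
      exact absurd this.2 (hemp _ this.1)
  obtain ⟨u, hu⟩ := h.bag_nonempty j
  have all : ∀ v, ∃ y, Below T i j y ∧ v ∈ bag y := by
    intro v
    obtain ⟨w⟩ := hH.preconnected u v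
    have h0 : ∃ y, Below T i j y ∧ u ∈ bag y := ⟨j, below_self _ _, hu⟩
    clear hu
    induction w with
    | nil => exact h0
    | cons hadj _ ih => exact ih (step _ _ hadj h0)
  obtain ⟨v, hv⟩ := h.bag_nonempty i
  obtain ⟨y, hy, hvy⟩ := all v
  obtain ⟨t, -, hmin, hpar, hbel⟩ := h.exists_top i v
  -- The tree is rooted at `i`, so a vertex of `bag i` has its top at `i`, which is not below `j`.
  have hti : t = i := by
    have h1 := hmin i hv
    rw [SimpleGraph.dist_self, Nat.le_zero, (hT.connected i t).dist_eq_zero_iff] at h1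
    exact h1.symm
  have hnb : ¬ Below T i j t := by
    rw [hti]
    have := not_below_child hT hji
    rwa [← hpj] at this
  have := mem_of_crossing hpar hnb hvy hy
  exact hemp v this.1 hv

end Decomposition

/-! ### Size and degree bounds for an admissible decomposition -/

namespace Setup

variable {n N : ℕ} {P : Setup n N}

theorem mem_extEdges {i : Fin N} {u v : Fin n} :
    s(u, v) ∈ P.extEdges i ↔ P.probed.Adj u v ∧ u ∈ P.ext i ∧ v ∈ P.ext i := by
  simp [extEdges]

theorem card_bag_le_wid (i : Fin N) : (P.bag i).card ≤ P.wid + 1 := by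
  have := Finset.le_sup (f := fun i => (P.bag i).card) (Finset.mem_univ i)
  simp only [wid]
  omega

theorem card_ext_le_widStar (i : Fin N) : (P.ext i).card ≤ P.widStar + 1 := by
  have := Finset.le_sup (f := fun i => (P.ext i).card) (Finset.mem_univ i)
  simp only [widStar]
  omega

theorem IsAdmissible.wid_le_widStar (hP : P.IsAdmissible) : P.wid ≤ P.widStar :=
  Nat.sub_le_sub_right
    (Finset.sup_mono_fun fun i _ => Finset.card_le_card (hP.bag_subset_ext i)) 1

theorem card_extEdges_le (i : Fin N) : (P.extEdges i).card ≤ P.maxExtEdges :=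
  Finset.le_sup (f := fun i => (P.extEdges i).card) (Finset.mem_univ i)

theorem card_ext_of_edge_le {e : Sym2 (Fin n)} (he : e ∈ P.probed.edgeFinset) :
    (Finset.univ.filter fun i => e ∈ P.extEdges i).card ≤ P.edgeDegStar :=
  Finset.le_sup (f := fun e => (Finset.univ.filter fun i => e ∈ P.extEdges i).card) he

theorem IsAdmissible.card_le (hP : P.IsAdmissible) (hn : 2 ≤ n) : N ≤ n := by
  have : Nonempty (Fin n) := ⟨⟨0, by omega⟩⟩
  simpa using hP.isTreeDecomposition.card_le

theorem IsAdmissible.exists_edge (hP : P.IsAdmissible) (hc : P.probed.Connected) (hn : 2 ≤ n) :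
    ∃ i u v, P.probed.Adj u v ∧ u ∈ P.bag i ∧ v ∈ P.bag i := by
  obtain ⟨v, hv⟩ := exists_adj_of_preconnected hc.preconnected
    (x := (⟨0, by omega⟩ : Fin n)) (y := ⟨1, by omega⟩) (by simp)
  obtain ⟨i, h1, h2⟩ := hP.isTreeDecomposition.edge_inclusion _ _ hv
  exact ⟨i, _, _, hv, h1, h2⟩

theorem IsAdmissible.one_le_wid (hP : P.IsAdmissible) (hc : P.probed.Connected) (hn : 2 ≤ n) :
    1 ≤ P.wid := by
  obtain ⟨i, u, v, huv, hu, hv⟩ := hP.exists_edge hc hn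
  have h1 : 1 < (P.bag i).card := Finset.one_lt_card.2 ⟨u, hu, v, hv, huv.ne⟩
  have := P.card_bag_le_wid i
  omega

theorem IsAdmissible.one_le_maxExtEdges (hP : P.IsAdmissible) (hc : P.probed.Connected)
    (hn : 2 ≤ n) : 1 ≤ P.maxExtEdges := by
  obtain ⟨i, u, v, huv, hu, hv⟩ := hP.exists_edge hc hn
  refine le_trans ?_ (P.card_extEdges_le i)
  exact Finset.card_pos.2
    ⟨s(u, v), mem_extEdges.2 ⟨huv, hP.bag_subset_ext i hu, hP.bag_subset_ext i hv⟩⟩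

theorem IsAdmissible.one_le_edgeDegStar (hP : P.IsAdmissible) (hc : P.probed.Connected)
    (hn : 2 ≤ n) : 1 ≤ P.edgeDegStar := by
  obtain ⟨i, u, v, huv, hu, hv⟩ := hP.exists_edge hc hn
  refine le_trans ?_ (P.card_ext_of_edge_le (e := s(u, v)) (by simpa using huv))
  refine Finset.card_pos.2 ⟨i, ?_⟩
  simp [mem_extEdges, huv, hP.bag_subset_ext i hu, hP.bag_subset_ext i hv]

theorem IsAdmissible.one_le_maxDegree (hP : P.IsAdmissible) (hc : P.probed.Connected)
    (hn : 2 ≤ n) : 1 ≤ P.probed.maxDegree := by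
  obtain ⟨i, u, v, huv, hu, hv⟩ := hP.exists_edge hc hn
  refine le_trans ?_ (P.probed.degree_le_maxDegree u)
  exact (P.probed.degree_pos_iff_exists_adj u).2 ⟨v, huv⟩

/-- Every vertex of a component has an edge inside the extended component. -/
theorem IsAdmissible.exists_extEdge (hP : P.IsAdmissible) (hc : P.probed.Connected) (hn : 2 ≤ n)
    {i : Fin N} {v : Fin n} (hv : v ∈ P.bag i) :
    ∃ u, P.probed.Adj v u ∧ s(v, u) ∈ P.extEdges i := by
  have hve := hP.bag_subset_ext i hv
  by_cases h : ∃ w ∈ P.ext i, v ≠ w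
  · obtain ⟨w, hw, hne⟩ := h
    obtain ⟨⟨z, hz⟩, hadj⟩ := exists_adj_of_preconnected (hP.ext_connected i).preconnected
      (x := ⟨v, hve⟩) (y := ⟨w, hw⟩) (by simpa using hne)
    exact ⟨z, hadj, mem_extEdges.2 ⟨hadj, hve, hz⟩⟩
  -- Here `W* = {v}`. Some other bag `k` contains `v`, together with a neighbour of `v`. By
  -- coherence the next component on the path from `i` to `k` contains `v`, hence all of `W`,
  -- against non-redundancy.
  · exfalso
    push Not at h
    have hT := hP.isTreeDecomposition
    obtain ⟨w, hvw⟩ : ∃ w, w ≠ v := by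
      by_cases h0 : v = ⟨0, by omega⟩
      · exact ⟨⟨1, by omega⟩, by rw [h0]; simp⟩
      · exact ⟨_, fun h => h0 h.symm⟩
    obtain ⟨u, hu⟩ := exists_adj_of_preconnected hc.preconnected hvw.symm
    obtain ⟨k, hk, hk'⟩ := hT.edge_inclusion _ _ hu
    have hik : i ≠ k := by
      rintro rfl
      exact hu.ne (h u (hP.bag_subset_ext i hk'))
    obtain ⟨p, hp, -⟩ := (hT.isTree.connected i k).exists_path_of_dist
    obtain ⟨h1, h2⟩ := parent_mem_path (r := k) hT.isTree p hp hik (by simp)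
    have h3 := hT.coherence i k p hp _ h2 v hv hk
    refine hT.nonredundant _ _ (parent_adj hT.isTree h1).symm fun x hx => ?_
    rwa [← h x (hP.bag_subset_ext i hx)]

/-- Each component that contains `v` has an edge at `v` in its extended component, and each of the
at most `deg(G')` edges at `v` serves at most `deg*_E` components. This bounds the weight with which
a single `Z_v` enters the costs. -/
theorem IsAdmissible.card_bags_le (hP : P.IsAdmissible) (hc : P.probed.Connected) (hn : 2 ≤ n)
    (v : Fin n) :
    (Finset.univ.filter fun i => v ∈ P.bag i).card ≤ P.probed.maxDegree * P.edgeDegStar := by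
  have hsub : (Finset.univ.filter fun i => v ∈ P.bag i) ⊆
      (P.probed.neighborFinset v).biUnion
        fun u => Finset.univ.filter fun i => s(v, u) ∈ P.extEdges i := by
    intro i hi
    simp only [Finset.mem_filter, Finset.mem_univ, true_and] at hi
    obtain ⟨u, hu, he⟩ := hP.exists_extEdge hc hn hi
    simp only [Finset.mem_biUnion, SimpleGraph.mem_neighborFinset, Finset.mem_filter,
      Finset.mem_univ, true_and]
    exact ⟨u, hu, he⟩
  refine (Finset.card_le_card hsub).trans
    ((Finset.card_biUnion_le_card_mul _ _ P.edgeDegStar ?_).trans ?_)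
  · intro u hu
    exact P.card_ext_of_edge_le (by simpa using hu)
  · exact Nat.mul_le_mul_right _ (P.probed.degree_le_maxDegree v)

end Setup

/-! ## Noisy signs -/

instance isProbabilityMeasure_noisySign {p : ℝ} [h : Fact (p ∈ Set.Icc (0 : ℝ) 1)] (y : ℤˣ) :
    IsProbabilityMeasure (noisySign p y) := by
  refine ⟨?_⟩
  have h0 := h.out.1
  have h1 := h.out.2
  simp only [noisySign, Measure.coe_add, Measure.coe_smul, Pi.add_apply, Pi.smul_apply,
    measure_univ, smul_eq_mul, mul_one]
  rw [← ENNReal.ofReal_add (by linarith) h0]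
  simp

theorem integral_noisySign {p : ℝ} (h : p ∈ Set.Icc (0 : ℝ) 1) (y : ℤˣ) (f : ℤˣ → ℝ) :
    ∫ x, f x ∂noisySign p y = (1 - p) * f y + p * f (-y) := by
  have h0 := h.1
  have h1 := h.2
  rw [noisySign, integral_add_measure, integral_smul_measure, integral_smul_measure,
    integral_dirac, integral_dirac, ENNReal.toReal_ofReal (by linarith), ENNReal.toReal_ofReal h0]
  · simp
  · exact (integrable_dirac (by simp)).smul_measure (by simp)
  · exact (integrable_dirac (by simp)).smul_measure (by simp)

theorem units_int_ne_iff {a b : ℤˣ} : a ≠ b ↔ a = -b := by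
  rcases Int.units_eq_one_or a with rfl | rfl <;> rcases Int.units_eq_one_or b with rfl | rfl <;>
    decide


/-- The left side is what Markov's inequality gives for a cut with `k` edges. With `x = 4p(1 - p) ≤
1` it equals `x ^ a` for `k = 2a` and `2p x ^ a` for `k = 2a + 1`. Lowering the exponent and using
`x ≤ 4p` then gives the right side, which no longer depends on `k`. -/
theorem flip_bound {p : ℝ} (hp : 0 < p) (hp2 : p < 1 / 2) {k c : ℕ} (hc : c ≤ (k + 1) / 2) :
    2 ^ k * p ^ ((k + 1) / 2) * (1 - p) ^ (k - (k + 1) / 2) ≤ 4 ^ c * p ^ c := by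
  have h4 : 4 * p * (1 - p) ≤ 1 := by nlinarith [sq_nonneg (1 - 2 * p)]
  have h40 : 0 ≤ 4 * p * (1 - p) := by apply mul_nonneg <;> linarith
  have h5 : 4 * p * (1 - p) ≤ 4 * p := by nlinarith
  rw [← mul_pow]
  rcases Nat.even_or_odd' k with ⟨a, rfl | rfl⟩
  · have e1 : (2 * a + 1) / 2 = a := by omega
    have e2 : 2 * a - a = a := by omega
    rw [e1] at hc
    rw [e1, e2, pow_mul, ← mul_pow, ← mul_pow]
    norm_num
    calc (4 * p * (1 - p)) ^ a ≤ (4 * p * (1 - p)) ^ c := pow_le_pow_of_le_one h40 h4 hc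
      _ ≤ _ := pow_le_pow_left₀ h40 h5 c
  · have e1 : (2 * a + 1 + 1) / 2 = a + 1 := by omega
    have e2 : 2 * a + 1 - (a + 1) = a := by omega
    rw [e1] at hc
    rw [e1, e2]
    have e3 : (2 : ℝ) ^ (2 * a + 1) * p ^ (a + 1) * (1 - p) ^ a
        = 2 * p * (4 * p * (1 - p)) ^ a := by
      rw [pow_succ, pow_mul, mul_pow, mul_pow]; norm_num; ring
    rw [e3]
    cases c with
    | zero =>
      have := pow_le_one₀ (n := a) h40 h4
      simp only [pow_zero]
      have h0 := pow_nonneg h40 a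
      nlinarith
    | succ c =>
      calc 2 * p * (4 * p * (1 - p)) ^ a ≤ 2 * p * (4 * p * (1 - p)) ^ c := by
            gcongr 2 * p * ?_; exact pow_le_pow_of_le_one h40 h4 (by omega)
        _ ≤ 4 * p * (4 * p) ^ c := by
            gcongr
            norm_num
        _ = _ := by rw [pow_succ]; ring

/-! ### Flips under a product measure, and a tail bound for weakly dependent events -/

section Pi

variable {E : Type*} [Fintype E]

/-- The probability that at least half of the signs in `F` are flipped. -/
theorem measure_half_flipped_le [DecidableEq E] {p : ℝ} (hp : 0 < p) (hp2 : p < 1 / 2) (y : E → ℤˣ)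
    (F : Finset E) {c : ℕ} (hc : c ≤ (F.card + 1) / 2) :
    (Measure.pi fun e => noisySign p (y e)).real
      {x | F.card ≤ 2 * (F.filter fun e => x e ≠ y e).card} ≤ 4 ^ c * p ^ c := by
  have hpI : p ∈ Set.Icc (0 : ℝ) 1 := ⟨hp.le, by linarith⟩
  have : Fact (p ∈ Set.Icc (0 : ℝ) 1) := ⟨hpI⟩
  set μ := Measure.pi fun e => noisySign p (y e)
  -- The weight per flip that is optimal for the threshold of one half; the mean of a factor is then
  -- `(1 - p) + p θ = 2 (1 - p)`.
  set θ : ℝ := (1 - p) / p with hθ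
  have h1p : 0 < 1 - p := by linarith
  have hθ1 : 1 ≤ θ := by rw [hθ, le_div_iff₀ hp]; linarith
  have hθ0 : 0 < θ := by linarith
  set k := F.card
  set a := (k + 1) / 2 with ha
  let g : (e : E) → ℤˣ → ℝ := fun e x => if e ∈ F then (if x ≠ y e then θ else 1) else 1
  have hprod : ∀ x : E → ℤˣ, ∏ e, g e (x e) = θ ^ (F.filter fun e => x e ≠ y e).card := by
    intro x
    simp only [g]
    rw [Finset.prod_ite_mem, Finset.univ_inter, Finset.prod_ite, Finset.prod_const_one, mul_one,
      Finset.prod_const]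
  have hint : ∫ x, ∏ e, g e (x e) ∂μ = (2 * (1 - p)) ^ k := by
    rw [integral_fintype_prod_eq_prod]
    have : ∀ e, ∫ x, g e x ∂(noisySign p (y e)) = if e ∈ F then 2 * (1 - p) else 1 := by
      intro e
      rw [integral_noisySign hpI]
      by_cases he : e ∈ F
      · have : -y e ≠ y e := units_int_ne_iff.2 rfl
        simp [g, he, this, hθ]
        field_simp
        ring
      · simp [g, he]
    simp_rw [this]
    rw [Finset.prod_ite_mem, Finset.univ_inter, Finset.prod_const]
  have hmarkov := mul_meas_ge_le_integral_of_nonneg (μ := μ) (f := fun x => ∏ e, g e (x e))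
    (Filter.Eventually.of_forall fun x => by simp only [hprod]; positivity) Integrable.of_finite (θ ^ a)
  rw [hint] at hmarkov
  have hsub : {x : E → ℤˣ | k ≤ 2 * (F.filter fun e => x e ≠ y e).card} ⊆
      {x | θ ^ a ≤ ∏ e, g e (x e)} := by
    intro x hx
    simp only [Set.mem_ofPred_eq] at hx ⊢
    rw [hprod]
    exact pow_le_pow_right₀ hθ1 (by omega)
  have h1 : μ.real {x | θ ^ a ≤ ∏ e, g e (x e)} ≤ 2 ^ k * p ^ a * (1 - p) ^ (k - a) := by
    rw [← le_div_iff₀' (by positivity)] at hmarkov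
    refine hmarkov.trans (le_of_eq ?_)
    rw [hθ, mul_pow, div_pow]
    have : (1 - p) ^ k = (1 - p) ^ a * (1 - p) ^ (k - a) := by
      rw [← pow_add]; congr 1; omega
    rw [this]
    field_simp
  exact ((measureReal_mono hsub).trans h1).trans (flip_bound hp hp2 hc)

/-- Functions of disjoint sets of coordinates are uncorrelated. -/
theorem integral_mul_of_dependsOn (μ : E → Measure ℤˣ) [∀ e, IsProbabilityMeasure (μ e)]
    {f g : (E → ℤˣ) → ℝ} {S T : Finset E} (hST : Disjoint S T) (hf : DependsOn f S)
    (hg : DependsOn g T) :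
    ∫ x, f x * g x ∂Measure.pi μ = (∫ x, f x ∂Measure.pi μ) * ∫ x, g x ∂Measure.pi μ := by
  obtain ⟨φ, rfl⟩ := dependsOn_iff_exists_comp.1 hf
  obtain ⟨ψ, rfl⟩ := dependsOn_iff_exists_comp.1 hg
  have hind := ProbabilityTheory.iIndepFun_pi (μ := μ) (X := fun _ x => x)
    (fun _ => aemeasurable_id)
  have h2 := hind.indepFun_finset S T hST (fun i => measurable_pi_apply i)
  have h3 := h2.comp (φ := φ) (ψ := ψ) Measurable.of_discrete Measurable.of_discrete
  exact h3.integral_fun_mul_eq_mul_integral Measurable.of_discrete.aestronglyMeasurable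
    Measurable.of_discrete.aestronglyMeasurable

theorem integral_prod_of_dependsOn [DecidableEq E] {ι : Type*} [DecidableEq ι] (μ : E → Measure ℤˣ)
    [∀ e, IsProbabilityMeasure (μ e)] {f : ι → (E → ℤˣ) → ℝ} {S : ι → Finset E}
    (hf : ∀ i, DependsOn (f i) (S i)) (s : Finset ι)
    (hS : ∀ i ∈ s, ∀ j ∈ s, i ≠ j → Disjoint (S i) (S j)) :
    ∫ x, ∏ i ∈ s, f i x ∂Measure.pi μ = ∏ i ∈ s, ∫ x, f i x ∂Measure.pi μ := by
  induction s using Finset.induction_on with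
  | empty => simp
  | insert a s ha ih =>
    simp_rw [Finset.prod_insert ha]
    rw [integral_mul_of_dependsOn μ (S := S a) (T := s.biUnion S) ?_ (hf a) ?_, ih]
    · exact fun i hi j hj => hS i (Finset.mem_insert_of_mem hi) j (Finset.mem_insert_of_mem hj)
    · rw [Finset.disjoint_biUnion_right]
      intro i hi
      exact hS a (Finset.mem_insert_self _ _) i (Finset.mem_insert_of_mem hi)
        (by rintro rfl; exact ha hi)
    · intro x y hxy
      refine Finset.prod_congr rfl fun i hi => hf i fun e he => hxy e ?_
      simp only [Finset.coe_biUnion, Set.mem_iUnion]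
      exact ⟨i, hi, he⟩

/-- Greedy colouring: at most `d` of the `d + 1` colours are forbidden for the next element. It is
used to split the failure events into `d + 1` classes of independent ones. -/
theorem exists_coloring {ι : Type*} [Fintype ι] [DecidableEq ι] (R : ι → ι → Prop)
    [DecidableRel R] (hR : ∀ i j, R i j → R j i) {d : ℕ}
    (hd : ∀ i, (Finset.univ.filter fun j => j ≠ i ∧ R i j).card ≤ d) :
    ∃ c : ι → Fin (d + 1), ∀ i j, i ≠ j → R i j → c i ≠ c j := by
  suffices h : ∀ s : Finset ι, ∃ c : ι → Fin (d + 1), ∀ i ∈ s, ∀ j ∈ s, i ≠ j → R i j → c i ≠ c j by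
    obtain ⟨c, hc⟩ := h Finset.univ
    exact ⟨c, fun i j => hc i (Finset.mem_univ _) j (Finset.mem_univ _)⟩
  intro s
  induction s using Finset.induction_on with
  | empty => exact ⟨fun _ => 0, by simp⟩
  | insert a s ha ih =>
    obtain ⟨c, hc⟩ := ih
    obtain ⟨m, hm⟩ : ∃ m, m ∉ (Finset.univ.filter fun j => j ≠ a ∧ R a j).image c := by
      by_contra! hall
      have h1 := Finset.card_le_card (fun x _ => hall x : (Finset.univ : Finset (Fin (d + 1))) ⊆ _)
      have h2 := Finset.card_image_le (s := Finset.univ.filter fun j => j ≠ a ∧ R a j) (f := c)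
      have h3 := hd a
      rw [Finset.card_univ, Fintype.card_fin] at h1
      omega
    have hm' : ∀ j, j ≠ a → R a j → c j ≠ m := by
      rintro j h1 h2 rfl
      exact hm (Finset.mem_image_of_mem c (by simp [h1, h2]))
    refine ⟨Function.update c a m, fun i hi j hj hij hRij => ?_⟩
    rcases Finset.mem_insert.1 hi with rfl | hi' <;> rcases Finset.mem_insert.1 hj with rfl | hj'
    · exact absurd rfl hij
    · rw [Function.update_self, Function.update_of_ne hij.symm]
      exact (hm' j hij.symm hRij).symm
    · rw [Function.update_self, Function.update_of_ne hij]
      exact hm' i hij (hR _ _ hRij)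
    · rw [Function.update_of_ne (by rintro rfl; exact ha hi'),
        Function.update_of_ne (by rintro rfl; exact ha hj')]
      exact hc i hi' j hj' hij hRij

open Classical in
/-- A tail bound for the number of events that occur, when each event shares coordinates with at
most `d` others. -/
theorem measure_card_ge_le {ι : Type*} [Fintype ι] (μ : E → Measure ℤˣ)
    [∀ e, IsProbabilityMeasure (μ e)] (A : ι → (E → ℤˣ) → Prop) (F : ι → Finset E)
    (hA : ∀ i, DependsOn (A i) (F i)) {d : ℕ}
    (hd : ∀ i, (Finset.univ.filter fun j => j ≠ i ∧ ¬ Disjoint (F i) (F j)).card ≤ d) (t : ℝ) :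
    (Measure.pi μ).real {x | (Real.exp 1 - 1) * ∑ i, (Measure.pi μ).real {x | A i x} + (d + 1) * t
      ≤ (Finset.univ.filter fun i => A i x).card} ≤ Real.exp (-t) := by
  set ν := Measure.pi μ
  obtain ⟨c, hc⟩ := exists_coloring (fun i j => ¬ Disjoint (F i) (F j))
    (fun i j h h' => h h'.symm) hd
  set m : ι → ℝ := fun i => (Real.exp 1 - 1) * ν.real {x | A i x}
  let g : ι → (E → ℤˣ) → ℝ := fun i x => if A i x then 1 else 0
  have he1 : 0 ≤ Real.exp 1 - 1 := by linarith [Real.add_one_le_exp (1 : ℝ)]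
  -- The moment of an indicator is `1 + (e - 1) P(A)`, and `1 + m ≤ exp m`.
  have hg : ∀ i, ∫ x, Real.exp (g i x) ∂ν ≤ Real.exp (m i) := by
    intro i
    have h1 : ∀ x, Real.exp (g i x) = 1 + (Real.exp 1 - 1) * Set.indicator {x | A i x} 1 x := by
      intro x
      by_cases h : A i x <;> simp [g, h]
    simp_rw [h1]
    rw [integral_add (integrable_const _) Integrable.of_finite, integral_const_mul,
      integral_indicator_one (Set.toFinite _).measurableSet]
    simp only [integral_const, probReal_univ, smul_eq_mul, mul_one]
    rw [add_comm]
    exact Real.add_one_le_exp _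
  have hclass : ∀ k : Fin (d + 1),
      ∫ x, Real.exp (∑ i with c i = k, (g i x - m i)) ∂ν ≤ 1 := by
    intro k
    simp_rw [Finset.sum_sub_distrib, Real.exp_sub, Real.exp_sum]
    rw [integral_div, div_le_one (Finset.prod_pos fun _ _ => Real.exp_pos _),
      integral_prod_of_dependsOn μ (S := F)]
    · exact Finset.prod_le_prod (fun i _ => integral_nonneg fun x => (Real.exp_pos _).le)
        fun i _ => hg i
    · intro i x y hxy
      have := hA i hxy
      simp only [g, this]
    · intro i hi j hj hij
      by_contra h
      simp only [Finset.mem_filter, Finset.mem_univ, true_and] at hi hj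
      exact hc i j hij h (hi.trans hj.symm)
  have hd0 : (0 : ℝ) < d + 1 := by positivity
  -- The total divided by `d + 1` is the average of the class sums, so Jensen's inequality reduces
  -- the dependent sum to the independent classes, at the price of the factor `d + 1` in the
  -- threshold.
  have havg : ∀ x, Real.exp ((∑ i, (g i x - m i)) / (d + 1)) ≤
      ∑ k : Fin (d + 1), (1 / (d + 1) : ℝ) * Real.exp (∑ i with c i = k, (g i x - m i)) := by
    intro x
    have := convexOn_exp.map_sum_le (t := (Finset.univ : Finset (Fin (d + 1))))
      (w := fun _ => (1 / (d + 1) : ℝ)) (p := fun k => ∑ i with c i = k, (g i x - m i))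
      (fun _ _ => by positivity) (by simp; field_simp) (fun _ _ => Set.mem_univ _)
    simp only [smul_eq_mul] at this
    rwa [← Finset.mul_sum, Finset.sum_fiberwise, one_div_mul_eq_div] at this
  have hint : ∫ x, Real.exp ((∑ i, (g i x - m i)) / (d + 1)) ∂ν ≤ 1 := by
    refine (integral_mono Integrable.of_finite Integrable.of_finite havg).trans ?_
    rw [integral_finsetSum _ fun _ _ => Integrable.of_finite]
    simp_rw [integral_const_mul]
    calc _ ≤ ∑ k : Fin (d + 1), (1 / (d + 1) : ℝ) * 1 :=
          Finset.sum_le_sum fun k _ => by gcongr; exact hclass k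
      _ = 1 := by simp; field_simp
  have hmarkov := mul_meas_ge_le_integral_of_nonneg (μ := ν)
    (f := fun x => Real.exp ((∑ i, (g i x - m i)) / (d + 1)))
    (Filter.Eventually.of_forall fun x => (Real.exp_pos _).le) Integrable.of_finite (Real.exp t)
  rw [Real.exp_neg, ← one_div, le_div_iff₀' (Real.exp_pos _)]
  refine le_trans ?_ (hmarkov.trans hint)
  refine mul_le_mul_of_nonneg_left (measureReal_mono fun x hx => ?_) (Real.exp_pos _).le
  · simp only [Set.mem_ofPred_eq] at hx ⊢
    rw [Real.exp_le_exp, le_div_iff₀ hd0, Finset.sum_sub_distrib]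
    have h1 : ∑ i, g i x = (Finset.univ.filter fun i => A i x).card := by
      simp [g]
    rw [h1, ← Finset.mul_sum]
    linarith

end Pi

/-! ## The first stage -/

@[simp] theorem edgeProd_mk {V : Type*} (y : V → ℤˣ) (u v : V) : edgeProd y s(u, v) = y u * y v :=
  rfl

namespace Setup

variable {n N : ℕ} (P : Setup n N)

/-- The edges of `G'(W*)` with exactly one end in `S`. -/
def cutEdges (i : Fin N) (S : Finset (Fin n)) : Finset P.graph.edgeSet :=
  Finset.univ.filter fun e => (e : Sym2 (Fin n)) ∈ P.extEdges i ∧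
    edgeProd (fun v => if v ∈ S then -1 else 1) (e : Sym2 (Fin n)) ≠ 1

/-- At least half of the edges in some cut that separates the component are flipped. -/
def Corrupted (Y : Fin n → ℤˣ) (i : Fin N) (X : EdgeObs P) : Prop :=
  ∃ S ⊆ P.ext i, (S ∩ P.bag i).Nonempty ∧ (P.bag i \ S).Nonempty ∧
    (P.cutEdges i S).card ≤
      2 * ((P.cutEdges i S).filter fun e : P.graph.edgeSet => X e ≠ edgeProd Y e).card

variable {P}

/-- Let `S` be the part of `W*` where `y ≠ Y`. On an edge that crosses `S`, exactly one of `y` and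
`Y` disagrees with `X`; on the other edges of `E'(W*)` both do or neither does. As `y` has no more
disagreements than `Y`, at least half of the cut is flipped relative to `Y`. -/
theorem eq_or_eq_neg_of_not_corrupted (hb : ∀ i, P.bag i ⊆ P.ext i) {Y y : Fin n → ℤˣ} {i : Fin N}
    {X : EdgeObs P} (h : ¬ P.Corrupted Y i X) (hy : P.disagreements X i y ≤ P.disagreements X i Y) :
    ∃ σ : ℤˣ, ∀ v ∈ P.bag i, y v = σ * Y v := by
  by_contra! hcon
  apply h
  set S := (P.ext i).filter fun v => y v ≠ Y v with hS
  refine ⟨S, Finset.filter_subset _ _, ?_, ?_, ?_⟩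
  -- The failure of `σ = 1` puts a vertex of `W` into `S`; the failure of `σ = -1` leaves one
  -- outside.
  · obtain ⟨v, hv, hne⟩ := hcon 1
    exact ⟨v, by simp [hS, hv, hb i hv]; simpa using hne⟩
  · obtain ⟨v, hv, hne⟩ := hcon (-1)
    refine ⟨v, ?_⟩
    have : y v = Y v := by
      by_contra h
      exact hne (by rw [units_int_ne_iff.1 h]; simp)
    simp [hS, hv, this]
  · have hprod : ∀ e ∈ P.extEdges i, edgeProd y e =
        edgeProd (fun v => if v ∈ S then -1 else 1) e * edgeProd Y e := by
      have hv : ∀ v ∈ P.ext i, y v = (if v ∈ S then -1 else 1) * Y v := by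
        intro v hv
        by_cases h : y v = Y v
        · simp [hS, h]
        · simp [hS, hv, units_int_ne_iff.1 h]
      intro e
      induction e with | _ u v => ?_
      intro he
      rw [mem_extEdges] at he
      simp only [edgeProd_mk]
      rw [hv u he.2.1, hv v he.2.2]
      exact mul_mul_mul_comm _ _ _ _
    -- Disagreements on the cut and off the cut are counted separately, so that the second part
    -- cancels between `y` and `Y`.
    have hsplit : ∀ z : Fin n → ℤˣ, P.disagreements X i z =
        ((P.cutEdges i S).filter fun e : P.graph.edgeSet => edgeProd z (e : Sym2 (Fin n)) ≠ X e).card +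
        ((Finset.univ.filter fun e : P.graph.edgeSet =>
          (e : Sym2 (Fin n)) ∈ P.extEdges i ∧ edgeProd z e ≠ X e).filter
            fun e : P.graph.edgeSet => edgeProd (fun v => if v ∈ S then -1 else 1) (e : Sym2 (Fin n)) = 1).card := by
      intro z
      rw [disagreements, ← Finset.card_filter_add_card_filter_not
        (fun e : P.graph.edgeSet =>
          edgeProd (fun v => if v ∈ S then -1 else 1) (e : Sym2 (Fin n)) = 1), add_comm]
      congr 2
      ext e
      simp only [cutEdges, Finset.mem_filter, Finset.mem_univ, true_and]
      tauto
    rw [hsplit y, hsplit Y] at hy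
    have hsame : ((Finset.univ.filter fun e : P.graph.edgeSet =>
          (e : Sym2 (Fin n)) ∈ P.extEdges i ∧ edgeProd y e ≠ X e).filter
            fun e : P.graph.edgeSet => edgeProd (fun v => if v ∈ S then -1 else 1) (e : Sym2 (Fin n)) = 1) =
        ((Finset.univ.filter fun e : P.graph.edgeSet =>
          (e : Sym2 (Fin n)) ∈ P.extEdges i ∧ edgeProd Y e ≠ X e).filter
            fun e : P.graph.edgeSet => edgeProd (fun v => if v ∈ S then -1 else 1) (e : Sym2 (Fin n)) = 1) := by
      ext e
      simp only [Finset.mem_filter, Finset.mem_univ, true_and]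
      constructor
      · rintro ⟨⟨h1, h2⟩, h3⟩
        rw [hprod _ h1, h3, one_mul] at h2
        exact ⟨⟨h1, h2⟩, h3⟩
      · rintro ⟨⟨h1, h2⟩, h3⟩
        refine ⟨⟨h1, ?_⟩, h3⟩
        rwa [hprod _ h1, h3, one_mul]
    rw [hsame] at hy
    have hcut : ((P.cutEdges i S).filter fun e : P.graph.edgeSet => edgeProd y (e : Sym2 (Fin n)) ≠ X e) =
        (P.cutEdges i S).filter fun e : P.graph.edgeSet => ¬ X e ≠ edgeProd Y (e : Sym2 (Fin n)) := by
      refine Finset.filter_congr fun e he => ?_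
      simp only [cutEdges, Finset.mem_filter, Finset.mem_univ, true_and] at he
      rw [hprod _ he.1, units_int_ne_iff.1 he.2, neg_one_mul, not_not, ne_comm, units_int_ne_iff,
        neg_neg]
    have hcut' : ((P.cutEdges i S).filter fun e : P.graph.edgeSet => edgeProd Y (e : Sym2 (Fin n)) ≠ X e) =
        (P.cutEdges i S).filter fun e : P.graph.edgeSet => X e ≠ edgeProd Y (e : Sym2 (Fin n)) :=
      Finset.filter_congr fun e _ => ne_comm
    rw [hcut, hcut'] at hy
    have := Finset.card_filter_add_card_filter_not (s := P.cutEdges i S)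
      (fun e : P.graph.edgeSet => X e ≠ edgeProd Y (e : Sym2 (Fin n)))
    omega

/-- An ordered pair from `S` to `W* \ S` is determined by its unordered edge, since only its first
entry lies in `S`. -/
theorem IsAdmissible.mincutStar_le_card_cutEdges (hP : P.IsAdmissible) {i : Fin N}
    {S : Finset (Fin n)} (hS : S ⊆ P.ext i) (h1 : (S ∩ P.bag i).Nonempty)
    (h2 : (P.bag i \ S).Nonempty) : P.mincutStar i ≤ (P.cutEdges i S).card := by
  have : P.mincutStar i ≤ (P.probed.interedges S (P.ext i \ S)).card :=
    Nat.sInf_le ⟨S, hS, h1, h2, rfl⟩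
  refine this.trans ?_
  rw [← Finset.card_image_of_injective _ Subtype.val_injective]
  refine Finset.card_le_card_of_injOn (fun x => s(x.1, x.2)) ?_ ?_
  · rintro ⟨a, b⟩ hab
    simp only [SimpleGraph.interedges, Finset.mem_coe, Rel.mem_interedges_iff,
      Finset.mem_sdiff] at hab
    obtain ⟨ha, ⟨hb, hbS⟩, hadj⟩ := hab
    simp only [Finset.coe_image, Set.mem_image, Finset.mem_coe]
    refine ⟨⟨s(a, b), hP.probed_le hadj⟩, ?_, rfl⟩
    simp [cutEdges, mem_extEdges, hadj, hS ha, hb, ha, hbS]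
  · rintro ⟨a, b⟩ hab ⟨c, d⟩ hcd h
    simp only [SimpleGraph.interedges, Finset.mem_coe, Rel.mem_interedges_iff,
      Finset.mem_sdiff] at hab hcd
    simp only [Sym2.eq_iff] at h
    rcases h with ⟨rfl, rfl⟩ | ⟨rfl, rfl⟩
    · rfl
    · exact absurd hcd.1 hab.2.1.2

/-- A single vertex of `W` can be cut off from `W*` by removing at most `|W*| - 1` edges. This
bounds the powers of `4` that come from `measure_half_flipped_le` in terms of `wid*`. -/
theorem IsAdmissible.mincutStar_le_widStar (hP : P.IsAdmissible) (i : Fin N) :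
    P.mincutStar i ≤ P.widStar := by
  by_cases h : ∃ S ⊆ P.ext i, (S ∩ P.bag i).Nonempty ∧ (P.bag i \ S).Nonempty
  · obtain ⟨S, -, ⟨v, hv⟩, w, hw⟩ := h
    simp only [Finset.mem_inter, Finset.mem_sdiff] at hv hw
    have hvw : w ≠ v := by rintro rfl; exact hw.2 hv.1
    have hve := hP.bag_subset_ext i hv.2
    have : P.mincutStar i ≤ (P.probed.interedges {v} (P.ext i \ {v})).card :=
      Nat.sInf_le ⟨{v}, by simpa using hve, ⟨v, by simp [hv.2]⟩, ⟨w, by simp [hw.1, hvw]⟩, rfl⟩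
    refine this.trans ((Rel.card_interedges_le_mul _ _ _).trans ?_)
    rw [Finset.card_singleton, one_mul, Finset.card_sdiff_of_subset (by simpa using hve),
      Finset.card_singleton]
    have := P.card_ext_le_widStar i
    omega
  -- Without a separating set the infimum is over the empty set of naturals, which gives `0`.
  · have : P.mincutStar i = 0 := by
      rw [mincutStar, Nat.sInf_eq_zero]
      right
      ext k
      simp only [Set.mem_ofPred_eq, Set.mem_empty_iff_false, iff_false]
      rintro ⟨S, h1, h2, h3, -⟩
      exact h ⟨S, h1, h2, h3⟩
    omega

/-- The probability that the estimator for a component fails. -/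
theorem IsAdmissible.measure_corrupted_le (hP : P.IsAdmissible) {p : ℝ} (hp : 0 < p)
    (hp2 : p < 1 / 2) (Y : Fin n → ℤˣ) (i : Fin N) :
    (Measure.pi fun e : P.graph.edgeSet => noisySign p (edgeProd Y e)).real
      {X | P.Corrupted Y i X} ≤ 4 ^ (P.widStar + 1) * p ^ ((P.mincutStar i + 1) / 2) := by
  set μ := Measure.pi fun e : P.graph.edgeSet => noisySign p (edgeProd Y e)
  have hpI : Fact (p ∈ Set.Icc (0 : ℝ) 1) := ⟨hp.le, by linarith⟩
  set c := (P.mincutStar i + 1) / 2 with hc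
  set I := (P.ext i).powerset.filter fun S => (S ∩ P.bag i).Nonempty ∧ (P.bag i \ S).Nonempty
  have hsub : {X | P.Corrupted Y i X} ⊆ ⋃ S ∈ I, {X : EdgeObs P | (P.cutEdges i S).card ≤
      2 * ((P.cutEdges i S).filter fun e : P.graph.edgeSet => X e ≠ edgeProd Y e).card} := by
    rintro X ⟨S, h1, h2, h3, h4⟩
    simp only [Set.mem_iUnion]
    exact ⟨S, by simp [I, h1, h2, h3], h4⟩
  have h1 : μ.real {X | P.Corrupted Y i X} ≤ ∑ S ∈ I, (4 ^ c * p ^ c : ℝ) := by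
    refine (measureReal_mono hsub (measure_ne_top _ _)).trans ((measureReal_biUnion_finset_le _ _).trans ?_)
    refine Finset.sum_le_sum fun S hS => measure_half_flipped_le hp hp2 _ _ ?_
    simp only [I, Finset.mem_filter, Finset.mem_powerset] at hS
    have := hP.mincutStar_le_card_cutEdges hS.1 hS.2.1 hS.2.2
    omega
  refine h1.trans ?_
  rw [Finset.sum_const, nsmul_eq_mul, ← mul_assoc]
  gcongr
  -- There are at most `2 ^ (wid* + 1)` sets `S`, and `4 ^ c` is bounded by the same number because
  -- `2c ≤ mincut* + 1 ≤ wid* + 1`. The product is `4 ^ (wid* + 1)`.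
  have h2 : I.card ≤ 2 ^ (P.widStar + 1) := by
    refine (Finset.card_filter_le _ _).trans ?_
    rw [Finset.card_powerset]
    exact Nat.pow_le_pow_right (by norm_num) (P.card_ext_le_widStar i)
  have h3 : 4 ^ c ≤ 2 ^ (P.widStar + 1) := by
    rw [show 4 = 2 ^ 2 by norm_num, ← pow_mul]
    have := hP.mincutStar_le_widStar i
    exact Nat.pow_le_pow_right (by norm_num) (by omega)
  calc (I.card : ℝ) * 4 ^ c ≤ 2 ^ (P.widStar + 1) * 2 ^ (P.widStar + 1) := by
        exact_mod_cast Nat.mul_le_mul h2 h3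
    _ = 4 ^ (P.widStar + 1) := by rw [← mul_pow]; norm_num

theorem corrupted_dependsOn (Y : Fin n → ℤˣ) (i : Fin N) :
    DependsOn (P.Corrupted Y i) ((Finset.univ.filter fun e : P.graph.edgeSet =>
      (e : Sym2 (Fin n)) ∈ P.extEdges i : Finset _) : Set P.graph.edgeSet) := by
  intro X X' h
  have : ∀ S, ((P.cutEdges i S).filter fun e : P.graph.edgeSet => X e ≠ edgeProd Y e) =
      (P.cutEdges i S).filter fun e : P.graph.edgeSet => X' e ≠ edgeProd Y e := by
    intro S
    refine Finset.filter_congr fun e he => ?_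
    simp only [cutEdges, Finset.mem_filter, Finset.mem_univ, true_and] at he
    rw [h e (by simpa using he.1)]
  simp only [Corrupted, this]

/-- A conflicting component shares one of at most `M` edges with `W*`, and each edge lies in at most
`deg*_E` extended components. -/
theorem card_conflicts_le (i : Fin N) :
    (Finset.univ.filter fun j => j ≠ i ∧ ¬ Disjoint
      (Finset.univ.filter fun e : P.graph.edgeSet => (e : Sym2 (Fin n)) ∈ P.extEdges i)
      (Finset.univ.filter fun e : P.graph.edgeSet => (e : Sym2 (Fin n)) ∈ P.extEdges j)).card ≤
    P.edgeDegStar * P.maxExtEdges := by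
  have hsub : (Finset.univ.filter fun j => j ≠ i ∧ ¬ Disjoint
      (Finset.univ.filter fun e : P.graph.edgeSet => (e : Sym2 (Fin n)) ∈ P.extEdges i)
      (Finset.univ.filter fun e : P.graph.edgeSet => (e : Sym2 (Fin n)) ∈ P.extEdges j)) ⊆
      (P.extEdges i).biUnion fun e => Finset.univ.filter fun j => e ∈ P.extEdges j := by
    intro j hj
    simp only [Finset.mem_filter, Finset.mem_univ, true_and] at hj
    rw [Finset.not_disjoint_iff] at hj
    obtain ⟨-, e, h1, h2⟩ := hj
    simp only [Finset.mem_filter, Finset.mem_univ, true_and] at h1 h2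
    simp only [Finset.mem_biUnion, Finset.mem_filter, Finset.mem_univ, true_and]
    exact ⟨e, h1, h2⟩
  refine (Finset.card_le_card hsub).trans
    ((Finset.card_biUnion_le_card_mul _ _ P.edgeDegStar ?_).trans ?_)
  · intro e he
    exact P.card_ext_of_edge_le (Finset.mem_of_mem_filter _ he)
  · rw [mul_comm]
    exact Nat.mul_le_mul_left _ (P.card_extEdges_le i)

open Classical in
/-- With high probability, the first stage fails on at most `K_n` components. -/
theorem IsAdmissible.measure_errBudget_lt_le (hP : P.IsAdmissible) (hc : P.probed.Connected)
    (hn : 2 ≤ n) {p δ : ℝ} (hp : 0 < p) (hp2 : p < 1 / 2) (hδ : 0 < δ) (hδ2 : δ ≤ 1 / 2)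
    (Y : Fin n → ℤˣ) :
    (Measure.pi fun e : P.graph.edgeSet => noisySign p (edgeProd Y e)).real
      {X | P.errBudget p δ < (Finset.univ.filter fun i => P.Corrupted Y i X).card} ≤ δ / 2 := by
  have hpI : Fact (p ∈ Set.Icc (0 : ℝ) 1) := ⟨hp.le, by linarith⟩
  have h := measure_card_ge_le (fun e : P.graph.edgeSet => noisySign p (edgeProd Y e))
    (fun i => P.Corrupted Y i) _ (fun i => corrupted_dependsOn Y i)
    (d := P.edgeDegStar * P.maxExtEdges) (fun i => by convert P.card_conflicts_le i)
    (Real.log (2 / δ))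
  rw [Real.exp_neg, Real.exp_log (by positivity), inv_div] at h
  refine le_trans (measureReal_mono fun X hX => ?_) h
  simp only [Set.mem_ofPred_eq] at hX ⊢
  refine le_trans ?_ hX.le
  rw [errBudget, cutSum]
  have hlog : 0 ≤ Real.log (2 / δ) := Real.log_nonneg (by rw [le_div_iff₀ hδ]; linarith)
  gcongr ?_ + ?_
  · have he : Real.exp 1 - 1 ≤ 4 := by have := Real.exp_one_lt_d9; linarith
    have he0 : 0 ≤ Real.exp 1 - 1 := by linarith [Real.add_one_le_exp (1 : ℝ)]
    calc _ ≤ (4 : ℝ) * ∑ i, 4 ^ (P.widStar + 1) * p ^ ((P.mincutStar i + 1) / 2) := by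
          gcongr with i
          exact hP.measure_corrupted_le hp hp2 Y i
      _ = _ := by rw [← Finset.mul_sum]; ring
  · gcongr
    -- Since `d = deg*_E · M ≥ 1`, the factor `d + 1` is at most `2d`, well within the `6d` of
    -- `K_n`.
    have h1 := hP.one_le_edgeDegStar hc hn
    have h2 := hP.one_le_maxExtEdges hc hn
    have h3 : 1 ≤ P.edgeDegStar * P.maxExtEdges := Nat.mul_pos h1 h2
    have h4 : (1 : ℝ) ≤ P.edgeDegStar * P.maxExtEdges := by exact_mod_cast h3
    push_cast
    nlinarith

end Setup

/-! ## The second stage -/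

/-- A set with at most `k` elements is listed by a function on `k` places, with `none` at the unused
ones. -/
theorem card_finsets_le (N k : ℕ) :
    (Finset.univ.filter fun D : Finset (Fin N) => D.card ≤ k).card ≤ (N + 1) ^ k := by
  have hsub : (Finset.univ.filter fun D : Finset (Fin N) => D.card ≤ k) ⊆
      (Finset.univ : Finset (Fin k → Option (Fin N))).image
        fun g => Finset.univ.filter fun x => ∃ j, g j = some x := by
    intro D hD
    simp only [Finset.mem_filter, Finset.mem_univ, true_and] at hD
    simp only [Finset.mem_image, Finset.mem_univ, true_and]
    refine ⟨fun j => D.toList[(j : ℕ)]?, ?_⟩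
    ext x
    simp only [Finset.mem_filter, Finset.mem_univ, true_and]
    rw [← Finset.mem_toList, List.mem_iff_getElem?]
    constructor
    · rintro ⟨j, hj⟩; exact ⟨j, hj⟩
    · rintro ⟨j, hj⟩
      have h1 : j < D.toList.length := by
        by_contra h
        rw [List.getElem?_eq_none (by omega)] at hj
        simp at hj
      rw [Finset.length_toList] at h1
      exact ⟨⟨j, by omega⟩, hj⟩
  refine (Finset.card_le_card hsub).trans (Finset.card_image_le.trans ?_)
  simp

/-- In a tree there are few vertex sets with a small edge boundary. -/
theorem card_small_boundary_le {N : ℕ} {T : SimpleGraph (Fin N)} [DecidableRel T.Adj]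
    (hT : T.IsTree) (k : ℕ) :
    (Finset.univ.filter fun D : Finset (Fin N) =>
      (T.edgeFinset.filter fun e => edgeProd (fun i => if i ∈ D then -1 else 1) e ≠ 1).card
        ≤ k).card ≤ 2 * (N + 1) ^ k := by
  obtain ⟨r⟩ := hT.connected.nonempty
  -- `D` is encoded by its membership at the root and the lower ends of its boundary edges.
  -- Descending from the root, membership changes exactly at these edges, so the code determines
  -- `D`.
  let φ : Finset (Fin N) → Bool × Finset (Fin N) := fun D =>
    (decide (r ∈ D), Finset.univ.filter fun x => x ≠ r ∧
      edgeProd (fun i => if i ∈ D then -1 else 1) s(x, parent T r x) ≠ 1)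
  have hinj : Function.Injective φ := by
    intro D D' h
    simp only [φ, Prod.mk.injEq, decide_eq_decide] at h
    obtain ⟨hroot, hfilter⟩ := h
    replace hfilter := fun x => Finset.ext_iff.1 hfilter x
    simp only [Finset.mem_filter_univ] at hfilter
    simp only [edgeProd_mk] at hfilter
    have key : ∀ d x, T.dist r x = d → (x ∈ D ↔ x ∈ D') := by
      intro d
      induction d with
      | zero =>
        intro x hx
        rw [(hT.connected r x).dist_eq_zero_iff] at hx
        rw [← hx]
        exact hroot
      | succ d ih =>
        intro x hx
        have hxr : x ≠ r := by rintro rfl; simp at hx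
        have h1 := ih (parent T r x) (by rw [dist_parent hT, hx]; rfl)
        have h2 := hfilter x
        clear hfilter ih hroot
        by_cases a : x ∈ D <;> by_cases b : x ∈ D' <;> by_cases c : parent T r x ∈ D' <;>
          simp_all
    ext x
    exact key _ x rfl
  have hmap : ∀ D ∈ (Finset.univ.filter fun D : Finset (Fin N) =>
      (T.edgeFinset.filter fun e => edgeProd (fun i => if i ∈ D then -1 else 1) e ≠ 1).card ≤ k),
      φ D ∈ (Finset.univ : Finset Bool) ×ˢ
        (Finset.univ.filter fun D : Finset (Fin N) => D.card ≤ k) := by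
    intro D hD
    simp only [Finset.mem_filter, Finset.mem_univ, true_and] at hD
    rw [card_filter_edgeFinset hT r] at hD
    simp only [φ, Finset.mem_product, Finset.mem_filter, Finset.mem_univ, true_and]
    exact hD
  refine (Finset.card_le_card_of_injOn φ hmap hinj.injOn).trans ?_
  rw [Finset.card_product]
  simpa using card_finsets_le N k

theorem card_incident_le {N : ℕ} (T : SimpleGraph (Fin N)) [DecidableRel T.Adj]
    (B : Finset (Fin N)) :
    (T.edgeFinset.filter fun e => ∃ i ∈ B, i ∈ e).card ≤ B.card * T.maxDegree := by
  have hsub : (T.edgeFinset.filter fun e => ∃ i ∈ B, i ∈ e) ⊆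
      B.biUnion fun i => T.incidenceFinset i := by
    intro e he
    simp only [Finset.mem_filter, SimpleGraph.mem_edgeFinset] at he
    obtain ⟨h1, i, hi, hie⟩ := he
    simp only [Finset.mem_biUnion, SimpleGraph.mem_incidenceFinset]
    exact ⟨i, hi, h1, hie⟩
  refine (Finset.card_le_card hsub).trans (Finset.card_biUnion_le_card_mul _ _ _ fun i _ => ?_)
  rw [SimpleGraph.card_incidenceFinset_eq_degree]
  exact T.degree_le_maxDegree i

/-- `y v * z v` as a real number. -/
def agree {n : ℕ} (Y Z : Fin n → ℤˣ) (v : Fin n) : ℝ := ((Y v * Z v : ℤˣ) : ℤ)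

/-- A Chernoff bound for a weighted sum of the independent signs `Y_v Z_v`, each with mean `1 - 2q =
2ε`. Half of the mean is given up to absorb the second-order term of the exponential; the weights
will be multiplicities of vertices in a family of bags. -/
theorem measure_sum_agree_le {n : ℕ} (Y : Fin n → ℤˣ) {q : ℝ} (hq0 : 0 < q) (hq : q < 1 / 2)
    (c : Fin n → ℕ) {B : ℝ} (hB : 0 < B) (hc : ∀ v, (c v : ℝ) ≤ B) (l : ℝ) :
    (Measure.pi fun v => noisySign q (Y v)).real
      {Z | ∑ v, c v * agree Y Z v ≤ (1 / 2 - q) * ∑ v, (c v : ℝ) - B * l / (1 / 2 - q)}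
        ≤ Real.exp (-l) := by
  have hqI : q ∈ Set.Icc (0 : ℝ) 1 := ⟨hq0.le, by linarith⟩
  have : Fact (q ∈ Set.Icc (0 : ℝ) 1) := ⟨hqI⟩
  set μ := Measure.pi fun v => noisySign q (Y v)
  set ε := 1 / 2 - q with hε
  have hε0 : 0 < ε := by linarith
  -- With this tilt every exponent `x = t c_v` is at most `ε`, so `1 - 2εx + x ^ 2 ≤ 1 - εx`; and
  -- `t` times the deviation `B l / ε` is exactly `l`.
  set t := ε / B with ht
  have ht0 : 0 < t := by positivity
  have htB : t * B = ε := by rw [ht]; field_simp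
  let g : Fin n → ℤˣ → ℝ := fun v z => Real.exp (-t * (c v * ((Y v * z : ℤˣ) : ℤ)))
  have hg : ∀ v, ∫ z, g v z ∂noisySign q (Y v) ≤ Real.exp (-(t * ε * c v)) := by
    intro v
    rw [integral_noisySign hqI]
    have hx0 : 0 ≤ t * c v := by positivity
    have hxε : t * c v ≤ ε := by rw [← htB]; gcongr; exact hc v
    set x := t * c v
    have e1 : g v (Y v) = Real.exp (-x) := by
      simp only [g, ← sq, Int.units_sq]; congr 1; simp [x]
    have e2 : g v (-Y v) = Real.exp x := by
      simp only [g, mul_neg, ← sq, Int.units_sq]; congr 1; simp [x]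
    rw [e1, e2]
    have b1 := (abs_le.1 (Real.abs_exp_sub_one_sub_id_le (x := x)
      (by rw [abs_of_nonneg hx0]; linarith))).2
    have b2 := (abs_le.1 (Real.abs_exp_sub_one_sub_id_le (x := -x)
      (by rw [abs_neg, abs_of_nonneg hx0]; linarith))).2
    have hxx : x ^ 2 ≤ x * ε := by rw [sq]; gcongr
    calc (1 - q) * Real.exp (-x) + q * Real.exp x
        ≤ (1 - q) * (1 - x + x ^ 2) + q * (1 + x + x ^ 2) := by
          gcongr <;> linarith
      _ ≤ -(t * ε * c v) + 1 := by
          have : t * ε * c v = x * ε := by simp only [x]; ring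
          rw [this, hε] at *
          nlinarith
      _ ≤ _ := Real.add_one_le_exp _
  have hint : ∫ Z, ∏ v, g v (Z v) ∂μ ≤ Real.exp (-(t * ε * ∑ v, (c v : ℝ))) := by
    rw [integral_fintype_prod_eq_prod, Finset.mul_sum, ← Finset.sum_neg_distrib, Real.exp_sum]
    exact Finset.prod_le_prod (fun v _ => integral_nonneg fun z => (Real.exp_pos _).le)
      fun v _ => hg v
  have hprod : ∀ Z : Fin n → ℤˣ, ∏ v, g v (Z v) = Real.exp (-t * ∑ v, c v * agree Y Z v) := by
    intro Z
    simp only [g, agree]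
    rw [← Real.exp_sum, Finset.mul_sum]
  set τ := ε * ∑ v, (c v : ℝ) - B * l / ε
  have hmarkov := mul_meas_ge_le_integral_of_nonneg (μ := μ) (f := fun Z => ∏ v, g v (Z v))
    (Filter.Eventually.of_forall fun x => by simp only [hprod]; exact (Real.exp_pos _).le)
    Integrable.of_finite (Real.exp (-t * τ))
  have h1 : Real.exp (-t * τ) * μ.real {Z | ∑ v, c v * agree Y Z v ≤ τ} ≤
      Real.exp (-(t * ε * ∑ v, (c v : ℝ))) := by
    refine le_trans ?_ (hmarkov.trans hint)
    refine mul_le_mul_of_nonneg_left (measureReal_mono fun Z hZ => ?_) (Real.exp_pos _).le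
    simp only [Set.mem_ofPred_eq] at hZ ⊢
    rw [hprod, Real.exp_le_exp, neg_mul, neg_mul, neg_le_neg_iff]
    gcongr
  rw [← le_div_iff₀' (Real.exp_pos _), ← Real.exp_sub] at h1
  refine h1.trans (le_of_eq ?_)
  congr 1
  simp only [τ, ht]
  field_simp
  ring

namespace Setup

variable {n N : ℕ} {P : Setup n N}

/-- The number of components in `D` that contain `v`. -/
def multiplicity (P : Setup n N) (D : Finset (Fin N)) (v : Fin n) : ℕ :=
  (D.filter fun i => v ∈ P.bag i).card

theorem sum_multiplicity_mul (D : Finset (Fin N)) (f : Fin n → ℝ) :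
    ∑ v, P.multiplicity D v * f v = ∑ i ∈ D, ∑ v ∈ P.bag i, f v := by
  simp only [multiplicity, Finset.card_filter, Nat.cast_sum, Finset.sum_mul]
  rw [Finset.sum_comm]
  refine Finset.sum_congr rfl fun i _ => ?_
  simp

theorem sum_multiplicity (D : Finset (Fin N)) :
    ∑ v, (P.multiplicity D v : ℝ) = ∑ i ∈ D, ((P.bag i).card : ℝ) := by
  have := P.sum_multiplicity_mul D fun _ => 1
  simpa using this

/-- Sets of components with at most `k` tree edges in the boundary. -/
def smallBoundary (P : Setup n N) (k : ℕ) : Finset (Finset (Fin N)) :=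
  Finset.univ.filter fun D : Finset (Fin N) =>
    (P.tree.edgeFinset.filter fun e => edgeProd (fun i => if i ∈ D then -1 else 1) e ≠ 1).card ≤ k

/-- With high probability the vertex measurements are informative on all sets of components with
a small boundary. -/
theorem IsAdmissible.measure_uninformative_le (hP : P.IsAdmissible) (hc : P.probed.Connected)
    (hn : 2 ≤ n) (Y : Fin n → ℤˣ) {q δ : ℝ} (hq0 : 0 < q) (hq : q < 1 / 2) (hδ : 0 < δ) (k : ℕ) :
    (Measure.pi fun v => noisySign q (Y v)).real
      {Z | ∃ D ∈ P.smallBoundary k, ∑ i ∈ D, ∑ v ∈ P.bag i, agree Y Z v ≤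
        (1 / 2 - q) * ∑ i ∈ D, ((P.bag i).card : ℝ)
          - (P.probed.maxDegree * P.edgeDegStar : ℝ) *
            (Real.log (4 / δ) + k * Real.log (N + 1)) / (1 / 2 - q)} ≤ δ / 2 := by
  have hqI : q ∈ Set.Icc (0 : ℝ) 1 := ⟨hq0.le, by linarith⟩
  have : Fact (q ∈ Set.Icc (0 : ℝ) 1) := ⟨hqI⟩
  set μ := Measure.pi fun v => noisySign q (Y v)
  set B : ℝ := P.probed.maxDegree * P.edgeDegStar with hB
  set l := Real.log (4 / δ) + k * Real.log (N + 1) with hl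
  have hB0 : 0 < B := by
    have h1 := hP.one_le_maxDegree hc hn
    have h2 := hP.one_le_edgeDegStar hc hn
    have : 0 < P.probed.maxDegree * P.edgeDegStar := Nat.mul_pos h1 h2
    rw [hB]; exact_mod_cast this
  have hsub : {Z | ∃ D ∈ P.smallBoundary k, ∑ i ∈ D, ∑ v ∈ P.bag i, agree Y Z v ≤
        (1 / 2 - q) * ∑ i ∈ D, ((P.bag i).card : ℝ) - B * l / (1 / 2 - q)} ⊆
      ⋃ D ∈ P.smallBoundary k, {Z | ∑ v, P.multiplicity D v * agree Y Z v ≤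
        (1 / 2 - q) * ∑ v, (P.multiplicity D v : ℝ) - B * l / (1 / 2 - q)} := by
    rintro Z ⟨D, hD, h⟩
    simp only [Set.mem_iUnion, Set.mem_ofPred_eq]
    refine ⟨D, hD, ?_⟩
    rwa [sum_multiplicity_mul, sum_multiplicity]
  have h1 : ∀ D ∈ P.smallBoundary k, μ.real {Z | ∑ v, P.multiplicity D v * agree Y Z v ≤
        (1 / 2 - q) * ∑ v, (P.multiplicity D v : ℝ) - B * l / (1 / 2 - q)} ≤ Real.exp (-l) := by
    intro D _
    refine measure_sum_agree_le Y hq0 hq _ hB0 (fun v => ?_) l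
    rw [hB]
    exact_mod_cast (Finset.card_le_card (Finset.filter_subset_filter _ (Finset.subset_univ D))).trans
      (hP.card_bags_le hc hn v)
  refine (measureReal_mono hsub (measure_ne_top _ _)).trans
    ((measureReal_biUnion_finset_le _ _).trans ((Finset.sum_le_sum h1).trans ?_))
  rw [Finset.sum_const, nsmul_eq_mul]
  have h2 : ((P.smallBoundary k).card : ℝ) ≤ 2 * (N + 1) ^ k := by
    exact_mod_cast card_small_boundary_le hP.isTreeDecomposition.isTree k
  -- `l` is chosen so that `exp (-l)`, multiplied by the bound `2 (N + 1) ^ k` for the number of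
  -- sets, gives `δ / 2`.
  have h3 : Real.exp (-l) = δ / (4 * (N + 1) ^ k) := by
    have hN : (0 : ℝ) < N + 1 := by positivity
    rw [hl, ← Real.log_pow, ← Real.log_mul (by positivity) (by positivity), Real.exp_neg,
      Real.exp_log (by positivity), div_mul_eq_mul_div, inv_div]
  rw [h3]
  calc _ ≤ (2 * (N + 1) ^ k) * (δ / (4 * (N + 1) ^ k)) := by gcongr
    _ = δ / 2 := by field_simp; norm_num

theorem errBudget_nonneg {p δ : ℝ} (hp : 0 < p) (hδ : 0 < δ) (hδ2 : δ ≤ 1 / 2) :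
    0 ≤ P.errBudget p δ := by
  have hlog : 0 ≤ Real.log (2 / δ) := Real.log_nonneg (by rw [le_div_iff₀ hδ]; linarith)
  have : 0 ≤ P.cutSum p := Finset.sum_nonneg fun i _ => by positivity
  rw [errBudget]
  positivity

/-- Turns the change of cost caused by flipping a correct label into a term of `agree`. -/
theorem indicator_sub_indicator (y z : ℤˣ) :
    ((if -y ≠ z then 1 else 0 : ℝ)) - (if y ≠ z then 1 else 0) = ((y * z : ℤˣ) : ℤ) := by
  rcases Int.units_eq_one_or y with rfl | rfl <;> rcases Int.units_eq_one_or z with rfl | rfl <;>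
    norm_num

theorem bagCost_le_card (Z : VertexObs n) (est : Fin N → Fin n → ℤˣ) (i : Fin N) (s : ℤˣ) :
    P.bagCost Z est i s ≤ (P.bag i).card := Finset.card_filter_le _ _

open Classical in
/-- The errors of an output are controlled by a set of components with a small boundary, on which
flipping the labels does not increase the cost by much. -/
theorem IsOutput.exists_flipped {p δ : ℝ} {X : EdgeObs P} {Z : VertexObs n} {Yhat : Fin n → ℤˣ}
    (h : P.IsOutput p δ X Z Yhat) (hb : ∀ i, P.bag i ⊆ P.ext i) (Y : Fin n → ℤˣ)
    (hbad : ((Finset.univ.filter fun i => P.Corrupted Y i X).card : ℝ) ≤ P.errBudget p δ) :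
    ∃ D ∈ P.smallBoundary ⌊2 * P.treeBudget p δ⌋₊,
      ∑ i ∈ D, ∑ v ∈ P.bag i, agree Y Z v ≤ P.errBudget p δ * (P.wid + 1) ∧
      (hammingDist Yhat Y : ℝ) ≤
        P.errBudget p δ * (P.wid + 1) + ∑ i ∈ D, ((P.bag i).card : ℝ) := by
  obtain ⟨est, link, s, home, hest, hlink, hfeas, hopt, hhome, hout⟩ := h
  set bad := Finset.univ.filter fun i => P.Corrupted Y i X with hbaddef
  -- On bad components `σ` is an arbitrary sign, here `1`.
  have hσ : ∀ i, ∃ σ : ℤˣ, i ∉ bad → ∀ v ∈ P.bag i, est i v = σ * Y v := by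
    intro i
    by_cases hi : P.Corrupted Y i X
    · exact ⟨1, fun h => absurd (by simp [hbaddef, hi]) h⟩
    · obtain ⟨σ, h⟩ := eq_or_eq_neg_of_not_corrupted hb hi (hest i Y)
      exact ⟨σ, fun _ => h⟩
  choose σ hσ using hσ
  -- Between good components the sign read off at a common vertex `v` is `σ_i σ_j Y_v ^ 2 = σ_i
  -- σ_j`, so `σ` does not violate the edge.
  have hedge : ∀ e ∈ P.tree.edgeFinset, (¬ ∃ i ∈ bad, i ∈ e) →
      edgeProd σ e = edgeProd (fun i => est i (link e)) e := by
    intro e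
    induction e with | _ i j => ?_
    intro he hne
    simp only [SimpleGraph.mem_edgeFinset, SimpleGraph.mem_edgeSet] at he
    have hi : i ∉ bad := fun h => hne ⟨i, h, by simp⟩
    have hj : j ∉ bad := fun h => hne ⟨j, h, by simp⟩
    have hl := hlink i j he
    rw [Finset.mem_inter] at hl
    simp only [edgeProd_mk]
    rw [hσ i hi _ hl.1, hσ j hj _ hl.2, mul_mul_mul_comm, ← sq (Y _), Int.units_sq, mul_one]
  have hinc : ((P.tree.edgeFinset.filter fun e => ∃ i ∈ bad, i ∈ e).card : ℝ) ≤
      P.treeBudget p δ := by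
    have h1 : ((P.tree.edgeFinset.filter fun e => ∃ i ∈ bad, i ∈ e).card : ℝ) ≤
        bad.card * P.tree.maxDegree := by
      exact_mod_cast card_incident_le P.tree bad
    rw [treeBudget, treeDeg, mul_comm]
    exact h1.trans (by gcongr)
  -- All edges violated by `σ` touch bad components. This is why `L_n = deg(T) K_n` is the right
  -- budget: `σ` is admitted to the minimization.
  have hσfeas : (P.violations est link σ : ℝ) ≤ P.treeBudget p δ := by
    refine le_trans ?_ hinc
    rw [violations]
    refine Nat.cast_le.2 (Finset.card_le_card fun e he => ?_)
    rw [Finset.mem_filter] at he ⊢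
    refine ⟨he.1, ?_⟩
    by_contra hcon
    exact he.2 (hedge e he.1 hcon)
  have hcost := hopt σ hσfeas
  set D := Finset.univ.filter fun i => i ∉ bad ∧ s i ≠ σ i with hD
  have hbag : ∑ i ∈ bad, ((P.bag i).card : ℝ) ≤ P.errBudget p δ * (P.wid + 1) := by
    calc ∑ i ∈ bad, ((P.bag i).card : ℝ) ≤ ∑ i ∈ bad, ((P.wid : ℝ) + 1) :=
          Finset.sum_le_sum fun i _ => by exact_mod_cast P.card_bag_le_wid i
      _ = bad.card * (P.wid + 1) := by rw [Finset.sum_const, nsmul_eq_mul]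
      _ ≤ _ := by gcongr
  refine ⟨D, ?_, le_trans ?_ hbag, le_trans ?_ (add_le_add_left hbag _)⟩
  · simp only [smallBoundary, Finset.mem_filter, Finset.mem_univ, true_and]
    refine Nat.le_floor ?_
    -- If neither `s` nor `σ` violates an edge between good components, then `s σ` is constant on
    -- the edge and it does not leave `D`. The two exceptional kinds of edges number at most `L_n`
    -- each.
    have hsub : (P.tree.edgeFinset.filter fun e =>
          edgeProd (fun i => if i ∈ D then -1 else 1) e ≠ 1) ⊆
        (P.tree.edgeFinset.filter fun e =>
          edgeProd s e ≠ edgeProd (fun i => est i (link e)) e) ∪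
        (P.tree.edgeFinset.filter fun e => ∃ i ∈ bad, i ∈ e) := by
      intro e he
      rw [Finset.mem_union, Finset.mem_filter, Finset.mem_filter]
      rw [Finset.mem_filter] at he
      by_contra hcon
      simp only [not_or, not_and] at hcon
      have h1 := hcon.1 he.1
      have h2 := hcon.2 he.1
      rw [not_not, ← hedge e he.1 h2] at h1
      refine he.2 ?_
      clear hcon he
      induction e with | _ i j => ?_
      have hi : i ∉ bad := fun h => h2 ⟨i, h, by simp⟩
      have hj : j ∉ bad := fun h => h2 ⟨j, h, by simp⟩
      simp only [edgeProd_mk] at h1 ⊢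
      have hiD : i ∈ D ↔ s i ≠ σ i := by simp [hD, hi]
      have hjD : j ∈ D ↔ s j ≠ σ j := by simp [hD, hj]
      by_cases hi' : s i = σ i
      · rw [hi'] at h1
        have hj' := mul_left_cancel h1
        simp [hiD, hjD, hi', hj']
      · have h3 := units_int_ne_iff.1 hi'
        have hj' : s j ≠ σ j := by
          intro h4
          rw [h4] at h1
          exact hi' (mul_right_cancel h1)
        simp [hiD, hjD, hi', hj']
    have := Finset.card_le_card hsub
    have h4 := this.trans (Finset.card_union_le _ _)
    rw [violations] at hfeas
    have h5 : ((P.tree.edgeFinset.filter fun e =>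
        edgeProd (fun i => if i ∈ D then -1 else 1) e ≠ 1).card : ℝ) ≤
        (P.tree.edgeFinset.filter fun e =>
          edgeProd s e ≠ edgeProd (fun i => est i (link e)) e).card +
        (P.tree.edgeFinset.filter fun e => ∃ i ∈ bad, i ∈ e).card := by
      exact_mod_cast h4
    linarith
  -- On `D` one has `s = -σ`, and the cost difference is the sum of `agree`; on a bad component it
  -- is at least `-|W|`; elsewhere it vanishes. Optimality makes the total nonpositive.
  · have hterm : ∀ i, (if i ∈ D then ∑ v ∈ P.bag i, agree Y Z v else 0)
        - (if i ∈ bad then ((P.bag i).card : ℝ) else 0) ≤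
        (P.bagCost Z est i (s i) : ℝ) - P.bagCost Z est i (σ i) := by
      intro i
      by_cases hib : i ∈ bad
      · have hiD : i ∉ D := by simp [hD, hib]
        rw [if_neg hiD, if_pos hib]
        have h1 : (P.bagCost Z est i (σ i) : ℝ) ≤ (P.bag i).card := by
          exact_mod_cast P.bagCost_le_card Z est i (σ i)
        have h2 : (0 : ℝ) ≤ P.bagCost Z est i (s i) := by positivity
        linarith
      · rw [if_neg hib, sub_zero]
        by_cases hs : s i = σ i
        · have hiD : i ∉ D := by simp [hD, hs]
          rw [if_neg hiD, hs, sub_self]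
        · have hiD : i ∈ D := by simp [hD, hs, hib]
          rw [if_pos hiD]
          refine le_of_eq ?_
          simp only [bagCost, Finset.card_filter, Nat.cast_sum, agree]
          rw [← Finset.sum_sub_distrib]
          refine Finset.sum_congr rfl fun v hv => ?_
          rw [units_int_ne_iff.1 hs, hσ i hib v hv, neg_mul, ← mul_assoc, ← sq, Int.units_sq,
            one_mul, ← indicator_sub_indicator]
          push_cast
          rfl
    have hsum := Finset.sum_le_sum fun i (_ : i ∈ Finset.univ) => hterm i
    rw [Finset.sum_sub_distrib, Finset.sum_sub_distrib] at hsum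
    have hcost' : (∑ i, (P.bagCost Z est i (s i) : ℝ)) ≤ ∑ i, (P.bagCost Z est i (σ i) : ℝ) := by
      exact_mod_cast hcost
    simp only [Finset.sum_ite_mem, Finset.univ_inter] at hsum
    linarith
  · have hsub : (Finset.univ.filter fun v => Yhat v ≠ Y v) ⊆
        bad.biUnion P.bag ∪ D.biUnion P.bag := by
      intro v hv
      simp only [Finset.mem_filter, Finset.mem_univ, true_and] at hv
      simp only [Finset.mem_union, Finset.mem_biUnion]
      by_cases hb : home v ∈ bad
      · exact Or.inl ⟨_, hb, hhome v⟩
      · refine Or.inr ⟨_, ?_, hhome v⟩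
        simp only [hD, Finset.mem_filter, Finset.mem_univ, true_and]
        refine ⟨hb, fun hs => hv ?_⟩
        rw [hout, hs, hσ _ hb v (hhome v), ← mul_assoc, ← sq, Int.units_sq, one_mul]
    have h1 : hammingDist Yhat Y ≤ ∑ i ∈ bad, (P.bag i).card + ∑ i ∈ D, (P.bag i).card :=
      (Finset.card_le_card hsub).trans ((Finset.card_union_le _ _).trans
        (add_le_add Finset.card_biUnion_le Finset.card_biUnion_le))
    exact_mod_cast h1

end Setup

/-! ## The error bounds -/

namespace Setup

variable {n N : ℕ} {P : Setup n N}

open Classical in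
-- There are two exceptional events of probability at most `δ / 2`: more than `K_n` bad components,
-- or uninformative `Z` on some set with a small boundary. Outside both, the set `D` from
-- `IsOutput.exists_flipped` satisfies `ε ∑ |W| - B l / ε < K_n (wid + 1)`, which is solved for `∑
-- |W|`.
theorem IsAdmissible.measure_hammingDist_le (hP : P.IsAdmissible) (hc : P.probed.Connected)
    (hn : 2 ≤ n) (Y : Fin n → ℤˣ) {p q δ : ℝ} (hp : 0 < p) (hpq : p < q) (hq : q < 1 / 2)
    (hδ : 0 < δ) (hδ2 : δ ≤ 1 / 2) :
    1 - δ ≤ (obsLaw P Y p q).real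
      {m | ∀ Yhat : Fin n → ℤˣ, P.IsOutput p δ m.1 m.2 Yhat →
        (hammingDist Yhat Y : ℝ) ≤ P.errBudget p δ * (P.wid + 1) +
          (P.errBudget p δ * (P.wid + 1) / (1 / 2 - q) + (P.probed.maxDegree * P.edgeDegStar : ℝ) *
            (Real.log (4 / δ) + ⌊2 * P.treeBudget p δ⌋₊ * Real.log (N + 1)) / (1 / 2 - q) ^ 2)} := by
  have : Fact (p ∈ Set.Icc (0 : ℝ) 1) := ⟨hp.le, by linarith⟩
  have : Fact (q ∈ Set.Icc (0 : ℝ) 1) := ⟨by linarith, by linarith⟩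
  have hε : 0 < 1 / 2 - q := by linarith
  rw [obsLaw]
  set μ := Measure.pi fun e : P.graph.edgeSet => noisySign p (edgeProd Y e)
  set ν := Measure.pi fun v => noisySign q (Y v)
  set A := {X | P.errBudget p δ < (Finset.univ.filter fun i => P.Corrupted Y i X).card}
  have hA : μ.real A ≤ δ / 2 := hP.measure_errBudget_lt_le hc hn hp (by linarith) hδ hδ2 Y
  have hB := hP.measure_uninformative_le hc hn Y (hp.trans hpq) hq hδ ⌊2 * P.treeBudget p δ⌋₊
  set l := Real.log (4 / δ) + ⌊2 * P.treeBudget p δ⌋₊ * Real.log (N + 1)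
  set B := {Z | ∃ D ∈ P.smallBoundary ⌊2 * P.treeBudget p δ⌋₊,
    ∑ i ∈ D, ∑ v ∈ P.bag i, agree Y Z v ≤ (1 / 2 - q) * ∑ i ∈ D, ((P.bag i).card : ℝ)
          - (P.probed.maxDegree * P.edgeDegStar : ℝ) * l / (1 / 2 - q)}
  set G := {m : EdgeObs P × VertexObs n | ∀ Yhat : Fin n → ℤˣ, P.IsOutput p δ m.1 m.2 Yhat →
        (hammingDist Yhat Y : ℝ) ≤ P.errBudget p δ * (P.wid + 1) +
          (P.errBudget p δ * (P.wid + 1) / (1 / 2 - q) +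
            (P.probed.maxDegree * P.edgeDegStar : ℝ) * l / (1 / 2 - q) ^ 2)}
  have hsub : Gᶜ ⊆ (A ×ˢ Set.univ) ∪ (Set.univ ×ˢ B) := by
    rintro ⟨X, Z⟩ hm
    by_contra hcon
    simp only [Set.mem_union, Set.mem_prod, Set.mem_univ, and_true, true_and, not_or] at hcon
    apply hm
    intro Yhat hY
    obtain ⟨D, hD, h1, h2⟩ := hY.exists_flipped hP.bag_subset_ext Y (not_lt.1 hcon.1)
    have h3 : ¬ _ := fun h => hcon.2 ⟨D, hD, h⟩
    rw [not_le] at h3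
    refine h2.trans (add_le_add_right ?_ _)
    have h4 := h3.trans_le h1
    rw [sub_lt_iff_lt_add, ← lt_div_iff₀' hε, add_div, div_div, ← sq] at h4
    exact h4.le
  have h1 : (μ.prod ν).real Gᶜ ≤ δ := by
    refine (measureReal_mono hsub).trans ((measureReal_union_le _ _).trans ?_)
    rw [measureReal_prod_prod, measureReal_prod_prod, probReal_univ, probReal_univ]
    linarith
  rw [probReal_compl_eq_one_sub (Set.toFinite _).measurableSet] at h1
  linarith

theorem cutSum_nonneg {p : ℝ} (hp : 0 < p) : 0 ≤ P.cutSum p :=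
  Finset.sum_nonneg fun i _ => by positivity

theorem errBudget_le {p δ : ℝ} (hδ : 0 < δ) (hδ2 : δ ≤ 1 / 2) :
    P.errBudget p δ ≤
      16 * (4 ^ P.widStar * P.cutSum p + P.edgeDegStar * P.maxExtEdges * Real.log (1 / δ)) := by
  have hlog2 : Real.log 2 ≤ Real.log (1 / δ) :=
    Real.log_le_log (by norm_num) (by rw [le_div_iff₀ hδ]; linarith)
  have h1 : Real.log (2 / δ) = Real.log 2 + Real.log (1 / δ) := by
    rw [← Real.log_mul (by norm_num) (by positivity)]; congr 1; ring
  have h2 : 0 < Real.log 2 := Real.log_pos (by norm_num)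
  have h3 : (0 : ℝ) ≤ P.edgeDegStar * P.maxExtEdges := by positivity
  rw [errBudget, h1, pow_add]
  nlinarith [mul_le_mul_of_nonneg_left hlog2 h3, mul_nonneg h3 h2.le]

theorem log_succ_le {n N : ℕ} (hn : 2 ≤ n) (hN : N ≤ n) : Real.log (N + 1) ≤ 2 * Real.log n := by
  have h2 : (2 : ℝ) ≤ n := by exact_mod_cast hn
  have h3 : (N : ℝ) ≤ n := by exact_mod_cast hN
  calc Real.log (N + 1) ≤ Real.log ((n : ℝ) ^ 2) :=
        Real.log_le_log (by positivity) (by nlinarith)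
    _ = _ := by rw [Real.log_pow]; norm_num

/-- All terms are compared with `Q R`, using `K ≤ 16 Q`, `wid + 1 ≤ 2 R` and `log (N + 1) ≤ 2 log
n`. Connectedness and `n ≥ 2` make `wid`, `deg(G')`, `deg*_E` and `M` at least one, so that no term
is lost in the products. -/
theorem IsAdmissible.bound_le (hP : P.IsAdmissible) (hc : P.probed.Connected)
    (hn : 2 ≤ n) {p q δ : ℝ} (hp : 0 < p) (hpq : p < q) (hq : q < 1 / 2)
    (hδ : 0 < δ) (hδ2 : δ ≤ 1 / 2) :
    P.errBudget p δ * (P.wid + 1) + (P.errBudget p δ * (P.wid + 1) / (1 / 2 - q) +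
        (P.probed.maxDegree * P.edgeDegStar : ℝ) *
          (Real.log (4 / δ) + ⌊2 * P.treeBudget p δ⌋₊ * Real.log (N + 1)) / (1 / 2 - q) ^ 2) ≤
      100 / (1 / 2 - q) ^ 2 * (P.probed.maxDegree * P.edgeDegStar) *
        (4 ^ P.widStar * P.cutSum p + P.edgeDegStar * P.maxExtEdges * Real.log (1 / δ)) *
          (P.wid + P.treeDeg * Real.log n) := by
  set ε := 1 / 2 - q with hε
  have hε0 : 0 < ε := by linarith
  have hε2 : ε ≤ 1 / 2 := by linarith
  set Q := 4 ^ P.widStar * P.cutSum p + P.edgeDegStar * P.maxExtEdges * Real.log (1 / δ) with hQ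
  set R := (P.wid : ℝ) + P.treeDeg * Real.log n with hR
  set B : ℝ := P.probed.maxDegree * P.edgeDegStar with hB
  set K := P.errBudget p δ with hK
  have hKQ : K ≤ 16 * Q := errBudget_le hδ hδ2
  have hK0 : 0 ≤ K := errBudget_nonneg hp hδ hδ2
  have hB1 : 1 ≤ B := by
    have : 1 ≤ P.probed.maxDegree * P.edgeDegStar :=
      Nat.mul_pos (hP.one_le_maxDegree hc hn) (hP.one_le_edgeDegStar hc hn)
    rw [hB]; exact_mod_cast this
  have hM1 : (1 : ℝ) ≤ P.edgeDegStar * P.maxExtEdges := by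
    have : 1 ≤ P.edgeDegStar * P.maxExtEdges :=
      Nat.mul_pos (hP.one_le_edgeDegStar hc hn) (hP.one_le_maxExtEdges hc hn)
    exact_mod_cast this
  have hw1 : (1 : ℝ) ≤ P.wid := by exact_mod_cast hP.one_le_wid hc hn
  have hlogn : 0 < Real.log n := Real.log_pos (by exact_mod_cast hn)
  have hlog2 : Real.log 2 ≤ Real.log (1 / δ) :=
    Real.log_le_log (by norm_num) (by rw [le_div_iff₀ hδ]; linarith)
  have hl2 : 0 < Real.log 2 := Real.log_pos (by norm_num)
  have hQl : Real.log (1 / δ) ≤ Q := by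
    have h1 : 0 ≤ 4 ^ P.widStar * P.cutSum p := mul_nonneg (by positivity) (cutSum_nonneg hp)
    rw [hQ]
    nlinarith
  have hQ0 : 0 ≤ Q := by linarith
  have ht0 : (0 : ℝ) ≤ P.treeDeg * Real.log n := by positivity
  have hwR : (P.wid : ℝ) ≤ R := by rw [hR]; linarith
  have htR : P.treeDeg * Real.log n ≤ R := by rw [hR]; linarith
  have hR1 : 1 ≤ R := hw1.trans hwR
  have hQR : 0 ≤ Q * R := mul_nonneg hQ0 (by linarith)
  have h1 : K * (P.wid + 1) ≤ 32 * (Q * R) := by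
    calc K * (P.wid + 1) ≤ (16 * Q) * (2 * R) := by gcongr; linarith
      _ = _ := by ring
  have h2 : Real.log (4 / δ) ≤ 3 * (Q * R) := by
    have e : Real.log (4 / δ) = 2 * Real.log 2 + Real.log (1 / δ) := by
      rw [show (4 : ℝ) / δ = 2 ^ 2 * (1 / δ) by ring,
        Real.log_mul (by norm_num) (by positivity), Real.log_pow]
      norm_num
    have : Q ≤ Q * R := by nlinarith
    linarith
  have h3 : ⌊2 * P.treeBudget p δ⌋₊ * Real.log (N + 1) ≤ 64 * (Q * R) := by
    have hT0 : 0 ≤ P.treeBudget p δ := by rw [treeBudget]; positivity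
    calc ⌊2 * P.treeBudget p δ⌋₊ * Real.log (N + 1)
        ≤ (2 * P.treeBudget p δ) * (2 * Real.log n) := by
          gcongr
          · exact Real.log_nonneg (by have : (0 : ℝ) ≤ N := by positivity
                                      linarith)
          · exact Nat.floor_le (by positivity)
          · exact log_succ_le hn (hP.card_le hn)
      _ = 4 * K * (P.treeDeg * Real.log n) := by rw [treeBudget]; ring
      _ ≤ 4 * (16 * Q) * R := by gcongr
      _ = _ := by ring
  -- This needs only `ε ≤ 1 / 2`; it merges the terms of order `1` and `1 / ε` into the `1 / ε ^ 2`
  -- term.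
  have hinv : 1 + 1 / ε ≤ 1 / ε ^ 2 := by
    rw [le_div_iff₀ (by positivity)]
    have : (1 + 1 / ε) * ε ^ 2 = ε ^ 2 + ε := by field_simp
    rw [this]; nlinarith
  have h4 : K * (P.wid + 1) + K * (P.wid + 1) / ε ≤ 32 * (B * (Q * R)) / ε ^ 2 := by
    calc K * (P.wid + 1) + K * (P.wid + 1) / ε = K * (P.wid + 1) * (1 + 1 / ε) := by ring
      _ ≤ (32 * (Q * R)) * (1 / ε ^ 2) := by gcongr
      _ ≤ (32 * (B * (Q * R))) * (1 / ε ^ 2) := by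
          gcongr ?_ * _
          exact mul_le_mul_of_nonneg_left (le_mul_of_one_le_left hQR hB1) (by norm_num)
      _ = _ := by ring
  have h5 : B * (Real.log (4 / δ) + ⌊2 * P.treeBudget p δ⌋₊ * Real.log (N + 1)) / ε ^ 2 ≤
      67 * (B * (Q * R)) / ε ^ 2 := by
    have : B * (Real.log (4 / δ) + ⌊2 * P.treeBudget p δ⌋₊ * Real.log (N + 1)) ≤
        B * (67 * (Q * R)) := by gcongr; linarith
    exact div_le_div_of_nonneg_right (by linarith) (by positivity)
  have h6 : 100 / ε ^ 2 * B * Q * R = 32 * (B * (Q * R)) / ε ^ 2 + 67 * (B * (Q * R)) / ε ^ 2 +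
      (B * (Q * R)) / ε ^ 2 := by ring
  have h7 : 0 ≤ (B * (Q * R)) / ε ^ 2 := by positivity
  rw [h6]
  linarith

/-- The explicit error bound. -/
theorem IsAdmissible.measure_error_le (hP : P.IsAdmissible) (hc : P.probed.Connected)
    (hn : 2 ≤ n) (Y : Fin n → ℤˣ) {p q δ : ℝ} (hp : 0 < p) (hpq : p < q) (hq : q < 1 / 2)
    (hδ : 0 < δ) (hδ2 : δ ≤ 1 / 2) :
    1 - δ ≤ (obsLaw P Y p q).real
      {m | ∀ Yhat : Fin n → ℤˣ, P.IsOutput p δ m.1 m.2 Yhat →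
        (hammingDist Yhat Y : ℝ) ≤
          100 / (1 / 2 - q) ^ 2 * (P.probed.maxDegree * P.edgeDegStar) *
            (4 ^ P.widStar * P.cutSum p + P.edgeDegStar * P.maxExtEdges * Real.log (1 / δ)) *
              (P.wid + P.treeDeg * Real.log n)} := by
  have : Fact (p ∈ Set.Icc (0 : ℝ) 1) := ⟨hp.le, by linarith⟩
  have : Fact (q ∈ Set.Icc (0 : ℝ) 1) := ⟨by linarith, by linarith⟩
  have : IsProbabilityMeasure (obsLaw P Y p q) := by rw [obsLaw]; infer_instance
  refine (hP.measure_hammingDist_le hc hn Y hp hpq hq hδ hδ2).trans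
    (measureReal_mono fun m hm Yhat hY => ?_)
  exact (hm Yhat hY).trans (hP.bound_le hc hn hp hpq hq hδ hδ2)

theorem BoundedBy.bound_le {D : ℕ} (hD : P.BoundedBy D) (hP : P.IsAdmissible) (hn : 2 ≤ n)
    {p q : ℝ} (hp : 0 < p) (hq : q < 1 / 2) :
    100 / (1 / 2 - q) ^ 2 * (P.probed.maxDegree * P.edgeDegStar) *
        (4 ^ P.widStar * P.cutSum p +
          P.edgeDegStar * P.maxExtEdges * Real.log (1 / (1 / (n : ℝ)))) *
            (P.wid + P.treeDeg * Real.log n) ≤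
      (100 * D ^ 2 * (4 ^ D + D ^ 2) * (3 * D)) / (1 / 2 - q) ^ 2 * Real.log n *
        (P.cutSum p + Real.log n) := by
  have hε : 0 < 1 / 2 - q := by linarith
  have h1 : (P.probed.maxDegree : ℝ) ≤ D := by exact_mod_cast hD.maxDegree_le
  have h2 : (P.edgeDegStar : ℝ) ≤ D := by exact_mod_cast hD.edgeDegStar_le
  have h3 : (P.maxExtEdges : ℝ) ≤ D := by exact_mod_cast hD.maxExtEdges_le
  have h4 : (P.treeDeg : ℝ) ≤ D := by exact_mod_cast hD.treeDeg_le
  have h5 : (P.wid : ℝ) ≤ D := by exact_mod_cast hP.wid_le_widStar.trans hD.widStar_le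
  have h6 : (4 : ℝ) ^ P.widStar ≤ 4 ^ D := pow_le_pow_right₀ (by norm_num) hD.widStar_le
  have hS : 0 ≤ P.cutSum p := cutSum_nonneg hp
  have hlog2 : (1 / 2 : ℝ) ≤ Real.log 2 := by have := Real.log_two_gt_d9; linarith
  have hlogn : 1 / 2 ≤ Real.log n :=
    hlog2.trans (Real.log_le_log (by norm_num) (by exact_mod_cast hn))
  have hlog0 : 0 ≤ Real.log n := by linarith
  rw [one_div_one_div]
  have e1 : 4 ^ P.widStar * P.cutSum p + P.edgeDegStar * P.maxExtEdges * Real.log n ≤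
      (4 ^ D + D ^ 2) * (P.cutSum p + Real.log n) := by
    have a : 4 ^ P.widStar * P.cutSum p ≤ 4 ^ D * P.cutSum p := by gcongr
    have b : P.edgeDegStar * P.maxExtEdges * Real.log n ≤ D * D * Real.log n := by gcongr
    have c : (0 : ℝ) ≤ 4 ^ D * Real.log n := by positivity
    have d : (0 : ℝ) ≤ D ^ 2 * P.cutSum p := by positivity
    nlinarith
  -- The constant term `wid ≤ D` is absorbed through `1 ≤ 2 log n`.
  have e2 : P.wid + P.treeDeg * Real.log n ≤ 3 * D * Real.log n := by
    have a : P.treeDeg * Real.log n ≤ D * Real.log n := by gcongr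
    have b : (D : ℝ) * 1 ≤ D * (2 * Real.log n) := by gcongr; linarith
    linarith
  have e0 : 0 ≤ 4 ^ P.widStar * P.cutSum p + P.edgeDegStar * P.maxExtEdges * Real.log n := by
    positivity
  calc _ ≤ 100 / (1 / 2 - q) ^ 2 * (D * D) * ((4 ^ D + D ^ 2) * (P.cutSum p + Real.log n)) *
        (3 * D * Real.log n) := by gcongr
    _ = _ := by ring

theorem IsAdmissible.cutSum_le (hP : P.IsAdmissible) (hn : 2 ≤ n) {p : ℝ} (hp : 0 < p)
    (hp1 : p ≤ 1) {Δ : ℕ} (hΔ : ∀ i, Δ ≤ P.mincutStar i) :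
    P.cutSum p ≤ p ^ ((Δ + 1) / 2) * n := by
  calc P.cutSum p ≤ ∑ _i : Fin N, p ^ ((Δ + 1) / 2) := by
        refine Finset.sum_le_sum fun i _ => pow_le_pow_of_le_one hp.le hp1 ?_
        have := hΔ i
        omega
    _ = p ^ ((Δ + 1) / 2) * N := by simp [mul_comm]
    _ ≤ _ := by gcongr; exact hP.card_le hn

end Setup

/-! ## Values of the programs -/

namespace Timed

@[simp] theorem bind_val {α β : Type} (x : Timed α) (f : α → Timed β) :
    (x >>= f).val = (f x.val).val := rfl

@[simp] theorem bind_time {α β : Type} (x : Timed α) (f : α → Timed β) :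
    (x >>= f).time = x.time + (f x.val).time := rfl

theorem bind_assoc {α β γ : Type} (x : Timed α) (f : α → Timed β) (g : β → Timed γ) :
    x >>= f >>= g = x >>= fun a => f a >>= g :=
  congrArg (Timed.mk _) (Nat.add_assoc _ _ _)

@[simp] theorem pure_val {α : Type} (a : α) : (pure a : Timed α).val = a := rfl

@[simp] theorem pure_time {α : Type} (a : α) : (pure a : Timed α).time = 0 := rfl

@[simp] theorem tick_time (k : ℕ) : (tick k).time = k := rfl

@[simp] theorem fetch_val {ι α : Type} (a : ι → α) (i : ι) : (fetch a i).val = a i := rfl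

@[simp] theorem fetch_time {ι α : Type} (a : ι → α) (i : ι) : (fetch a i).time = 1 := rfl

@[simp] theorem fillFin_val {α : Type} {m : ℕ} (f : Fin m → Timed α) (i : Fin m) :
    (fillFin f).val i = (f i).val := rfl

@[simp] theorem fillUpTo_val {α : Type} (L : ℕ) (f : ℕ → Timed α) (k : ℕ) :
    (fillUpTo L f).val k = (f (min k L)).val := rfl

@[simp] theorem fillSign_val {α : Type} (f : ℤˣ → Timed α) (s : ℤˣ) :
    (fillSign f).val s = (f s).val := by
  rcases Int.units_eq_one_or s with rfl | rfl
  · simp [fillSign]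
  · have : (-1 : ℤˣ) ≠ 1 := by decide
    simp [fillSign, this]

theorem fillSign_time {α : Type} (f : ℤˣ → Timed α) :
    (fillSign f).time = 2 + ((f 1).time + (f (-1)).time) := rfl

@[simp] theorem ite_val {α : Type} (c : Prop) [Decidable c] (x y : Timed α) :
    (if c then x else y).val = if c then x.val else y.val := by split <;> rfl

theorem forEach_val {α β : Type} (l : List α) (b : β) (f : β → α → Timed β) :
    (forEach l b f).val = l.foldl (fun b a => (f b a).val) b := by
  induction l generalizing b with
  | nil => rfl
  | cons a l ih => simp [forEach, ih]

theorem forEach_time_le {α β : Type} (l : List α) (b : β) (f : β → α → Timed β) (g : α → ℕ)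
    (h : ∀ b, ∀ a ∈ l, (f b a).time ≤ g a) :
    (forEach l b f).time ≤ (l.map fun a => g a + 1).sum := by
  induction l generalizing b with
  | nil => simp [forEach]
  | cons a l ih =>
    have h1 := h b a (by simp)
    have h2 := ih (f b a).val fun b a ha => h b a (by simp [ha])
    simp only [forEach, bind_time, tick_time, List.map_cons, List.sum_cons]
    omega

theorem forEach_time_le_mul {α β : Type} (l : List α) (b : β) (f : β → α → Timed β) (k : ℕ)
    (h : ∀ b, ∀ a ∈ l, (f b a).time ≤ k) :
    (forEach l b f).time ≤ l.length * (k + 1) := by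
  simpa using forEach_time_le l b f (fun _ => k) h

end Timed

theorem foldl_add_eq_sum {α : Type*} (l : List α) (g : α → ℕ) (acc : ℕ) :
    l.foldl (fun acc a => acc + g a) acc = acc + (l.map g).sum := by
  induction l generalizing acc with
  | nil => simp
  | cons a l ih => simp [ih, add_assoc]

theorem foldl_sort_add {m : ℕ} (s : Finset (Fin m)) (g : Fin m → ℕ) (acc : ℕ) :
    (s.sort (· ≤ ·)).foldl (fun acc a => acc + g a) acc = acc + ∑ a ∈ s, g a := by
  rw [foldl_add_eq_sum, ← List.sum_toFinset g (Finset.sort_nodup _ _), Finset.sort_toFinset]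

/-- Keeping the better of two cells. -/
theorem foldl_argmin {α β : Type*} (l : List α) (f : α → ℕ × β) (c : ℕ × β) :
    let r := l.foldl (fun c a => if (f a).1 < c.1 then f a else c) c
    (r = c ∨ ∃ a ∈ l, r = f a) ∧ r.1 ≤ c.1 ∧ ∀ a ∈ l, r.1 ≤ (f a).1 := by
  induction l generalizing c with
  | nil => simp
  | cons a l ih =>
    obtain ⟨h1, h2, h3⟩ := ih (if (f a).1 < c.1 then f a else c)
    simp only [List.foldl_cons]
    refine ⟨?_, ?_, ?_⟩
    · rcases h1 with h1 | ⟨b, hb, h1⟩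
      · rw [h1]
        split_ifs
        · exact Or.inr ⟨a, by simp, rfl⟩
        · exact Or.inl rfl
      · exact Or.inr ⟨b, by simp [hb], h1⟩
    · refine h2.trans ?_
      split_ifs <;> omega
    · intro b hb
      rcases List.mem_cons.1 hb with rfl | hb
      · refine h2.trans ?_
        split_ifs <;> omega
      · exact h3 b hb

namespace Setup

variable {n N : ℕ} {P : Setup n N}

/-- The test `u < v` selects one of the two orders of each edge, so the pairs counted correspond to
edges of `E'(W*)`. The default value of `readEdge` never enters, because probed edges are edges of
`G`. -/
theorem energyProg_val (hP : P.probed ≤ P.graph) (X : EdgeObs P) (i : Fin N) (y : Fin n → ℤˣ) :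
    (P.energyProg X ((P.ext i).sort (· ≤ ·)) y).val = P.disagreements X i y := by
  let g : Fin n → Fin n → ℕ := fun u v =>
    if h : (u < v ∧ P.probed.Adj u v) then
      (if y u * y v ≠ X ⟨s(u, v), hP h.2⟩ then 1 else 0) else 0
  have hstep : ∀ acc u v, (do
      tick 2
      if u < v ∧ P.probed.Adj u v then
        let x ← P.readEdge X u v
        let a ← readLabel ((P.ext i).sort (· ≤ ·)).length y u
        let b ← readLabel ((P.ext i).sort (· ≤ ·)).length y v
        tick 3
        pure (if a * b ≠ x then acc + 1 else acc)
      else pure acc : Timed ℕ).val = acc + g u v := by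
    intro acc u v
    simp only [bind_val, ite_val, pure_val, readEdge, readLabel, g]
    by_cases h : u < v ∧ P.probed.Adj u v
    · have h' := hP h.2
      rw [if_pos h, dif_pos h, dif_pos h']
      split_ifs <;> rfl
    · rw [if_neg h, dif_neg h, add_zero]
  simp only [energyProg, forEach_val, hstep, foldl_sort_add, zero_add]
  rw [disagreements, ← Finset.sum_product']
  have hg : ∀ x : Fin n × Fin n, g x.1 x.2 =
      if ∃ h : (x.1 < x.2 ∧ P.probed.Adj x.1 x.2), y x.1 * y x.2 ≠ X ⟨s(x.1, x.2), hP h.2⟩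
        then 1 else 0 := by
    intro x
    by_cases h : x.1 < x.2 ∧ P.probed.Adj x.1 x.2 <;> simp [g, h]
  simp_rw [hg]
  rw [← Finset.card_filter]
  refine Finset.card_bij (fun x hx => ⟨s(x.1, x.2), ?_⟩) ?_ ?_ ?_
  · simp only [Finset.mem_filter] at hx
    exact hP hx.2.1.2
  · rintro ⟨u, v⟩ hx
    simp only [Finset.mem_filter, Finset.mem_product] at hx
    obtain ⟨⟨hu, hv⟩, h, hne⟩ := hx
    simp [mem_extEdges, h.2, hu, hv]
    exact hne
  · rintro ⟨u, v⟩ hx ⟨u', v'⟩ hx' h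
    simp only [Finset.mem_filter, Finset.mem_product] at hx hx'
    obtain ⟨-, h1, -⟩ := hx
    obtain ⟨-, h2, -⟩ := hx'
    rcases Sym2.eq_iff.1 (congrArg Subtype.val h) with ⟨rfl, rfl⟩ | ⟨rfl, rfl⟩
    · rfl
    · exact absurd (h1.1.trans h2.1) (lt_irrefl _)
  · rintro ⟨e, he⟩ h
    induction e with | _ u v => ?_
    simp only [Finset.mem_filter, Finset.mem_univ, true_and, mem_extEdges, edgeProd_mk] at h
    obtain ⟨⟨hadj, hu, hv⟩, hne⟩ := h
    rcases lt_or_gt_of_ne hadj.ne with hlt | hlt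
    · refine ⟨(u, v), ?_, rfl⟩
      simp only [Finset.mem_filter, Finset.mem_product]
      exact ⟨⟨hu, hv⟩, ⟨hlt, hadj⟩, hne⟩
    · refine ⟨(v, u), ?_, by simp [Sym2.eq_swap]⟩
      simp only [Finset.mem_filter, Finset.mem_product]
      refine ⟨⟨hv, hu⟩, ⟨hlt, hadj.symm⟩, ?_⟩
      rw [mul_comm]
      convert hne using 3
      exact Subtype.ext Sym2.eq_swap

theorem labelings_eq_one {l : List (Fin n)} {y : Fin n → ℤˣ} (hy : y ∈ labelings l) {v : Fin n}
    (hv : v ∉ l) : y v = 1 := by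
  induction l generalizing y with
  | nil => simp only [labelings, List.mem_singleton] at hy; rw [hy]
  | cons a l ih =>
    simp only [labelings, List.mem_flatMap, List.mem_cons, List.not_mem_nil, or_false] at hy
    simp only [List.mem_cons, not_or] at hv
    obtain ⟨z, hz, rfl | rfl⟩ := hy
    · exact ih hz hv.2
    · rw [Function.update_of_ne hv.1]; exact ih hz hv.2

theorem exists_labeling (l : List (Fin n)) (y : Fin n → ℤˣ) :
    ∃ z ∈ labelings l, ∀ v ∈ l, z v = y v := by
  induction l with
  | nil => exact ⟨fun _ => 1, by simp [labelings], by simp⟩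
  | cons a l ih =>
    obtain ⟨z, hz, h⟩ := ih
    by_cases hza : z a = y a
    · refine ⟨z, ?_, ?_⟩
      · simp only [labelings, List.mem_flatMap]
        exact ⟨z, hz, by simp⟩
      · intro v hv
        rcases List.mem_cons.1 hv with rfl | hv
        · exact hza
        · exact h v hv
    -- A wrong label at `a` shows that `a` has not been treated yet, so it still carries the default
    -- `1` and the update to `-1` corrects it.
    · have ha : a ∉ l := fun ha => hza (h a ha)
      have h1 := labelings_eq_one hz ha
      have h2 : y a = -1 := by
        rw [h1] at hza
        exact (units_int_ne_iff.1 (Ne.symm hza))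
      refine ⟨Function.update z a (-1), ?_, ?_⟩
      · simp only [labelings, List.mem_flatMap]
        exact ⟨z, hz, by simp⟩
      · intro v hv
        rcases List.mem_cons.1 hv with rfl | hv'
        · rw [Function.update_self, h2]
        · rw [Function.update_of_ne (by rintro rfl; exact ha hv')]
          exact h v hv'

theorem length_labelings (l : List (Fin n)) : (labelings l).length = 2 ^ l.length := by
  induction l with
  | nil => rfl
  | cons a l ih =>
    simp only [labelings, List.length_flatMap, List.length_cons, List.length_nil]
    simp [ih, pow_succ]

theorem disagreements_congr (X : EdgeObs P) (i : Fin N) {y z : Fin n → ℤˣ}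
    (h : ∀ v ∈ P.ext i, y v = z v) : P.disagreements X i y = P.disagreements X i z := by
  rw [disagreements, disagreements]
  congr 1
  refine Finset.filter_congr fun e _ => ?_
  obtain ⟨e, he⟩ := e
  induction e with | _ u v => ?_
  refine and_congr_right fun hm => ?_
  rw [mem_extEdges] at hm
  simp only [edgeProd_mk, h u hm.2.1, h v hm.2.2]

/-- The brute-force search finds a minimizer. -/
theorem estimatorProg_val_le (hP : P.probed ≤ P.graph) (X : EdgeObs P) (i : Fin N)
    (y : Fin n → ℤˣ) :
    P.disagreements X i (P.estimatorProg X ((P.ext i).sort (· ≤ ·))).val ≤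
      P.disagreements X i y := by
  obtain ⟨z, hz, hzy⟩ := exists_labeling ((P.ext i).sort (· ≤ ·)) y
  have := foldl_argmin (labelings ((P.ext i).sort (· ≤ ·)))
    (fun y => (P.disagreements X i y, y)) (P.disagreements X i (fun _ => 1), fun _ => 1)
  simp only [estimatorProg, bind_val, pure_val, forEach_val, energyProg_val hP]
  obtain ⟨h1, -, h3⟩ := this
  rw [← disagreements_congr X i fun v hv => hzy v ((Finset.mem_sort _).2 hv)]
  refine le_trans (le_of_eq ?_) (h3 z hz)
  rcases h1 with h1 | ⟨a, -, h1⟩ <;> rw [h1]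

theorem costProg_val (Z : VertexObs n) (est : Fin N → Fin n → ℤˣ) (i : Fin N) (s : ℤˣ) :
    (P.costProg Z est i s).val = P.bagCost Z est i s := by
  simp only [costProg, forEach_val, bind_val, readLabel, pure_val, fetch_val]
  rw [bagCost, Finset.card_filter, ← zero_add (∑ v ∈ P.bag i, _), ← foldl_sort_add]
  congr 1
  funext acc v
  by_cases h : s * est i v = Z v <;> simp [h]

theorem foldl_find {m : ℕ} (s : Finset (Fin m)) (l : List (Fin m)) (o : Option (Fin m)) :
    l.foldl (fun acc v => if (acc.isNone = true) ∧ v ∈ s then some v else acc) o =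
      o.or (l.find? fun v => v ∈ s) := by
  induction l generalizing o with
  | nil => simp
  | cons a l ih =>
    rw [List.foldl_cons, ih]
    cases o with
    | none => by_cases h : a ∈ s <;> simp [h]
    | some b => simp

theorem find_sorted {m : ℕ} {s : Finset (Fin m)} {l : List (Fin m)} (hl : l.Pairwise (· ≤ ·))
    {v : Fin m} (hv : v ∈ l) (hvs : v ∈ s) (hmin : ∀ w ∈ l, w ∈ s → v ≤ w) :
    l.find? (fun v => v ∈ s) = some v := by
  induction l with
  | nil => simp at hv
  | cons a l ih =>
    rw [List.pairwise_cons] at hl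
    by_cases ha : a ∈ s
    · have h1 := hmin a (by simp) ha
      have h2 : a ≤ v := by
        rcases List.mem_cons.1 hv with rfl | hv
        · exact le_rfl
        · exact hl.1 v hv
      simp [ha, le_antisymm h1 h2]
    · have hva : v ≠ a := by rintro rfl; exact ha hvs
      rw [List.find?_cons_of_neg (by simpa using ha)]
      exact ih hl.2 (by simpa [hva] using hv) fun w hw => hmin w (by simp [hw])

/-- The vertices that are common to the components at the ends of `e`. -/
def common (P : Setup n N) (e : Sym2 (Fin N)) : Finset (Fin n) :=
  Finset.univ.filter fun v => ∀ i ∈ e, v ∈ P.bag i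

theorem common_mk (i j : Fin N) : P.common s(i, j) = P.bag i ∩ P.bag j := by
  ext v; simp [common]

/-- The list is sorted, so the first hit is the least common vertex. It depends only on the
unordered edge, as required of `link` in `IsOutput`. -/
theorem signProg_val (est : Fin N → Fin n → ℤˣ) (i j : Fin N) (h : (P.common s(i, j)).Nonempty) :
    (P.signProg est i j).val =
      est i ((P.common s(i, j)).min' h) * est j ((P.common s(i, j)).min' h) := by
  have hmem := Finset.min'_mem _ h
  set v := (P.common s(i, j)).min' h with hv
  have hmem' : v ∈ P.bag i ∧ v ∈ P.bag j := by
    rw [common_mk, Finset.mem_inter] at hmem; exact hmem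
  have hlink : (P.linkProg i j).val = some v := by
    simp only [linkProg, forEach_val, bind_val, pure_val]
    rw [foldl_find, Option.none_or]
    refine find_sorted (Finset.pairwise_sort _ _) ((Finset.mem_sort _).2 hmem'.1) hmem'.2 ?_
    intro w hw hw'
    rw [hv]
    refine Finset.min'_le _ _ ?_
    rw [common_mk, Finset.mem_inter]
    exact ⟨(Finset.mem_sort _).1 hw, hw'⟩
  simp only [signProg, bind_val, hlink, readLabel, pure_val]

theorem foldl_update {m : ℕ} {β : Type*} (l : List (Fin m)) (h : Fin m → β) (b : β) (v : Fin m) :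
    l.foldl (fun h v => Function.update h v b) h v = if v ∈ l then b else h v := by
  induction l generalizing h with
  | nil => simp
  | cons a l ih =>
    rw [List.foldl_cons, ih]
    by_cases h1 : v ∈ l
    · simp [h1]
    · by_cases h2 : v = a
      · subst h2; simp [h1]
      · simp [h1, h2]

theorem homeProg_val_mem (hP : ∀ v, ∃ i, v ∈ P.bag i) (root : Fin N) (v : Fin n) :
    v ∈ P.bag ((P.homeProg root).val v) := by
  have hinner : ∀ (h : Fin n → Fin N) (i : Fin N),
      (forEach ((P.bag i).sort (· ≤ ·)) h fun h v => do
        tick 1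
        pure (Function.update h v i)).val v = if v ∈ P.bag i then i else h v := by
    intro h i
    simp only [forEach_val, bind_val, pure_val, foldl_update, Finset.mem_sort]
  -- Invariant of the loop: the current entry for `v` is valid, or a component containing `v` is
  -- still to come.
  have main : ∀ (l : List (Fin N)) (h : Fin n → Fin N),
      (v ∈ P.bag (h v) ∨ ∃ i ∈ l, v ∈ P.bag i) →
      v ∈ P.bag (l.foldl (fun h i => (forEach ((P.bag i).sort (· ≤ ·)) h fun h v => do
        tick 1
        pure (Function.update h v i)).val) h v) := by
    intro l
    induction l with
    | nil => intro h hh; simpa using hh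
    | cons a l ih =>
      intro h hh
      rw [List.foldl_cons]
      refine ih _ ?_
      rw [hinner]
      by_cases ha : v ∈ P.bag a
      · simp [ha]
      · simpa [ha] using hh
  simp only [homeProg, bind_val]
  rw [forEach_val]
  refine main _ _ (Or.inr ?_)
  obtain ⟨i, hi⟩ := hP v
  exact ⟨i, List.mem_finRange i, hi⟩

end Setup

/-! ## Correctness of the dynamic program -/

namespace Setup

/-! ### Optimal cells and how they combine -/

section Cells

variable {N : ℕ}

/-- The labeling `s` of the components in `A` is what `lab` stores. -/
def Stores (lab : Labels N) (A : Finset (Fin N)) (s : Fin N → ℤˣ) : Prop :=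
  ∀ a : Fin N → ℤˣ, (writeLabels lab a).val = (fun x => if x ∈ A then s x else a x) ∧
    (writeLabels lab a).time + 1 = 2 * A.card

theorem stores_single (u : Fin N) {t : ℤˣ} {s : Fin N → ℤˣ} (h : s u = t) :
    Stores (Labels.single u t) {u} s := by
  intro a
  refine ⟨?_, rfl⟩
  funext x
  simp only [writeLabels, bind_val, pure_val, Finset.mem_singleton]
  by_cases hx : x = u
  · subst hx; simp [h]
  · simp [hx]

/-- A stored labeling of `A` is a binary tree with `2 |A| - 1` nodes; in the form `time + 1 = 2 |A|`
the count is additive for disjoint sets. -/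
theorem Stores.join {l m : Labels N} {A B : Finset (Fin N)} {s : Fin N → ℤˣ}
    (hl : Stores l A s) (hm : Stores m B s) (hAB : Disjoint A B) :
    Stores (Labels.join l m) (A ∪ B) s := by
  intro a
  obtain ⟨h1, h2⟩ := hl a
  obtain ⟨h3, h4⟩ := hm (writeLabels l a).val
  refine ⟨?_, ?_⟩
  · simp only [writeLabels, bind_val]
    rw [h3, h1]
    funext x
    by_cases hA : x ∈ A <;> by_cases hB : x ∈ B <;> simp [hA, hB]
  · simp only [writeLabels, bind_time, tick_time]
    rw [Finset.card_union_of_disjoint hAB]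
    omega

theorem Stores.congr {l : Labels N} {A : Finset (Fin N)} {s s' : Fin N → ℤˣ} (h : Stores l A s)
    (hs : ∀ x ∈ A, s x = s' x) : Stores l A s' := by
  intro a
  refine ⟨?_, (h a).2⟩
  rw [(h a).1]
  funext x
  by_cases hx : x ∈ A <;> simp [hx]
  exact hs x hx

variable (cost : Fin N → ℤˣ → ℕ)

/-- The cell `x` has the least cost of a labeling of `A` with the property `F`, and stores such a
labeling. -/
def IsOptimal (A : Finset (Fin N)) (F : (Fin N → ℤˣ) → Prop) (x : ℕ × Labels N) : Prop :=
  (∃ s, F s ∧ ∑ i ∈ A, cost i (s i) = x.1 ∧ Stores x.2 A s) ∧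
    ∀ s, F s → x.1 ≤ ∑ i ∈ A, cost i (s i)

/-- The property `F` depends only on the labels in `A`. -/
def IsLocal (A : Finset (Fin N)) (F : (Fin N → ℤˣ) → Prop) : Prop :=
  ∀ s s' : Fin N → ℤˣ, (∀ x ∈ A, s x = s' x) → F s → F s'

variable {cost}

theorem IsOptimal.congr {A : Finset (Fin N)} {F G : (Fin N → ℤˣ) → Prop} {x : ℕ × Labels N}
    (h : IsOptimal cost A F x) (hFG : ∀ s, F s ↔ G s) : IsOptimal cost A G x := by
  rwa [← funext fun s => propext (hFG s)]

theorem IsOptimal.better {A : Finset (Fin N)} {F G : (Fin N → ℤˣ) → Prop} {x y : ℕ × Labels N}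
    (hx : IsOptimal cost A F x) (hy : IsOptimal cost A G y) :
    IsOptimal cost A (fun s => F s ∨ G s) (if y.1 < x.1 then y else x) := by
  split_ifs with h
  · obtain ⟨⟨s, h1, h2⟩, h3⟩ := hy
    refine ⟨⟨s, Or.inr h1, h2⟩, ?_⟩
    rintro s (hs | hs)
    · exact h.le.trans (hx.2 s hs)
    · exact h3 s hs
  · obtain ⟨⟨s, h1, h2⟩, h3⟩ := hx
    refine ⟨⟨s, Or.inl h1, h2⟩, ?_⟩
    rintro s (hs | hs)
    · exact h3 s hs
    · exact (not_lt.1 h).trans (hy.2 s hs)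

theorem IsOptimal.foldl {α : Type*} {A : Finset (Fin N)} {f : α → ℕ × Labels N}
    {G : α → (Fin N → ℤˣ) → Prop} (l : List α) (hf : ∀ a ∈ l, IsOptimal cost A (G a) (f a))
    {F : (Fin N → ℤˣ) → Prop} {x : ℕ × Labels N} (hx : IsOptimal cost A F x) :
    IsOptimal cost A (fun s => F s ∨ ∃ a ∈ l, G a s)
      (l.foldl (fun c a => if (f a).1 < c.1 then f a else c) x) := by
  induction l generalizing F x with
  | nil => exact hx.congr fun s => by simp
  | cons a l ih =>
    rw [List.foldl_cons]
    refine (ih (fun b hb => hf b (by simp [hb])) (hx.better (hf a (by simp)))).congr fun s => ?_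
    simp [or_assoc]

/-- Locality allows the two optimal labelings to be glued along the disjoint sets without losing
either property. -/
theorem IsOptimal.add {A B : Finset (Fin N)} {F G : (Fin N → ℤˣ) → Prop} {x y : ℕ × Labels N}
    (hx : IsOptimal cost A F x) (hy : IsOptimal cost B G y) (hAB : Disjoint A B)
    (hF : IsLocal A F) (hG : IsLocal B G) :
    IsOptimal cost (A ∪ B) (fun s => F s ∧ G s) (x.1 + y.1, Labels.join x.2 y.2) := by
  obtain ⟨⟨s, h1, h2, h3⟩, h4⟩ := hx
  obtain ⟨⟨s', h1', h2', h3'⟩, h4'⟩ := hy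
  constructor
  · let s'' : Fin N → ℤˣ := fun x => if x ∈ A then s x else s' x
    have hA : ∀ x ∈ A, s x = s'' x := fun x hx => by simp [s'', hx]
    have hB : ∀ x ∈ B, s' x = s'' x := fun x hx => by
      simp [s'', Finset.disjoint_right.1 hAB hx]
    refine ⟨s'', ⟨hF _ _ hA h1, hG _ _ hB h1'⟩, ?_, (h3.congr hA).join (h3'.congr hB) hAB⟩
    rw [Finset.sum_union hAB, ← h2, ← h2']
    congr 1
    · exact Finset.sum_congr rfl fun x hx => by rw [hA x hx]
    · exact Finset.sum_congr rfl fun x hx => by rw [hB x hx]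
  · rintro s ⟨hs, hs'⟩
    rw [Finset.sum_union hAB]
    exact add_le_add (h4 s hs) (h4' s hs')

end Cells

/-! ### Tables of subtrees and messages to the parent -/

section Tables

variable {N : ℕ} (T : SimpleGraph (Fin N)) (r : Fin N) (sg : Fin N → Fin N → ℤˣ)

/-- The number of violated edges inside a subtree `A` with the root `u`. -/
noncomputable def subViolations (A : Finset (Fin N)) (u : Fin N) (s : Fin N → ℤˣ) : ℕ :=
  ((A.erase u).filter fun x => s x ≠ s (parent T r x) * sg (parent T r x) x).card

/-- `A` is connected, with `u` as the vertex closest to the root. -/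
structure IsSubtree (A : Finset (Fin N)) (u : Fin N) : Prop where
  root_mem : u ∈ A
  parent_mem : ∀ x ∈ A, x ≠ u → parent T r x ∈ A

variable {T r sg}

theorem IsSubtree.subViolations_congr {A : Finset (Fin N)} {u : Fin N} (h : IsSubtree T r A u)
    {s s' : Fin N → ℤˣ} (hs : ∀ x ∈ A, s x = s' x) :
    subViolations T r sg A u s = subViolations T r sg A u s' := by
  rw [subViolations, subViolations]
  congr 1
  refine Finset.filter_congr fun x hx => ?_
  rw [Finset.mem_erase] at hx
  rw [hs x hx.2, hs _ (h.parent_mem x hx.2 hx.1)]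

theorem IsSubtree.union {A B : Finset (Fin N)} {u c : Fin N} (hA : IsSubtree T r A u)
    (hB : IsSubtree T r B c) (hcu : parent T r c = u) : IsSubtree T r (A ∪ B) u := by
  refine ⟨Finset.mem_union_left _ hA.root_mem, fun x hx hxu => ?_⟩
  rw [Finset.mem_union] at hx ⊢
  rcases hx with hx | hx
  · exact Or.inl (hA.parent_mem x hx hxu)
  · by_cases hxc : x = c
    · rw [hxc, hcu]; exact Or.inl hA.root_mem
    · exact Or.inr (hB.parent_mem x hx hxc)

/-- The only edge of the union that lies in neither part joins `c` to its parent `u`. -/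
theorem subViolations_union {A B : Finset (Fin N)} {u c : Fin N} (hA : IsSubtree T r A u)
    (hB : IsSubtree T r B c) (hcu : parent T r c = u) (hAB : Disjoint A B) (s : Fin N → ℤˣ) :
    subViolations T r sg (A ∪ B) u s = subViolations T r sg A u s +
      (subViolations T r sg B c s + if s c ≠ s u * sg u c then 1 else 0) := by
  have huB : u ∉ B := Finset.disjoint_left.1 hAB hA.root_mem
  have e1 : (A ∪ B).erase u = A.erase u ∪ B := by
    rw [Finset.erase_union_distrib, Finset.erase_eq_of_notMem huB]
  have hd : Disjoint (A.erase u) B := Finset.disjoint_of_subset_left (Finset.erase_subset _ _) hAB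
  rw [subViolations, subViolations, subViolations, e1, Finset.filter_union,
    Finset.card_union_of_disjoint (Finset.disjoint_filter_filter hd)]
  congr 1
  conv_lhs => rw [← Finset.insert_erase hB.root_mem]
  rw [Finset.filter_insert, hcu]
  split_ifs with h
  · rw [Finset.card_insert_of_notMem (by simp)]
  · simp

variable (T r sg) (cost : Fin N → ℤˣ → ℕ) (L : ℕ)

/-- The table of the subtree `A` with the root `u`. -/
def IsTable (A : Finset (Fin N)) (u : Fin N) (t : Table N) : Prop :=
  ∀ s₀, ∀ k ≤ L, IsOptimal cost A (fun s => s u = s₀ ∧ subViolations T r sg A u s ≤ k) (t s₀ k)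

/-- The message of the subtree `B` with the root `c` to the component `u` above it. -/
def IsMessage (B : Finset (Fin N)) (u c : Fin N) (h : Table N) : Prop :=
  ∀ t₀, ∀ k ≤ L, IsOptimal cost B (fun s => subViolations T r sg B c s +
    (if s c ≠ t₀ * sg u c then 1 else 0) ≤ k) (h t₀ k)

variable {T r sg cost L}

theorem isOptimal_base (u : Fin N) (s₀ : ℤˣ) :
    IsOptimal cost {u} (fun s => s u = s₀) (cost u s₀, Labels.single u s₀) := by
  refine ⟨⟨fun _ => s₀, rfl, by simp, stores_single u rfl⟩, ?_⟩
  rintro s rfl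
  simp

theorem baseTable_val (u : Fin N) (s : ℤˣ) (k : ℕ) :
    (baseTable L cost u).val s k = (cost u s, Labels.single u s) := by
  simp [baseTable]

theorem isSubtree_singleton (u : Fin N) : IsSubtree T r {u} u :=
  ⟨by simp, fun x hx hxu => absurd (by simpa using hx) hxu⟩

theorem subViolations_singleton (u : Fin N) (s : Fin N → ℤˣ) :
    subViolations T r sg {u} u s = 0 := by
  simp [subViolations]

theorem isTable_baseTable (u : Fin N) :
    IsTable T r sg cost L {u} u (baseTable L cost u).val := by
  intro s₀ k _
  rw [baseTable_val]
  exact (isOptimal_base u s₀).congr fun s => by simp [subViolations_singleton]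

/-- The child either satisfies the edge and keeps the budget `k`, or has the opposite label and
keeps `k - 1`; the second case is excluded for `k = 0`. -/
theorem IsTable.message {B : Finset (Fin N)} {u c : Fin N} {g : Table N}
    (hg : IsTable T r sg cost L B c g) :
    IsMessage T r sg cost L B u c (messageTable L (sg u c) g).val := by
  intro t₀ k hk
  simp only [messageTable, fillSign_val, fillUpTo_val, bind_val, ite_val, fetch_val, pure_val,
    min_eq_left hk, Setup.better]
  by_cases h0 : k = 0
  · rw [if_pos h0]
    refine (hg (t₀ * sg u c) k hk).congr fun s => ?_
    by_cases h : s c = t₀ * sg u c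
    · simp [h]
    · simp [h, h0]
  · rw [if_neg h0]
    refine ((hg (t₀ * sg u c) k hk).better (hg (-(t₀ * sg u c)) (k - 1) (by omega))).congr
      fun s => ?_
    by_cases h : s c = t₀ * sg u c
    · have : ¬ t₀ * sg u c = -(t₀ * sg u c) := fun h' => units_int_ne_iff.2 h' rfl
      simp [h, this]
    · rw [if_pos h]
      constructor
      · rintro (⟨h1, -⟩ | ⟨-, h2⟩)
        · exact absurd h1 h
        · omega
      · intro h3
        exact Or.inr ⟨units_int_ne_iff.1 h, by omega⟩

theorem isLocal_table {A : Finset (Fin N)} {u : Fin N} (hA : IsSubtree T r A u) (s₀ : ℤˣ)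
    (k : ℕ) : IsLocal A fun s => s u = s₀ ∧ subViolations T r sg A u s ≤ k := by
  intro s s' h
  simp only [h u hA.root_mem, hA.subViolations_congr h, imp_self]

theorem isLocal_message {B : Finset (Fin N)} {c : Fin N} (hB : IsSubtree T r B c) (t : ℤˣ)
    (k : ℕ) : IsLocal B fun s => subViolations T r sg B c s + (if s c ≠ t then 1 else 0) ≤ k := by
  intro s s' h
  simp only [h c hB.root_mem, hB.subViolations_congr h, imp_self]

/-- A single component contains no edge and uses no budget, so the whole budget goes to the child
and no split has to be searched. -/
theorem IsMessage.attachFirst {B : Finset (Fin N)} {u c : Fin N} {h : Table N}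
    (hB : IsSubtree T r B c) (hcu : parent T r c = u) (huB : u ∉ B)
    (hh : IsMessage T r sg cost L B u c h) :
    IsTable T r sg cost L ({u} ∪ B) u
      (Setup.attachFirst L (baseTable L cost u).val h).val := by
  intro s₀ k hk
  simp only [Setup.attachFirst, fillSign_val, fillUpTo_val, bind_val, fetch_val, pure_val,
    addCells, min_eq_left hk, baseTable_val]
  have hd : Disjoint {u} B := Finset.disjoint_singleton_left.2 huB
  refine ((isOptimal_base u s₀).add (hh s₀ k hk) hd ?_ (isLocal_message hB _ _)).congr fun s => ?_
  · intro s s' h hs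
    rw [← h u (by simp), hs]
  · rw [subViolations_union (isSubtree_singleton u) hB hcu hd, subViolations_singleton, zero_add]
    refine and_congr_right fun h => ?_
    rw [h]

theorem IsTable.attachNext {A B : Finset (Fin N)} {u c : Fin N} {g h : Table N}
    (hA : IsSubtree T r A u) (hB : IsSubtree T r B c) (hcu : parent T r c = u)
    (hAB : Disjoint A B) (hg : IsTable T r sg cost L A u g)
    (hh : IsMessage T r sg cost L B u c h) :
    IsTable T r sg cost L (A ∪ B) u (Setup.attachNext L g h).val := by
  intro s₀ k hk
  simp only [Setup.attachNext, fillSign_val, fillUpTo_val, bind_val, fetch_val, pure_val,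
    addCells, min_eq_left hk, forEach_val, Setup.better]
  have hcell : ∀ j ≤ k, IsOptimal cost (A ∪ B)
      (fun s => (s u = s₀ ∧ subViolations T r sg A u s ≤ k - j) ∧
        subViolations T r sg B c s + (if s c ≠ s₀ * sg u c then 1 else 0) ≤ j)
      ((g s₀ (k - j)).1 + (h s₀ j).1, Labels.join (g s₀ (k - j)).2 (h s₀ j).2) := fun j hj =>
    (hg s₀ (k - j) (by omega)).add (hh s₀ j (by omega)) hAB (isLocal_table hA _ _)
      (isLocal_message hB _ _)
  have := IsOptimal.foldl (f := fun j => ((g s₀ (k - (j + 1))).1 + (h s₀ (j + 1)).1,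
      Labels.join (g s₀ (k - (j + 1))).2 (h s₀ (j + 1)).2)) (List.range k)
    (fun j hj => hcell (j + 1) (by rw [List.mem_range] at hj; omega)) (hcell 0 (by omega))
  refine this.congr fun s => ?_
  rw [subViolations_union hA hB hcu hAB]
  constructor
  · rintro (⟨⟨h1, h2⟩, h3⟩ | ⟨j, hj, ⟨h1, h2⟩, h3⟩)
    · refine ⟨h1, ?_⟩
      rw [h1]; omega
    · rw [List.mem_range] at hj
      refine ⟨h1, ?_⟩
      rw [h1]; omega
  · rintro ⟨h1, h2⟩
    rw [h1] at h2
    -- The split is at the exact number `b` of violations charged to the child: `b = 0` is the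
    -- initial cell, and loop index `j` stands for `b = j + 1`.
    set b := subViolations T r sg B c s + if s c ≠ s₀ * sg u c then 1 else 0
    cases hb : b with
    | zero => exact Or.inl ⟨⟨h1, by omega⟩, le_rfl⟩
    | succ j => exact Or.inr ⟨j, List.mem_range.2 (by omega), ⟨h1, by omega⟩, le_rfl⟩

end Tables

/-! ### The recursion over the rooted tree -/

section Solve

variable {n N : ℕ} {P : Setup n N}

open Classical in
/-- The subtree below `u`. -/
noncomputable def below (P : Setup n N) (r u : Fin N) : Finset (Fin N) :=
  Finset.univ.filter (Below P.tree r u)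

theorem mem_below {r u x : Fin N} : x ∈ P.below r u ↔ Below P.tree r u x := by simp [below]

theorem isSubtree_below (r u : Fin N) : IsSubtree P.tree r (P.below r u) u :=
  ⟨mem_below.2 (below_self _ _), fun _ hx hxu => mem_below.2 ((mem_below.1 hx).parent hxu)⟩

/-- The components below `u`, in the order in which the dynamic program visits them. -/
def children (P : Setup n N) (above : Option (Fin N)) (u : Fin N) : List (Fin N) :=
  ((P.tree.neighborFinset u).sort (· ≤ ·)).filter fun c => above ≠ some c

open Classical in
/-- The component above `u`. -/
noncomputable def above (P : Setup n N) (r u : Fin N) : Option (Fin N) :=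
  if u = r then none else some (parent P.tree r u)

theorem mem_children (hT : P.tree.IsTree) {r u c : Fin N} :
    c ∈ P.children (P.above r u) u ↔ c ≠ r ∧ parent P.tree r c = u := by
  simp only [children, List.mem_filter, Finset.mem_sort, SimpleGraph.mem_neighborFinset,
    decide_eq_true_eq]
  rw [above, adj_iff_parent hT r]
  constructor
  · rintro ⟨⟨h1, h2⟩ | h, h3⟩
    · rw [if_neg h1, h2] at h3; exact absurd rfl h3
    · exact ⟨h.1, h.2.symm⟩
  · rintro ⟨h1, h2⟩
    refine ⟨Or.inr ⟨h1, h2.symm⟩, ?_⟩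
    split_ifs with h
    · simp
    · simp only [ne_eq, Option.some.injEq]
      intro h3
      have h4 := (parent_spec hT h1).2
      have h5 := (parent_spec hT h).2
      rw [h2] at h4; rw [h3] at h5; omega

theorem nodup_children (a : Option (Fin N)) (u : Fin N) : (P.children a u).Nodup :=
  (Finset.sort_nodup _ _).filter _

theorem above_child {r u c : Fin N} (hc : c ≠ r)
    (hcu : parent P.tree r c = u) : P.above r c = some u := by
  rw [above, if_neg hc, hcu]

theorem below_eq (hT : P.tree.IsTree) (r u : Fin N) :
    P.below r u = {u} ∪ (P.children (P.above r u) u).toFinset.biUnion (P.below r) := by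
  ext x
  rw [mem_below, below_iff]
  simp only [Finset.mem_union, Finset.mem_singleton, Finset.mem_biUnion, List.mem_toFinset,
    mem_children hT, mem_below, and_assoc]

theorem disjoint_below (hT : P.tree.IsTree) {r c d : Fin N} (hc : c ≠ r) (hd : d ≠ r)
    (h : parent P.tree r c = parent P.tree r d) (hcd : c ≠ d) :
    Disjoint (P.below r c) (P.below r d) := by
  rw [Finset.disjoint_left]
  intro x hx hx'
  exact hcd (below_child_unique hT hc hd h (mem_below.1 hx) (mem_below.1 hx'))

/-- Guarantees that recursion with fuel `N` from the root never runs out. -/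
theorem dist_lt (hT : P.tree.IsTree) (r u : Fin N) : P.tree.dist r u < N := by
  obtain ⟨p, hp, hl⟩ := (hT.connected r u).exists_path_of_dist
  have := hp.length_lt
  rw [Fintype.card_fin] at this
  omega

/-- The body of the loop over the children of `u`. -/
def childProg (P : Setup n N) (L : ℕ) (est : Fin N → Fin n → ℤˣ) (cost : Fin N → ℤˣ → ℕ)
    (fuel : ℕ) (u : Fin N) (t : Table N) (c : Fin N) : Timed (Table N) := do
  let g ← P.solveProg L est cost fuel (some u) c
  let sg ← P.signProg est u c
  let h ← messageTable L sg g
  attachNext L t h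

/-- The table of `u` after the first child. -/
def firstProg (P : Setup n N) (L : ℕ) (est : Fin N → Fin n → ℤˣ) (cost : Fin N → ℤˣ → ℕ)
    (fuel : ℕ) (u : Fin N) (base : Table N) (c : Fin N) : Timed (Table N) := do
  let g ← P.solveProg L est cost fuel (some u) c
  let sg ← P.signProg est u c
  let h ← messageTable L sg g
  attachFirst L base h

theorem solveProg_succ (L : ℕ) (est : Fin N → Fin n → ℤˣ) (cost : Fin N → ℤˣ → ℕ)
    (fuel : ℕ) (a : Option (Fin N)) (u : Fin N) :
    P.solveProg L est cost (fuel + 1) a u = (do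
      let base ← baseTable L cost u
      tick ((P.tree.neighborFinset u).sort (· ≤ ·)).length
      match P.children a u with
      | [] => pure base
      | c :: cs => do
        let t ← P.firstProg L est cost fuel u base c
        forEach cs t (P.childProg L est cost fuel u)) := by
  rw [solveProg]
  simp only [children]
  congr 1
  funext base
  congr 1
  funext _
  generalize List.filter (fun c => decide (a ≠ some c)) _ = l
  cases l with
  | nil => rfl
  | cons c cs =>
    simp only [firstProg, Timed.bind_assoc]
    rfl

/-- Passing to a child lowers the fuel by one and raises the depth by one, which preserves the
hypothesis on the fuel. The loop maintains a table for `u` together with the subtrees attached so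
far. -/
theorem isTable_solveProg (hT : P.tree.IsTree) (L : ℕ) (est : Fin N → Fin n → ℤˣ)
    (cost : Fin N → ℤˣ → ℕ) (r : Fin N) (fuel : ℕ) (u : Fin N)
    (hfuel : N ≤ fuel + P.tree.dist r u) :
    IsTable P.tree r (fun i j => (P.signProg est i j).val) cost L (P.below r u) u
      (P.solveProg L est cost fuel (P.above r u) u).val := by
  induction fuel generalizing u with
  | zero => have := dist_lt hT r u; omega
  | succ fuel ih =>
    have hchild : ∀ c, c ∈ P.children (P.above r u) u →
        IsMessage P.tree r (fun i j => (P.signProg est i j).val) cost L (P.below r c) u c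
          (messageTable L (P.signProg est u c).val
            (P.solveProg L est cost fuel (some u) c).val).val := by
      intro c hc
      obtain ⟨h1, h2⟩ := (mem_children hT).1 hc
      rw [← above_child h1 h2]
      have h3 := (parent_spec hT h1).2
      rw [h2] at h3
      exact (ih c (by omega)).message (u := u)
    have hfold : ∀ (cs : List (Fin N)) (A : Finset (Fin N)) (t : Table N),
        (∀ c ∈ cs, c ∈ P.children (P.above r u) u) → cs.Nodup → IsSubtree P.tree r A u →
        (∀ c ∈ cs, Disjoint A (P.below r c)) →
        IsTable P.tree r (fun i j => (P.signProg est i j).val) cost L A u t →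
        IsTable P.tree r (fun i j => (P.signProg est i j).val) cost L
          (A ∪ cs.toFinset.biUnion (P.below r)) u
          (cs.foldl (fun t c => (P.childProg L est cost fuel u t c).val) t) := by
      intro cs
      induction cs with
      | nil => intro A t _ _ _ _ ht; simpa using ht
      | cons c cs ihc =>
        intro A t hcs hnd hA hd ht
        rw [List.nodup_cons] at hnd
        have hc := hcs c (by simp)
        obtain ⟨h1, h2⟩ := (mem_children hT).1 hc
        have := ihc (A ∪ P.below r c) (P.childProg L est cost fuel u t c).val
          (fun d hd => hcs d (by simp [hd])) hnd.2 (hA.union (isSubtree_below r c) h2) ?_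
          (ht.attachNext hA (isSubtree_below r c) h2 (hd c (by simp)) (hchild c hc))
        · rw [List.foldl_cons, List.toFinset_cons, Finset.biUnion_insert, ← Finset.union_assoc]
          exact this
        · intro d hd'
          obtain ⟨h3, h4⟩ := (mem_children hT).1 (hcs d (by simp [hd']))
          rw [Finset.disjoint_union_left]
          exact ⟨hd d (by simp [hd']), disjoint_below hT h1 h3 (h2.trans h4.symm)
            (by rintro rfl; exact hnd.1 hd')⟩
    rw [solveProg_succ, below_eq hT]
    simp only [bind_val]
    have hmem := fun c => (mem_children hT (P := P) (r := r) (u := u) (c := c)).1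
    have hnd := P.nodup_children (P.above r u) u
    revert hchild hfold hmem hnd
    cases P.children (P.above r u) u with
    | nil =>
      intro _ _ _ _
      simpa using isTable_baseTable u
    | cons c cs =>
      intro hchild hfold hmem hnd
      rw [List.nodup_cons] at hnd
      obtain ⟨h1, h2⟩ := hmem c (by simp)
      have hu : ∀ d, d ≠ r → parent P.tree r d = u → u ∉ P.below r d := by
        intro d hd hdu
        rw [mem_below, ← hdu]
        exact not_below_child hT hd
      have hfirst := (hchild c (by simp)).attachFirst (isSubtree_below r c) h2 (hu c h1 h2)
      simp only [bind_val, forEach_val]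
      rw [List.toFinset_cons, Finset.biUnion_insert, ← Finset.union_assoc]
      refine hfold cs _ _ (fun d hd => by simp [hd]) hnd.2
        ((isSubtree_singleton u).union (isSubtree_below r c) h2) ?_ hfirst
      intro d hd
      obtain ⟨h3, h4⟩ := hmem d (by simp [hd])
      rw [Finset.disjoint_union_left, Finset.disjoint_singleton_left]
      exact ⟨hu d h3 h4, disjoint_below hT h1 h3 (h2.trans h4.symm)
        (by rintro rfl; exact hnd.1 hd)⟩

theorem below_root_eq_univ (hT : P.tree.IsTree) (r : Fin N) : P.below r r = Finset.univ := by
  ext x; simp [mem_below, below_root hT]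

theorem above_root (r : Fin N) : P.above r r = none := by simp [above]

/-- The cell that the dynamic program finally selects. -/
theorem isOptimal_root (hT : P.tree.IsTree) (L : ℕ) (est : Fin N → Fin n → ℤˣ)
    (cost : Fin N → ℤˣ → ℕ) (r : Fin N) :
    let t := (P.solveProg L est cost N none r).val
    IsOptimal cost Finset.univ
      (fun s => subViolations P.tree r (fun i j => (P.signProg est i j).val) Finset.univ r s ≤ L)
      (better (t 1 L) (t (-1) L)).val := by
  have h := P.isTable_solveProg hT L est cost r N r (by omega)
  rw [above_root, below_root_eq_univ hT] at h
  refine ((h 1 L le_rfl).better (h (-1) L le_rfl)).congr fun s => ?_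
  rcases Int.units_eq_one_or (s r) with h | h <;> simp [h]

theorem treeDecoder_val (hT : P.tree.IsTree) (L : ℕ) (est : Fin N → Fin n → ℤˣ)
    (cost : Fin N → ℤˣ → ℕ) (r : Fin N) :
    let s := (P.treeDecoder L r est cost).val
    let V := subViolations P.tree r (fun i j => (P.signProg est i j).val) Finset.univ r
    V s ≤ L ∧ ∀ s', V s' ≤ L → ∑ i, cost i (s i) ≤ ∑ i, cost i (s' i) := by
  obtain ⟨⟨s, h1, h2, h3⟩, h4⟩ := P.isOptimal_root hT L est cost r
  have h5 : (P.treeDecoder L r est cost).val = s := by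
    simp only [treeDecoder, bind_val, fetch_val]
    rw [(h3 _).1]
    simp
  simp only [h5]
  exact ⟨h1, fun s' hs' => h2.le.trans (h4 s' hs')⟩

/-- Tree edges are counted by their lower ends; as signs are their own inverses, comparing `s x`
with the parent's sign is the same as comparing products. -/
theorem violations_eq (hT : P.tree.IsTree) (r : Fin N) (est : Fin N → Fin n → ℤˣ)
    (link : Sym2 (Fin N) → Fin n)
    (hlink : ∀ i j, P.tree.Adj i j →
      (P.signProg est i j).val = est i (link s(i, j)) * est j (link s(i, j)))
    (s : Fin N → ℤˣ) :
    subViolations P.tree r (fun i j => (P.signProg est i j).val) Finset.univ r s =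
      P.violations est link s := by
  rw [violations, card_filter_edgeFinset hT r, subViolations]
  congr 1
  ext x
  simp only [Finset.mem_filter, Finset.mem_erase, Finset.mem_univ, and_true, true_and]
  refine and_congr_right fun hx => ?_
  rw [edgeProd_mk, edgeProd_mk, hlink _ _ (parent_adj hT hx).symm, Sym2.eq_swap (a := parent P.tree r x),
    mul_comm (est (parent P.tree r x) _)]
  generalize est x (link s(x, parent P.tree r x)) * est (parent P.tree r x)
    (link s(x, parent P.tree r x)) = a
  rw [not_iff_not]
  rcases Int.units_eq_one_or (s (parent P.tree r x)) with h | h <;> rw [h]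
  · simp
  · simp [neg_eq_iff_eq_neg]

end Solve

end Setup

/-! ## The program computes an output -/

namespace Setup

variable {n N : ℕ} {P : Setup n N}

theorem IsAdmissible.isOutput_decoder (hP : P.IsAdmissible) (hc : P.probed.Connected)
    {p δ : ℝ} (hp : 0 < p) (hδ : 0 < δ) (hδ2 : δ ≤ 1 / 2) (root : Fin N) (X : EdgeObs P)
    (Z : VertexObs n) : P.IsOutput p δ X Z (P.treeDecompositionDecoder p δ root X Z).val := by
  classical
  obtain ⟨v₀⟩ := hc.nonempty
  have hne : Nonempty (Fin n) := ⟨v₀⟩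
  have hT := hP.isTreeDecomposition.isTree
  have hB : 0 ≤ P.treeBudget p δ := by
    have := P.errBudget_nonneg hp hδ hδ2
    rw [treeBudget]; positivity
  set L := ⌊P.treeBudget p δ⌋₊ with hL
  let est : Fin N → Fin n → ℤˣ := fun i => (P.estimatorProg X ((P.ext i).sort (· ≤ ·))).val
  -- The least common vertex, which is the one the program finds; `v₀` fills in where the ends have
  -- no common vertex.
  let link : Sym2 (Fin N) → Fin n := fun e =>
    if h : (P.common e).Nonempty then (P.common e).min' h else v₀
  let s := (P.treeDecoder L root est (P.bagCost Z est)).val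
  let home := (P.homeProg root).val
  have hcommon : ∀ i j, P.tree.Adj i j → (P.common s(i, j)).Nonempty := by
    intro i j hij
    rw [common_mk]
    exact hP.isTreeDecomposition.bag_inter_nonempty hc hij
  have hlink : ∀ i j, P.tree.Adj i j →
      (P.signProg est i j).val = est i (link s(i, j)) * est j (link s(i, j)) := by
    intro i j hij
    have h := hcommon i j hij
    simp only [link, dif_pos h]
    exact signProg_val est i j h
  have hviol := violations_eq hT root est link hlink
  obtain ⟨h1, h2⟩ := treeDecoder_val hT L est (P.bagCost Z est) root
  refine ⟨est, link, s, home, fun i y => estimatorProg_val_le hP.probed_le X i y, ?_, ?_, ?_,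
    homeProg_val_mem hP.isTreeDecomposition.vertex_inclusion root, ?_⟩
  · intro i j hij
    have h := hcommon i j hij
    simp only [link, dif_pos h]
    rw [← common_mk]
    exact Finset.min'_mem _ _
  -- The number of violations is an integer, so the budgets `L_n` and `⌊L_n⌋` are equivalent.
  · rw [hviol] at h1
    exact (Nat.le_floor_iff hB).1 h1
  · intro s' hs'
    refine h2 s' ?_
    rw [hviol]
    exact (Nat.le_floor_iff hB).2 hs'
  · have hcost : ∀ f : Fin N → Fin n → ℤˣ,
        (fillFin fun i => fillSign fun s => P.costProg Z f i s).val = P.bagCost Z f := by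
      intro f
      funext i s
      rw [fillFin_val, fillSign_val, costProg_val]
    intro v
    simp only [treeDecompositionDecoder, decoder, bind_val, fillFin_val, fetch_val, pure_val,
      readLabel, hcost]
    rfl

/-! ## Running times -/

theorem energyProg_time_le (X : EdgeObs P) (l : List (Fin n)) (y : Fin n → ℤˣ) :
    (P.energyProg X l y).time ≤ l.length * (l.length * (2 * l.length + 9) + 1) := by
  -- For a list of length `m`, one pair costs at most `2 + 1 + 2 (m + 1) + 3 = 2m + 8` steps.
  refine forEach_time_le_mul _ _ _ _ fun acc u _ => forEach_time_le_mul _ _ _ (2 * l.length + 8)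
    fun acc v _ => ?_
  split_ifs
  · simp only [bind_time, tick_time, readEdge, readLabel, pure_time]
    omega
  · simp only [bind_time, tick_time, pure_time]
    omega

/-- A bound for the time of the brute-force search on `m` vertices. -/
def searchTime (m : ℕ) : ℕ :=
  2 ^ (m + 1) * (m + 1) + m * (m * (2 * m + 9) + 1) +
    2 ^ m * (m * (m * (2 * m + 9) + 1) + 1 + 1)

theorem searchTime_mono : Monotone searchTime := by
  intro a b h
  have h1 : 2 ^ (a + 1) ≤ 2 ^ (b + 1) := Nat.pow_le_pow_right (by norm_num) (by omega)
  have h2 : 2 ^ a ≤ 2 ^ b := Nat.pow_le_pow_right (by norm_num) h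
  simp only [searchTime]
  gcongr

theorem estimatorProg_time_le (X : EdgeObs P) (l : List (Fin n)) :
    (P.estimatorProg X l).time ≤ searchTime l.length := by
  simp only [estimatorProg, bind_time, tick_time, pure_time, searchTime]
  have h1 := P.energyProg_time_le X l fun _ => 1
  have h2 := forEach_time_le_mul (labelings l) ((P.energyProg X l fun _ => 1).val, fun _ => 1)
    (fun (best : ℕ × (Fin n → ℤˣ)) y => do
      let e ← P.energyProg X l y
      tick 1
      pure (if e < best.1 then (e, y) else best))
    (l.length * (l.length * (2 * l.length + 9) + 1) + 1) (by
      intro best y _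
      have := P.energyProg_time_le X l y
      simp only [bind_time, tick_time, pure_time]
      omega)
  rw [length_labelings] at h2
  omega

theorem costProg_time_le {w : ℕ} (hb : ∀ i, (P.bag i).card ≤ w) (he : ∀ i, (P.ext i).card ≤ w)
    (Z : VertexObs n) (est : Fin N → Fin n → ℤˣ) (i : Fin N) (s : ℤˣ) :
    (P.costProg Z est i s).time ≤ w * (w + 6) := by
  refine (forEach_time_le_mul _ _ _ (w + 5) fun acc v _ => ?_).trans ?_
  · have := he i
    simp only [bind_time, tick_time, pure_time, readLabel, fetch_time]
    omega
  · rw [Finset.length_sort]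
    exact Nat.mul_le_mul_right _ (hb i)

theorem linkProg_time_le {w : ℕ} (hb : ∀ i, (P.bag i).card ≤ w) (i j : Fin N) :
    (P.linkProg i j).time ≤ w * (w + 3) := by
  refine (forEach_time_le_mul _ _ _ (w + 2) fun acc v _ => ?_).trans ?_
  · have := hb j
    simp only [bind_time, tick_time, pure_time]
    omega
  · rw [Finset.length_sort]
    exact Nat.mul_le_mul_right _ (hb i)

theorem signProg_time_le {w : ℕ} (hb : ∀ i, (P.bag i).card ≤ w) (he : ∀ i, (P.ext i).card ≤ w)
    (est : Fin N → Fin n → ℤˣ) (i j : Fin N) :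
    (P.signProg est i j).time ≤ w * (w + 3) + 2 * w + 3 := by
  have h1 := P.linkProg_time_le hb i j
  have h2 := he i
  have h3 := he j
  simp only [signProg, bind_time]
  cases (P.linkProg i j).val with
  | none => simp only [pure_time]; omega
  | some v => simp only [bind_time, readLabel, tick_time, pure_time]; omega

theorem homeProg_time_le {w : ℕ} (hb : ∀ i, (P.bag i).card ≤ w) (root : Fin N) :
    (P.homeProg root).time ≤ n + N * (2 * w + 1) := by
  have h1 : (fillFin fun _ : Fin n => (pure root : Timed (Fin N))).time = n := by
    simp [fillFin]
  simp only [homeProg, bind_time, h1]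
  have h2 := forEach_time_le_mul (List.finRange N)
    (fillFin fun _ : Fin n => (pure root : Timed (Fin N))).val (fun h i =>
    forEach ((P.bag i).sort (· ≤ ·)) h fun h v => do
      tick 1
      pure (Function.update h v i)) (2 * w) (by
    intro h i _
    refine (forEach_time_le_mul _ _ _ 1 fun h v _ => ?_).trans ?_
    · simp
    · rw [Finset.length_sort]
      have := hb i
      omega)
  rw [List.length_finRange] at h2
  omega

theorem fillUpTo_time_le {α : Type} (L : ℕ) (f : ℕ → Timed α) (c : ℕ)
    (h : ∀ k ≤ L, (f k).time ≤ c) : (fillUpTo L f).time ≤ (L + 1) * (c + 1) := by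
  have := Finset.sum_le_card_nsmul (Finset.range (L + 1)) (fun k => (f k).time + 1) (c + 1)
    fun k hk => Nat.add_le_add_right (h k (by rw [Finset.mem_range] at hk; omega)) 1
  simpa [fillUpTo] using this

theorem fillFin_time_le {α : Type} {m : ℕ} (f : Fin m → Timed α) (c : ℕ)
    (h : ∀ i, (f i).time ≤ c) : (fillFin f).time ≤ m * (c + 1) := by
  have := Finset.sum_le_card_nsmul Finset.univ (fun i => (f i).time + 1) (c + 1)
    fun i _ => Nat.add_le_add_right (h i) 1
  simpa [fillFin] using this

theorem fillSign_time_le {α : Type} (f : ℤˣ → Timed α) (c : ℕ) (h : ∀ s, (f s).time ≤ c) :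
    (fillSign f).time ≤ 2 + 2 * c := by
  have h1 := h 1
  have h2 := h (-1)
  rw [fillSign_time]
  omega

theorem baseTable_time_le (L : ℕ) (cost : Fin N → ℤˣ → ℕ) (u : Fin N) :
    (baseTable L cost u).time ≤ 8 * (L + 1) := by
  refine (fillSign_time_le _ _ fun s => fillUpTo_time_le L _ 2 fun k _ => ?_).trans (by omega)
  simp

theorem messageTable_time_le (L : ℕ) (sg : ℤˣ) (g : Table N) :
    (messageTable L sg g).time ≤ 14 * (L + 1) := by
  refine (fillSign_time_le _ _ fun s => fillUpTo_time_le L _ 5 fun k _ => ?_).trans (by omega)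
  split_ifs <;> simp [better]

theorem attachFirst_time_le (L : ℕ) (base h : Table N) :
    (attachFirst L base h).time ≤ 12 * (L + 1) := by
  refine (fillSign_time_le _ _ fun s => fillUpTo_time_le L _ 4 fun k _ => ?_).trans (by omega)
  simp [addCells]

theorem attachNext_time_le (L : ℕ) (g h : Table N) :
    (attachNext L g h).time ≤ 18 * (L + 1) ^ 2 := by
  refine (fillSign_time_le _ _ fun s => fillUpTo_time_le L _ (4 + L * 8) fun k hk => ?_).trans ?_
  · simp only [bind_time, fetch_time, addCells, tick_time, pure_time]
    refine le_trans (Nat.add_le_add_left (Nat.add_le_add_left (Nat.add_le_add_left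
      (forEach_time_le_mul _ _ _ 7 fun c j _ => ?_) _) _) _) ?_
    · simp [better]
    · rw [List.length_range]
      omega
  · nlinarith

/-- The time of the dynamic program. -/
theorem solveProg_time_le (hT : P.tree.IsTree) {w : ℕ} (hb : ∀ i, (P.bag i).card ≤ w)
    (he : ∀ i, (P.ext i).card ≤ w) (L : ℕ) (est : Fin N → Fin n → ℤˣ)
    (cost : Fin N → ℤˣ → ℕ) (r : Fin N) (fuel : ℕ) (u : Fin N)
    (hfuel : N ≤ fuel + P.tree.dist r u) :
    (P.solveProg L est cost fuel (P.above r u) u).time +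
        (w * (w + 3) + 2 * w + 4 + 14 * (L + 1)) ≤
      ∑ x ∈ P.below r u, (P.treeDeg + (w * (w + 3) + 2 * w + 4) + 34 * (L + 1) +
        ((P.children (P.above r x) x).length - 1) * (18 * (L + 1) ^ 2)) := by
  -- The extra `κ + 14 (L + 1)` on the left prepays the edge sign and the message that the parent
  -- will compute from this table. The own share `34 (L + 1)` consists of `8` for the base table,
  -- `12` for the first child and `14` for the prepayment.
  set κ := w * (w + 3) + 2 * w + 4 with hκ
  set f : Fin N → ℕ := fun x => P.treeDeg + κ + 34 * (L + 1) +
    ((P.children (P.above r x) x).length - 1) * (18 * (L + 1) ^ 2) with hf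
  induction fuel generalizing u with
  | zero => have := dist_lt hT r u; omega
  | succ fuel ih =>
    have hnd := P.nodup_children (P.above r u) u
    have hmem := fun c => (mem_children hT (P := P) (r := r) (u := u) (c := c)).1
    have hsum : ∑ x ∈ P.below r u, f x =
        f u + ((P.children (P.above r u) u).map fun c => ∑ x ∈ P.below r c, f x).sum := by
      rw [below_eq hT, Finset.sum_union, Finset.sum_singleton, Finset.sum_biUnion,
        List.sum_toFinset _ hnd]
      · intro c hc d hd hcd
        obtain ⟨h1, h2⟩ := hmem c (by simpa using hc)
        obtain ⟨h3, h4⟩ := hmem d (by simpa using hd)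
        exact disjoint_below hT h1 h3 (h2.trans h4.symm) hcd
      · rw [Finset.disjoint_singleton_left, Finset.mem_biUnion]
        rintro ⟨c, hc, hu⟩
        obtain ⟨h1, h2⟩ := hmem c (by simpa using hc)
        rw [mem_below, ← h2] at hu
        exact not_below_child hT h1 hu
    have hchild : ∀ c ∈ P.children (P.above r u) u,
        (P.solveProg L est cost fuel (some u) c).time + (κ + 14 * (L + 1)) ≤
          ∑ x ∈ P.below r c, f x := by
      intro c hc
      obtain ⟨h1, h2⟩ := hmem c hc
      have h3 := (parent_spec hT h1).2
      rw [h2] at h3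
      have := ih c (by omega)
      rwa [above_child h1 h2] at this
    have hdeg : ((P.tree.neighborFinset u).sort (· ≤ ·)).length ≤ P.treeDeg := by
      rw [Finset.length_sort, SimpleGraph.card_neighborFinset_eq_degree]
      exact P.tree.degree_le_maxDegree u
    have hbase := baseTable_time_le L cost u
    rw [hsum, solveProg_succ]
    have hfu : f u = P.treeDeg + κ + 34 * (L + 1) +
      ((P.children (P.above r u) u).length - 1) * (18 * (L + 1) ^ 2) := rfl
    rw [hfu]
    simp only [bind_time, tick_time]
    revert hchild
    clear hfu hsum hmem hnd
    cases P.children (P.above r u) u with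
    | nil =>
      intro _
      simp only [pure_time, List.map_nil, List.sum_nil, List.length_nil]
      omega
    | cons c cs =>
      intro hchild
      have h1 := hchild c (by simp)
      have hs := fun d => P.signProg_time_le hb he est u d
      have hfirst : (P.firstProg L est cost fuel u (baseTable L cost u).val c).time ≤
          ∑ x ∈ P.below r c, f x + 12 * (L + 1) := by
        have h2 := hs c
        have h3 := messageTable_time_le L (P.signProg est u c).val
          (P.solveProg L est cost fuel (some u) c).val
        have h4 := attachFirst_time_le L (baseTable L cost u).val (messageTable L
          (P.signProg est u c).val (P.solveProg L est cost fuel (some u) c).val).val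
        simp only [firstProg, bind_time]
        omega
      have hrest : ∀ t, (forEach cs t (P.childProg L est cost fuel u)).time ≤
          (cs.map fun c => ∑ x ∈ P.below r c, f x).sum + cs.length * (18 * (L + 1) ^ 2) := by
        intro t
        -- The `- 1` leaves room for the step that the loop itself takes; it is available because
        -- `κ` exceeds the time of `signProg` by one.
        refine (forEach_time_le _ _ _
          (fun c => ∑ x ∈ P.below r c, f x + 18 * (L + 1) ^ 2 - 1) fun t d hd => ?_).trans ?_
        · have h0 := hchild d (by simp [hd])
          have h2 := hs d
          have h3 := messageTable_time_le L (P.signProg est u d).val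
            (P.solveProg L est cost fuel (some u) d).val
          have h4 := attachNext_time_le L t (messageTable L
            (P.signProg est u d).val (P.solveProg L est cost fuel (some u) d).val).val
          simp only [childProg, bind_time]
          omega
        · have : ∀ d, ∑ x ∈ P.below r d, f x + 18 * (L + 1) ^ 2 - 1 + 1 =
              ∑ x ∈ P.below r d, f x + 18 * (L + 1) ^ 2 := by
            intro d
            have : 0 < (L + 1) ^ 2 := by positivity
            omega
          simp only [this, List.sum_map_add]
          simp
      have h5 := hrest (P.firstProg L est cost fuel u (baseTable L cost u).val c).val
      simp only [bind_time, List.map_cons, List.sum_cons, List.length_cons, Nat.add_sub_cancel]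
      omega

/-- The number of ways in which the subtrees branch. -/
noncomputable def branching (P : Setup n N) (r : Fin N) : ℕ :=
  ∑ x, ((P.children (P.above r x) x).length - 1)

theorem treeDecoder_time_le (hT : P.tree.IsTree) {w : ℕ} (hb : ∀ i, (P.bag i).card ≤ w)
    (he : ∀ i, (P.ext i).card ≤ w) (L : ℕ) (est : Fin N → Fin n → ℤˣ)
    (cost : Fin N → ℤˣ → ℕ) (r : Fin N) :
    (P.treeDecoder L r est cost).time ≤
      N * (P.treeDeg + (w * (w + 3) + 2 * w + 4) + 34 * (L + 1) + 3) +
        P.branching r * (18 * (L + 1) ^ 2) := by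
  have h1 := P.solveProg_time_le hT hb he L est cost r N r (by omega)
  rw [above_root, below_root_eq_univ hT, Finset.sum_add_distrib, Finset.sum_const,
    Finset.card_univ, Fintype.card_fin, smul_eq_mul, ← Finset.sum_mul] at h1
  obtain ⟨⟨s, -, -, h3⟩, -⟩ := P.isOptimal_root hT L est cost r
  have h4 : (fillFin fun _ : Fin N => (pure 1 : Timed ℤˣ)).time = N := by simp [fillFin]
  have h5 := (h3 (fillFin fun _ : Fin N => (pure 1 : Timed ℤˣ)).val).2
  rw [Finset.card_univ, Fintype.card_fin] at h5
  simp only [treeDecoder, bind_time, fetch_time, fetch_val, h4]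
  have h6 : ∀ a b : ℕ × Labels N, (better a b).time = 1 := fun _ _ => rfl
  rw [h6, branching]
  -- The `3N` steps fill the array and traverse the `2N - 1` nodes of the stored labeling; the final
  -- selection is paid from the slack in `h1`.
  have h7 : N * (P.treeDeg + (w * (w + 3) + 2 * w + 4) + 34 * (L + 1) + 3) =
    N * (P.treeDeg + (w * (w + 3) + 2 * w + 4) + 34 * (L + 1)) + 3 * N := by ring
  rw [h7]
  omega

theorem decoder_time_le (hT : P.tree.IsTree) {w : ℕ} (hb : ∀ i, (P.bag i).card ≤ w)
    (he : ∀ i, (P.ext i).card ≤ w) (hN : N ≤ n) (L : ℕ) (r : Fin N) (X : EdgeObs P)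
    (Z : VertexObs n) :
    (P.decoder L r X Z).time ≤
      n * (searchTime w + P.treeDeg + 3 * w * (w + 3) + 20 * w + 60) * (L + 1) +
        P.branching r * (18 * (L + 1) ^ 2) := by
  simp only [decoder, bind_time]
  have h1 : (fillFin fun i => P.estimatorProg X ((P.ext i).sort (· ≤ ·))).time ≤
      N * (searchTime w + 1) := by
    refine fillFin_time_le _ _ fun i => (P.estimatorProg_time_le X _).trans (searchTime_mono ?_)
    rw [Finset.length_sort]
    exact he i
  set est := (fillFin fun i => P.estimatorProg X ((P.ext i).sort (· ≤ ·))).val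
  have h2 : (fillFin fun i => fillSign fun s => P.costProg Z est i s).time ≤
      N * (2 + 2 * (w * (w + 6)) + 1) :=
    fillFin_time_le _ _ fun i =>
      fillSign_time_le _ _ fun s => P.costProg_time_le hb he Z est i s
  set cost := (fillFin fun i => fillSign fun s => P.costProg Z est i s).val
  have h3 := P.treeDecoder_time_le hT hb he L est cost r
  set s := (P.treeDecoder L r est cost).val
  have h4 := P.homeProg_time_le hb r
  set home := (P.homeProg r).val
  have h5 : (fillFin fun v => do
      let i ← fetch home v
      let a ← fetch s i
      let y ← readLabel (P.ext i).card (est i) v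
      tick 1
      pure (a * y) : Timed (Fin n → ℤˣ)).time ≤ n * (w + 5) := by
    refine fillFin_time_le _ (w + 4) fun v => ?_
    have := he (home v)
    simp only [bind_time, fetch_time, fetch_val, readLabel, tick_time, pure_time]
    omega
  have hsum : N * (searchTime w + 1) + (N * (2 + 2 * (w * (w + 6)) + 1) +
      ((N * (P.treeDeg + (w * (w + 3) + 2 * w + 4) + 34 * (L + 1) + 3)) +
        ((n + N * (2 * w + 1)) + n * (w + 5)))) ≤
      n * (searchTime w + P.treeDeg + 3 * w * (w + 3) + 20 * w + 60) * (L + 1) := by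
    calc _ ≤ n * (searchTime w + 1) + (n * (2 + 2 * (w * (w + 6)) + 1) +
        ((n * (P.treeDeg + (w * (w + 3) + 2 * w + 4) + 34 * (L + 1) + 3)) +
          ((n + n * (2 * w + 1)) + n * (w + 5)))) := by gcongr
      _ = n * ((searchTime w + P.treeDeg + 3 * w * (w + 3) + 11 * w + 18) + 34 * (L + 1)) := by ring
      _ ≤ n * ((searchTime w + P.treeDeg + 3 * w * (w + 3) + 20 * w + 60) * (L + 1)) := by
          refine Nat.mul_le_mul_left _ ?_
          generalize searchTime w + P.treeDeg + 3 * w * (w + 3) = z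
          nlinarith [Nat.zero_le (z * L), Nat.zero_le (w * L)]
      _ = _ := by ring
  omega

theorem branching_le (r : Fin N) : P.branching r ≤ N * P.treeDeg := by
  refine (Finset.sum_le_card_nsmul _ _ P.treeDeg fun x _ => ?_).trans (by simp)
  have h1 : (P.children (P.above r x) x).length ≤ ((P.tree.neighborFinset x).sort (· ≤ ·)).length :=
    List.length_filter_le _ _
  rw [Finset.length_sort, SimpleGraph.card_neighborFinset_eq_degree] at h1
  have h2 := P.tree.degree_le_maxDegree x
  rw [treeDeg]
  omega

theorem degree_le_two_of_path (φ : P.tree ≃g SimpleGraph.pathGraph N) (x : Fin N) :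
    (P.tree.neighborFinset x).card ≤ 2 := by
  have : (P.tree.neighborFinset x).card ≤ ({(φ x : ℕ) - 1, (φ x : ℕ) + 1} : Finset ℕ).card := by
    refine Finset.card_le_card_of_injOn (fun y => (φ y : ℕ)) ?_ ?_
    · intro y hy
      have h1 : P.tree.Adj x y := by simpa using hy
      have h2 := φ.map_adj_iff.2 h1
      rw [SimpleGraph.pathGraph_adj] at h2
      simp only [Finset.coe_insert, Finset.coe_singleton, Set.mem_insert_iff,
        Set.mem_singleton_iff]
      omega
    · intro y _ z _ h
      exact φ.injective (Fin.ext h)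
  exact this.trans Finset.card_le_two

/-- Each component has at most two neighbours, and one of them is its parent unless it is the root.
Only the root can have a second child. -/
theorem branching_le_one_of_path (hT : P.tree.IsTree) (φ : P.tree ≃g SimpleGraph.pathGraph N)
    (r : Fin N) : P.branching r ≤ 1 := by
  rw [branching, ← Finset.sum_erase_add _ _ (Finset.mem_univ r)]
  have h1 : ∀ x ∈ Finset.univ.erase r, (P.children (P.above r x) x).length - 1 = 0 := by
    intro x hx
    have hxr : x ≠ r := (Finset.mem_erase.1 hx).1
    have hsub : (P.children (P.above r x) x).toFinset ⊆
        (P.tree.neighborFinset x).erase (parent P.tree r x) := by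
      intro c hc
      rw [List.mem_toFinset] at hc
      obtain ⟨h1, h2⟩ := (mem_children hT).1 hc
      rw [Finset.mem_erase, SimpleGraph.mem_neighborFinset, adj_iff_parent hT r]
      refine ⟨?_, Or.inr ⟨h1, h2.symm⟩⟩
      rintro rfl
      have h4 := (parent_spec hT h1).2
      have h5 := (parent_spec hT hxr).2
      rw [h2] at h4; omega
    have h2 := Finset.card_le_card hsub
    rw [List.toFinset_card_of_nodup (nodup_children _ _), Finset.card_erase_of_mem
      (by simpa using parent_adj hT hxr)] at h2
    have h3 := P.degree_le_two_of_path φ x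
    omega
  rw [Finset.sum_eq_zero h1, zero_add]
  have h2 : (P.children (P.above r r) r).length ≤ ((P.tree.neighborFinset r).sort (· ≤ ·)).length :=
    List.length_filter_le _ _
  rw [Finset.length_sort] at h2
  have := P.degree_le_two_of_path φ r
  omega

end Setup

/-! ## The running time for bounded parameters -/

namespace Setup

variable {n N : ℕ} {P : Setup n N}

/-- A constant with `L_n + 1 ≤ C * ⌈p ^ (Δ / 2) * n⌉ * log n`. -/
def budgetConst (D : ℕ) : ℝ := 16 * D * (2 * 4 ^ D + D ^ 2) + 2

/-- The constant factor of the time that is not spent on merging subtrees. -/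
def linearConst (D : ℕ) : ℕ :=
  searchTime (D + 1) + D + 3 * (D + 1) * ((D + 1) + 3) + 20 * (D + 1) + 60

theorem half_le_log (hn : 2 ≤ n) : 1 / 2 ≤ Real.log n := by
  have h1 : (1 / 2 : ℝ) ≤ Real.log 2 := by have := Real.log_two_gt_d9; linarith
  exact h1.trans (Real.log_le_log (by norm_num) (by exact_mod_cast hn))

theorem one_le_ceil (hn : 2 ≤ n) {p : ℝ} (hp : 0 < p) (Δ : ℕ) :
    (1 : ℝ) ≤ ⌈p ^ ((Δ : ℝ) / 2) * n⌉₊ := by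
  have h0 : (0 : ℝ) < n := by exact_mod_cast (by omega : 0 < n)
  have : 0 < ⌈p ^ ((Δ : ℝ) / 2) * n⌉₊ := Nat.ceil_pos.2 (by positivity)
  exact_mod_cast this

/-- With `x = ⌈p ^ (Δ/2) n⌉` one has `Σ ≤ x`. As `x ≥ 1` and `log n ≥ 1 / 2`, the quantities `x`,
`log n` and `1` are all at most `2 x log n`; the last one gives the `+ 2` in `budgetConst`. -/
theorem BoundedBy.floor_treeBudget_le {D : ℕ} (hD : P.BoundedBy D) (hP : P.IsAdmissible)
    (hn : 2 ≤ n) {p : ℝ} (hp : 0 < p) (hp1 : p ≤ 1) {Δ : ℕ} (hΔ : ∀ i, Δ ≤ P.mincutStar i) :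
    (⌊P.treeBudget p (1 / n)⌋₊ : ℝ) + 1 ≤
      budgetConst D * (⌈p ^ ((Δ : ℝ) / 2) * n⌉₊ * Real.log n) := by
  have hn2 : (2 : ℝ) ≤ n := by exact_mod_cast hn
  have hδ : (0 : ℝ) < 1 / n := by positivity
  have hδ2 : (1 : ℝ) / n ≤ 1 / 2 := one_div_le_one_div_of_le (by norm_num) hn2
  have hl := half_le_log hn
  have hl0 : 0 ≤ Real.log n := by linarith
  have hq1 := one_le_ceil hn hp Δ
  set x : ℝ := (⌈p ^ ((Δ : ℝ) / 2) * n⌉₊ : ℝ) with hx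
  have hS : P.cutSum p ≤ x := by
    refine (hP.cutSum_le hn hp hp1 hΔ).trans (le_trans ?_ (Nat.le_ceil _))
    gcongr
    rw [← Real.rpow_natCast]
    refine Real.rpow_le_rpow_of_exponent_ge hp hp1 ?_
    have : Δ ≤ 2 * ((Δ + 1) / 2) := by omega
    have : (Δ : ℝ) ≤ 2 * ((Δ + 1) / 2 : ℕ) := by exact_mod_cast this
    linarith
  have hK := P.errBudget_le (p := p) hδ hδ2
  have hK0 := P.errBudget_nonneg hp hδ hδ2
  rw [one_div_one_div] at hK
  have h2 : (P.edgeDegStar : ℝ) ≤ D := by exact_mod_cast hD.edgeDegStar_le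
  have h3 : (P.maxExtEdges : ℝ) ≤ D := by exact_mod_cast hD.maxExtEdges_le
  have h4 : (P.treeDeg : ℝ) ≤ D := by exact_mod_cast hD.treeDeg_le
  have h6 : (4 : ℝ) ^ P.widStar ≤ 4 ^ D := pow_le_pow_right₀ (by norm_num) hD.widStar_le
  have hx1 : x ≤ 2 * (x * Real.log n) := by nlinarith
  have hx2 : Real.log n ≤ x * Real.log n := le_mul_of_one_le_left hl0 hq1
  have hB0 : 0 ≤ P.treeBudget p (1 / n) := by rw [treeBudget]; positivity
  have hS0 := P.cutSum_nonneg hp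
  have hb : P.treeBudget p (1 / n) ≤ 16 * D * (2 * 4 ^ D + D ^ 2) * (x * Real.log n) := by
    calc P.treeBudget p (1 / n) = P.treeDeg * P.errBudget p (1 / n) := rfl
      _ ≤ D * (16 * (4 ^ P.widStar * P.cutSum p +
          P.edgeDegStar * P.maxExtEdges * Real.log n)) := by gcongr
      _ ≤ D * (16 * (4 ^ D * (2 * (x * Real.log n)) + D * D * (x * Real.log n))) := by
          gcongr
          exact hS.trans hx1
      _ = _ := by ring
  have := Nat.floor_le hB0
  rw [budgetConst]
  linarith

theorem BoundedBy.decoder_time_le {D : ℕ} (hD : P.BoundedBy D) (hP : P.IsAdmissible)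
    (hn : 2 ≤ n) (L : ℕ) (r : Fin N) (X : EdgeObs P) (Z : VertexObs n) :
    ((P.decoder L r X Z).time : ℝ) ≤
      linearConst D * (n * ((L : ℝ) + 1)) + 18 * P.branching r * ((L : ℝ) + 1) ^ 2 := by
  have he : ∀ i, (P.ext i).card ≤ D + 1 := fun i =>
    (P.card_ext_le_widStar i).trans (Nat.succ_le_succ hD.widStar_le)
  have h := P.decoder_time_le hP.isTreeDecomposition.isTree
    (fun i => (Finset.card_le_card (hP.bag_subset_ext i)).trans (he i)) he (hP.card_le hn) L r X Z
  have h1 : n * (searchTime (D + 1) + P.treeDeg + 3 * (D + 1) * ((D + 1) + 3) +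
      20 * (D + 1) + 60) * (L + 1) ≤ n * linearConst D * (L + 1) := by
    have := hD.treeDeg_le
    rw [linearConst]
    gcongr
  have h2 := h.trans (Nat.add_le_add_right h1 _)
  have h3 : ((P.decoder L r X Z).time : ℝ) ≤
      n * linearConst D * (L + 1) + P.branching r * (18 * (L + 1) ^ 2) := by exact_mod_cast h2
  refine h3.trans (le_of_eq ?_)
  ring

/-- The constant in the bounds for the running time. -/
def timeConst (D : ℕ) : ℝ :=
  2 * linearConst D * budgetConst D + 18 * (D + 1) * budgetConst D ^ 2

theorem budgetConst_pos (D : ℕ) : 0 < budgetConst D := by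
  rw [budgetConst]; positivity

/-- The second logarithm is wasted here, via `log n ≤ 2 (log n) ^ 2`, so that this part fits the
form of the quadratic one. -/
theorem BoundedBy.linear_time_le (D : ℕ) (hn : 2 ≤ n) {x l : ℝ} (hx : 1 ≤ x)
    (hl : l ≤ budgetConst D * (x * Real.log n)) :
    linearConst D * (n * l) ≤
      2 * linearConst D * budgetConst D * (Real.log n ^ 2 * x * n) := by
  have h1 := half_le_log hn
  have hb := budgetConst_pos D
  calc linearConst D * (n * l) ≤ linearConst D * (n * (budgetConst D * (x * Real.log n))) := by
        gcongr
    _ ≤ linearConst D * (n * (budgetConst D * (x * (2 * Real.log n ^ 2)))) := by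
        gcongr
        nlinarith
    _ = _ := by ring

theorem BoundedBy.time_le {D : ℕ} (hD : P.BoundedBy D) (hP : P.IsAdmissible)
    (hn : 2 ≤ n) {p : ℝ} (hp : 0 < p) (hp1 : p ≤ 1) {Δ : ℕ} (hΔ : ∀ i, Δ ≤ P.mincutStar i)
    (r : Fin N) (X : EdgeObs P) (Z : VertexObs n) :
    ((P.treeDecompositionDecoder p (1 / n) r X Z).time : ℝ) ≤
      timeConst D * Real.log n ^ 2 * (⌈p ^ ((Δ : ℝ) / 2) * n⌉₊ : ℝ) ^ 2 * n := by
  have h0 := hD.decoder_time_le hP hn ⌊P.treeBudget p (1 / n)⌋₊ r X Z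
  have h1 := hD.floor_treeBudget_le hP hn hp hp1 hΔ
  have hx := one_le_ceil hn hp Δ
  set x : ℝ := (⌈p ^ ((Δ : ℝ) / 2) * n⌉₊ : ℝ)
  set l : ℝ := (⌊P.treeBudget p (1 / n)⌋₊ : ℝ) + 1 with hldef
  have hl0 : 0 ≤ l := by positivity
  have h2 := linear_time_le D hn hx h1
  have hb := budgetConst_pos D
  have h3 : (P.branching r : ℝ) ≤ n * D := by
    exact_mod_cast (P.branching_le r).trans (Nat.mul_le_mul (hP.card_le hn) hD.treeDeg_le)
  have h4 : 18 * (P.branching r : ℝ) * l ^ 2 ≤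
      18 * (D + 1) * budgetConst D ^ 2 * (Real.log n ^ 2 * x ^ 2 * n) := by
    calc 18 * (P.branching r : ℝ) * l ^ 2
        ≤ 18 * (n * (D + 1)) * (budgetConst D * (x * Real.log n)) ^ 2 := by
          gcongr
          refine h3.trans ?_
          gcongr
          linarith
      _ = _ := by ring
  have h5 : 2 * linearConst D * budgetConst D * (Real.log n ^ 2 * x * n) ≤
      2 * linearConst D * budgetConst D * (Real.log n ^ 2 * x ^ 2 * n) := by
    gcongr
    nlinarith
  refine (h0.trans (add_le_add (h2.trans h5) h4)).trans (le_of_eq ?_)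
  rw [timeConst]
  ring

theorem BoundedBy.time_le_of_path {D : ℕ} (hD : P.BoundedBy D) (hP : P.IsAdmissible)
    (hn : 2 ≤ n) {p : ℝ} (hp : 0 < p) (hp1 : p ≤ 1) {Δ : ℕ} (hΔ : ∀ i, Δ ≤ P.mincutStar i)
    (φ : P.tree ≃g SimpleGraph.pathGraph N) (r : Fin N) (X : EdgeObs P) (Z : VertexObs n) :
    ((P.treeDecompositionDecoder p (1 / n) r X Z).time : ℝ) ≤
      timeConst D * Real.log n ^ 2 * (⌈p ^ ((Δ : ℝ) / 2) * n⌉₊ : ℝ) * n := by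
  have h0 := hD.decoder_time_le hP hn ⌊P.treeBudget p (1 / n)⌋₊ r X Z
  have h1 := hD.floor_treeBudget_le hP hn hp hp1 hΔ
  have hx := one_le_ceil hn hp Δ
  -- With branching at most one the term `l ^ 2` occurs without a factor `n`, and `x ≤ n` turns its
  -- `x ^ 2` into `x n`.
  have hxn : (⌈p ^ ((Δ : ℝ) / 2) * n⌉₊ : ℝ) ≤ n := by
    have : ⌈p ^ ((Δ : ℝ) / 2) * n⌉₊ ≤ n := by
      rw [Nat.ceil_le]
      exact mul_le_of_le_one_left (by positivity) (Real.rpow_le_one hp.le hp1 (by positivity))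
    exact_mod_cast this
  set x : ℝ := (⌈p ^ ((Δ : ℝ) / 2) * n⌉₊ : ℝ)
  set l : ℝ := (⌊P.treeBudget p (1 / n)⌋₊ : ℝ) + 1 with hldef
  have hl0 : 0 ≤ l := by positivity
  have h2 := linear_time_le D hn hx h1
  have hb := budgetConst_pos D
  have h3 : (P.branching r : ℝ) ≤ D + 1 := by
    have : P.branching r ≤ D + 1 :=
      (P.branching_le_one_of_path hP.isTreeDecomposition.isTree φ r).trans (by omega)
    exact_mod_cast this
  have h4 : 18 * (P.branching r : ℝ) * l ^ 2 ≤
      18 * (D + 1) * budgetConst D ^ 2 * (Real.log n ^ 2 * x * n) := by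
    calc 18 * (P.branching r : ℝ) * l ^ 2
        ≤ 18 * (D + 1) * (budgetConst D * (x * Real.log n)) ^ 2 := by gcongr
      _ = 18 * (D + 1) * budgetConst D ^ 2 * (Real.log n ^ 2 * x * x) := by ring
      _ ≤ _ := by gcongr
  refine (h0.trans (add_le_add h2 h4)).trans (le_of_eq ?_)
  rw [timeConst]
  ring

theorem timeConst_nonneg (D : ℕ) : 0 ≤ timeConst D := by
  have := budgetConst_pos D
  rw [timeConst]
  positivity

/-- The constant in the error bounds for bounded parameters. -/
def errorConst (D : ℕ) : ℝ := 100 * D ^ 2 * (4 ^ D + D ^ 2) * (3 * D)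

/-- The error bounds for bounded parameters. -/
theorem BoundedBy.measure_error_le {D : ℕ} (hD : P.BoundedBy D) (hP : P.IsAdmissible)
    (hc : P.probed.Connected) (hn : 2 ≤ n) (Y : Fin n → ℤˣ) {p q : ℝ} (hp : 0 < p) (hpq : p < q)
    (hq : q < 1 / 2) {C s : ℝ} (hC : errorConst D ≤ C) (hs : P.cutSum p ≤ s) :
    1 - 1 / (n : ℝ) ≤ (obsLaw P Y p q).real
      {m | ∀ Yhat : Fin n → ℤˣ, P.IsOutput p (1 / n) m.1 m.2 Yhat →
        (hammingDist Yhat Y : ℝ) ≤ C / (1 / 2 - q) ^ 2 * Real.log n * (s + Real.log n)} := by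
  have : Fact (p ∈ Set.Icc (0 : ℝ) 1) := ⟨hp.le, by linarith⟩
  have : Fact (q ∈ Set.Icc (0 : ℝ) 1) := ⟨by linarith, by linarith⟩
  have : IsProbabilityMeasure (obsLaw P Y p q) := by rw [obsLaw]; infer_instance
  have hn2 : (2 : ℝ) ≤ n := by exact_mod_cast hn
  have hl := half_le_log hn
  refine (hP.measure_error_le hc hn Y hp hpq hq (by positivity)
    (one_div_le_one_div_of_le (by norm_num) hn2)).trans (measureReal_mono fun m hm Yhat hY => ?_)
  refine (hm Yhat hY).trans ((hD.bound_le hP hn hp hq).trans ?_)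
  rw [← errorConst]
  have hS := P.cutSum_nonneg hp
  have h1 : 0 < 1 / 2 - q := by linarith
  have hC0 : 0 ≤ errorConst D := by rw [errorConst]; positivity
  have hC1 : 0 ≤ C := hC0.trans hC
  gcongr

end Setup

end TreeDecoding

theorem mainTheorem1 :
    -- the explicit bound, for every output of the algorithm, and correctness of the program
    (∃ C : ℝ, 0 < C ∧
      ∀ (n N : ℕ) (P : TreeDecoding.Setup n N), P.IsAdmissible → P.probed.Connected → 2 ≤ n →
      ∀ (Y : Fin n → ℤˣ) (p q δ : ℝ), 0 < p → p < q → q < 1 / 2 → 0 < δ → δ ≤ 1 / 2 →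
        1 - δ ≤ (TreeDecoding.obsLaw P Y p q).real
          {m | ∀ Yhat : Fin n → ℤˣ, P.IsOutput p δ m.1 m.2 Yhat →
            (hammingDist Yhat Y : ℝ) ≤
              C / (1 / 2 - q) ^ 2 * (P.probed.maxDegree * P.edgeDegStar) *
                (4 ^ P.widStar * P.cutSum p
                  + P.edgeDegStar * P.maxExtEdges * Real.log (1 / δ)) *
                (P.wid + P.treeDeg * Real.log n)} ∧
        ∀ (root : Fin N) (X : TreeDecoding.EdgeObs P) (Z : TreeDecoding.VertexObs n),
          P.IsOutput p δ X Z (P.treeDecompositionDecoder p δ root X Z).val) ∧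
    -- the rates for bounded parameters and failure probability `1 / n`
    (∀ D : ℕ, ∃ C : ℝ, 0 < C ∧
      ∀ (n N : ℕ) (P : TreeDecoding.Setup n N), P.IsAdmissible → P.BoundedBy D →
        P.probed.Connected → 2 ≤ n →
      ∀ (Y : Fin n → ℤˣ) (p q : ℝ), 0 < p → p < q → q < 1 / 2 →
        -- the error in terms of the extended min-cuts
        1 - 1 / (n : ℝ) ≤ (TreeDecoding.obsLaw P Y p q).real
          {m | ∀ Yhat : Fin n → ℤˣ, P.IsOutput p (1 / n) m.1 m.2 Yhat →
            (hammingDist Yhat Y : ℝ) ≤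
              C / (1 / 2 - q) ^ 2 * Real.log n * (P.cutSum p + Real.log n)} ∧
        ∀ Δ : ℕ, (∀ i, Δ ≤ P.mincutStar i) →
          -- the error in terms of a lower bound for the extended min-cuts
          1 - 1 / (n : ℝ) ≤ (TreeDecoding.obsLaw P Y p q).real
            {m | ∀ Yhat : Fin n → ℤˣ, P.IsOutput p (1 / n) m.1 m.2 Yhat →
              (hammingDist Yhat Y : ℝ) ≤
                C / (1 / 2 - q) ^ 2 * Real.log n * (p ^ ((Δ + 1) / 2) * n + Real.log n)} ∧
          -- the running time
          ∀ (root : Fin N) (X : TreeDecoding.EdgeObs P) (Z : TreeDecoding.VertexObs n),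
            ((P.treeDecompositionDecoder p (1 / n) root X Z).time : ℝ) ≤
              C * Real.log n ^ 2 * (⌈p ^ ((Δ : ℝ) / 2) * n⌉₊ : ℝ) ^ 2 * n ∧
            (Nonempty (P.tree ≃g SimpleGraph.pathGraph N) →
              ((P.treeDecompositionDecoder p (1 / n) root X Z).time : ℝ) ≤
                C * Real.log n ^ 2 * (⌈p ^ ((Δ : ℝ) / 2) * n⌉₊ : ℝ) * n)) := by
  refine ⟨⟨100, by norm_num, ?_⟩, fun D => ?_⟩
  · intro n N P hP hc hn Y p q δ hp hpq hq hδ hδ2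
    exact ⟨hP.measure_error_le hc hn Y hp hpq hq hδ hδ2,
      fun root X Z => hP.isOutput_decoder hc hp hδ hδ2 root X Z⟩
  -- The sum serves the error and the time bounds at once; the `1` makes it positive.
  · refine ⟨TreeDecoding.Setup.errorConst D + TreeDecoding.Setup.timeConst D + 1, ?_, ?_⟩
    · have := TreeDecoding.Setup.timeConst_nonneg D
      rw [TreeDecoding.Setup.errorConst]
      positivity
    · intro n N P hP hD hc hn Y p q hp hpq hq
      have hE : 0 ≤ TreeDecoding.Setup.errorConst D := by
        rw [TreeDecoding.Setup.errorConst]; positivity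
      have hT := TreeDecoding.Setup.timeConst_nonneg D
      have hp1 : p ≤ 1 := by linarith
      refine ⟨hD.measure_error_le hP hc hn Y hp hpq hq (by linarith) le_rfl, fun Δ hΔ =>
        ⟨hD.measure_error_le hP hc hn Y hp hpq hq (by linarith) (hP.cutSum_le hn hp hp1 hΔ), ?_⟩⟩
      intro root X Z
      refine ⟨(hD.time_le hP hn hp hp1 hΔ root X Z).trans ?_,
        fun ⟨φ⟩ => (hD.time_le_of_path hP hn hp hp1 hΔ φ root X Z).trans ?_⟩
      · gcongr
        linarith
      · gcongr
        linarith
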